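/- Let $S^2$ be the unit sphere with its great-circle distance, and let $K,L\subsetneq S^2$ be closed convex sets with interior points (a closed set with non-empty interior is convex if, with any two of its non-antipodal points, it contains the shorter great-circle arc connecting them). Then the following three statements are equivalent. (1) There exists $\varepsilon>0$ such that for all orientation preserving congruences $\varphi,\psi:S^2\to S^2$ with $\operatorname{int}\big((\varphi K)\cap(\psi L)\big)\neq\emptyset$ and $\operatorname{diam}\big((\varphi K)\cap(\psi L)\big)\le\varepsilon$, the set $(\varphi K)\cap(\psi L)$ has a non-trivial symmetry, i.e. is mapped onto itself by some congruence of $S^2$ (orientation preserving or not) different from the identity. (2) There exists $\varepsilon>0$ such that for all orientation preserving congruences $\varphi,\psi:S^2\to S^2$ with $\operatorname{int}\big((\varphi K)\cap(\psi L)\big)\neq\emptyset$ and $\operatorname{diam}\big((\varphi K)\cap(\psi L)\big)\le\varepsilon$, the set $(\varphi K)\cap(\psi L)$ has an axis of symmetry, i.e. is mapped onto itself by the reflection in some great circle. (3) $K$ and $L$ are two circles (closed discs) of spherical radii in $(0,\pi/2]$. In particular, if there exists $\varepsilon>0$ such that all the intersections $(\varphi K)\cap(\psi L)$ as in (1) are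 centrally symmetric, i.e. are mapped onto themselves by the rotation through the angle $\pi$ about some point of $S^2$, then $K$ and $L$ are two circles (closed discs) of the same radius, which is at most $\pi/2$. -/

import Mathlib

open scoped RealInnerProductSpace

namespace SphericalPlane

/-- Euclidean three-space. -/
abbrev E3 : Type := EuclideanSpace ℝ (Fin 3)

/-- The unit sphere `S²`, with the topology induced from Euclidean three-space. -/
abbrev S2 : Type := Metric.sphere (0 : E3) 1

/-- The action on `S²` of a linear isometry of `ℝ³`. The congruences (isometries) of `S²` are
exactly these maps. -/
noncomputable def act (g : E3 ≃ₗᵢ[ℝ] E3) (x : S2) : S2 :=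
  ⟨g x, by simp⟩

/-- The orientation preserving congruences of `S²`: the rotations, of determinant `1`. -/
def OrientationPreserving (g : E3 ≃ₗᵢ[ℝ] E3) : Prop :=
  LinearMap.det (g.toLinearEquiv : E3 →ₗ[ℝ] E3) = 1

/-- The spherical (great circle) distance of two points of `S²`. -/
noncomputable def sdist (x y : S2) : ℝ :=
  InnerProductGeometry.angle (x : E3) (y : E3)

/-- The diameter of a subset of `S²` for the spherical distance (all distances are at most `π`,
so that the supremum is a true one as soon as the set is non-empty). -/
noncomputable def sdiam (A : Set S2) : ℝ :=
  sSup {d : ℝ | ∃ x ∈ A, ∃ y ∈ A, d = sdist x y}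

/-- The shorter great circle arc between two non-antipodal points `x`, `y` of `S²`: the points of
`S²` that are combinations of `x` and `y` with non-negative coefficients. -/
def shorterArc (x y : S2) : Set S2 :=
  {z : S2 | ∃ a b : ℝ, 0 ≤ a ∧ 0 ≤ b ∧ (z : E3) = a • (x : E3) + b • (y : E3)}

/-- A closed convex set with interior points in `S²`: a closed set with non-empty interior that
contains with any two non-antipodal points the shorter great circle arc connecting them. -/
structure IsClosedConvexWithInterior (K : Set S2) : Prop where
  isClosed : IsClosed K
  nonempty_interior : (interior K).Nonempty
  shorterArc_subset : ∀ x ∈ K, ∀ y ∈ K, x ≠ -y → shorterArc x y ⊆ K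

/-- The (closed, solid) circle with centre `c` and spherical radius `r`. -/
def circle (c : S2) (r : ℝ) : Set S2 :=
  {x : S2 | sdist c x ≤ r}

/-- `A` has a symmetry (orientation preserving or not) different from the identity. -/
def HasNontrivialSymmetry (A : Set S2) : Prop :=
  ∃ g : E3 ≃ₗᵢ[ℝ] E3, g ≠ LinearIsometryEquiv.refl ℝ E3 ∧ act g '' A = A

/-- `A` has an axis of symmetry: a great circle (the one orthogonal to `u`) such that the
reflection in it maps `A` to itself. -/
def HasAxisOfSymmetry (A : Set S2) : Prop :=
  ∃ u : S2, act (ℝ ∙ (u : E3))ᗮ.reflection '' A = A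

/-- `A` is centrally symmetric: for some point `c` of `S²`, the point reflection in `c`,
`x ↦ 2 ⟪c, x⟫ c - x`, i.e. the rotation about `c` through the angle `π`, maps `A` to itself. -/
def IsCentrallySymmetric (A : Set S2) : Prop :=
  ∃ c : S2, act (ℝ ∙ (c : E3)).reflection '' A = A

/-- All sufficiently small intersections with interior points of a directly congruent copy
of `K` and a directly congruent copy of `L` have the property `P`. -/
def SmallIntersectionsSatisfy (P : Set S2 → Prop) (K L : Set S2) : Prop :=
  ∃ ε : ℝ, 0 < ε ∧ ∀ φ ψ : E3 ≃ₗᵢ[ℝ] E3,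
    OrientationPreserving φ → OrientationPreserving ψ →
    (interior (act φ '' K ∩ act ψ '' L)).Nonempty →
    sdiam (act φ '' K ∩ act ψ '' L) ≤ ε →
    P (act φ '' K ∩ act ψ '' L)

/-- `K` is a circle of radius at most `π / 2` (and positive). -/
def IsCircle (K : Set S2) : Prop :=
  ∃ (c : S2) (r : ℝ), 0 < r ∧ r ≤ Real.pi / 2 ∧ K = circle c r

/-- `K` and `L` are congruent circles of radius at most `π / 2`, i.e. of the same radius. -/
def AreCongruentCircles (K L : Set S2) : Prop :=
  ∃ (c d : S2) (r : ℝ), 0 < r ∧ r ≤ Real.pi / 2 ∧ K = circle c r ∧ L = circle d r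

end SphericalPlane

/-!
A closed convex set with interior points on the sphere, different from the sphere, is studied
through the closed convex cone in `ℝ³` that it spans (`Body`, `cone`). After a rotation the cone is,
in the plane `z 2 = 1`, the epigraph of a convex function `f` on the line (`Chart`), and its
boundary is the curve `pt f` on the sphere. The condition on small intersections becomes `SmallSym`.

Two circles have the reflection in the great circle through their centres in common, so only one
implication is hard: if all small intersections of `K` and `L` have a non-trivial symmetry, then `K`
and `L` are circles.

*Lenses.* At a smooth boundary point, short arcs of the boundary are very flat. Hence short arcs of
the boundaries of `K` and `L` with equal chords `p q` can be placed on different sides of a common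
chord so that they bound a lens `K ∩ φ L`, in which `p`, `q` is the only pair of points of maximal
distance (`Lens.inner_ge`). A non-trivial symmetry of the lens permutes `p` and `q`. It follows
(`FlatChart.exists_symmetry`) that the two arcs are congruent, or each of them is symmetric.

*Local circles.* Keeping the arc of `L` fixed, one sees that the short arcs of `K` with a given
chord length are all symmetric, or all congruent to each other. In the second case, by continuity, the
congruences between arcs either all preserve or all reverse the direction of the curve
(`MonoCurve.exists_rigid`). In each case inscribed polygons with equal sides have equal angles, so
that four consecutive vertices are on a circle. Repeated halving shows that the curve is locally
planar, i.e. a circular arc (`MonoCurve.exists_plane`).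

*No corners.* A convex function has points of differentiability, but `K` could have corners. If the
boundary of `K` has a corner `x`, a flat arc of the boundary of `L` cuts a small piece with vertices
`x`, `p`, `q` off `K`. The vertices are the only points of the piece at which supporting planes
enclose a definite angle (`Sharp`), hence a symmetry permutes them. The two ends can be moved
towards `x` at a ratio for which the triangle is scalene, and then the symmetry is the identity
(`CornerLens.eq_refl`, `Chart.dL_eq_dR_of_smallSym`).

*One circle.* So the boundary is locally planar everywhere. As it is connected, it is contained in
one plane (`frontier_planar`), and a cone with such a boundary is the cone over a circle, of radius
at most `π / 2` by convexity (`Body.exists_cap`).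

If the small intersections are centrally symmetric, the symmetry of a lens is a half-turn. This
cannot exchange `p` and `q` and fix the normal of their plane, so that the arcs of `K` and `L` are
congruent, and the radii are equal (`cap_radius_eq`). For two great circles there is nothing to
prove.
-/

open Filter Topology Set

namespace SphericalPlane

/-! ### Vector algebra in three-space -/

/-- The cross product of two vectors of `ℝ³`. -/
noncomputable def cr (a b : E3) : E3 :=
  !₂[a 1 * b 2 - a 2 * b 1, a 2 * b 0 - a 0 * b 2, a 0 * b 1 - a 1 * b 0]

/-- The triple product (determinant) of three vectors of `ℝ³`. -/
noncomputable def trip (a b c : E3) : ℝ := ⟪cr a b, c⟫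

lemma inner_coord (a b : E3) : ⟪a, b⟫ = a 0 * b 0 + a 1 * b 1 + a 2 * b 2 := by
  simp [PiLp.inner_apply, Fin.sum_univ_three, mul_comm]

@[simp] lemma cr_zero (a b : E3) : cr a b 0 = a 1 * b 2 - a 2 * b 1 := by simp [cr]
@[simp] lemma cr_one (a b : E3) : cr a b 1 = a 2 * b 0 - a 0 * b 2 := by simp [cr]
@[simp] lemma cr_two (a b : E3) : cr a b 2 = a 0 * b 1 - a 1 * b 0 := by simp [cr]

lemma trip_coord (a b c : E3) : trip a b c =
    (a 1 * b 2 - a 2 * b 1) * c 0 + (a 2 * b 0 - a 0 * b 2) * c 1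
      + (a 0 * b 1 - a 1 * b 0) * c 2 := by
  simp [trip, inner_coord]

lemma ext_coord {a b : E3} (h0 : a 0 = b 0) (h1 : a 1 = b 1) (h2 : a 2 = b 2) : a = b := by
  ext i; fin_cases i <;> assumption

@[simp] lemma trip_self_left (a b : E3) : trip a b a = 0 := by rw [trip_coord]; ring
@[simp] lemma trip_self_right (a b : E3) : trip a b b = 0 := by rw [trip_coord]; ring
lemma trip_rot (a b c : E3) : trip a b c = trip b c a := by simp only [trip_coord]; ring
lemma trip_swap (a b c : E3) : trip a b c = - trip b a c := by simp only [trip_coord]; ring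
lemma trip_swap' (a b c : E3) : trip a b c = - trip a c b := by simp only [trip_coord]; ring
lemma cr_swap (a b : E3) : cr a b = - cr b a := by
  apply ext_coord <;> simp [mul_comm]

lemma trip_add (a b c d : E3) : trip a b (c + d) = trip a b c + trip a b d := by
  simp [trip, inner_add_right]
lemma trip_sub (a b c d : E3) : trip a b (c - d) = trip a b c - trip a b d := by
  simp [trip, inner_sub_right]
lemma trip_smul (a b c : E3) (t : ℝ) : trip a b (t • c) = t * trip a b c := by
  simp [trip, inner_smul_right]
@[simp] lemma trip_cr (a b : E3) : trip a b (cr a b) = ‖cr a b‖ ^ 2 := by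
  rw [trip, real_inner_self_eq_norm_sq]

lemma norm_cr_sq (a b : E3) : ‖cr a b‖ ^ 2 = ‖a‖ ^ 2 * ‖b‖ ^ 2 - ⟪a, b⟫ ^ 2 := by
  simp only [← real_inner_self_eq_norm_sq, inner_coord, cr_zero, cr_one, cr_two]; ring

lemma inner_cr_left (a b : E3) : ⟪cr a b, a⟫ = 0 := by simp [inner_coord]; ring
lemma inner_cr_right (a b : E3) : ⟪cr a b, b⟫ = 0 := by simp [inner_coord]; ring

lemma continuous_cr : Continuous fun p : E3 × E3 => cr p.1 p.2 := by
  unfold cr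
  fun_prop

/-- Cramer's rule. -/
lemma cramer (a b c z : E3) :
    trip a b c • z = trip z b c • a + trip a z c • b + trip a b z • c := by
  apply ext_coord <;> simp only [trip_coord, PiLp.add_apply, PiLp.smul_apply, smul_eq_mul] <;> ring

lemma eq_of_inner_eq {a b c z w : E3} (h : trip a b c ≠ 0) (ha : ⟪a, z⟫ = ⟪a, w⟫)
    (hb : ⟪b, z⟫ = ⟪b, w⟫) (hc : ⟪c, z⟫ = ⟪c, w⟫) : z = w := by
  have key : trip a b c • (z - w) = ⟪a, z - w⟫ • cr b c + ⟪b, z - w⟫ • cr c a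
      + ⟪c, z - w⟫ • cr a b := by
    apply ext_coord <;> simp only [trip_coord, inner_coord, cr_zero, cr_one, cr_two,
      PiLp.add_apply, PiLp.smul_apply, PiLp.sub_apply, smul_eq_mul] <;> ring
  rw [inner_sub_right, inner_sub_right, inner_sub_right, ha, hb, hc] at key
  simp only [sub_self, zero_smul, add_zero] at key
  exact sub_eq_zero.1 ((smul_eq_zero.1 key).resolve_left h)

/-- The convex cone generated by three vectors. -/
def hull (a b c : E3) : Set E3 :=
  {z | ∃ α β γ : ℝ, 0 ≤ α ∧ 0 ≤ β ∧ 0 ≤ γ ∧ z = α • a + β • b + γ • c}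

lemma left_mem_hull (a b c : E3) : a ∈ hull a b c := ⟨1, 0, 0, by simp⟩
lemma mid_mem_hull (a b c : E3) : b ∈ hull a b c := ⟨0, 1, 0, by simp⟩

/-- Cramer's rule as a criterion for membership in a cone. -/
lemma mem_hull_of_trip {a b c z : E3} (h : 0 < trip a b c) (h1 : 0 ≤ trip z b c)
    (h2 : 0 ≤ trip a z c) (h3 : 0 ≤ trip a b z) : z ∈ hull a b c := by
  refine ⟨trip z b c / trip a b c, trip a z c / trip a b c, trip a b z / trip a b c,
    by positivity, by positivity, by positivity, ?_⟩
  have := cramer a b c z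
  have h' := h.ne'
  calc z = (trip a b c)⁻¹ • (trip a b c • z) := by rw [smul_smul, inv_mul_cancel₀ h', one_smul]
    _ = _ := by rw [this]; simp only [smul_add, smul_smul, div_eq_inv_mul]

/-- Membership in the cone spanned by `a`, `b`, `X` tested by the plane through `a`, `b` and by
two half-spaces whose boundaries pass through `a` and through `b`. -/
lemma mem_hull_of_supports {a b X Na Nb z : E3} (hX : trip a b X < 0)
    (ha : ⟪Na, a⟫ = 0) (hab : 0 < ⟪Na, b⟫) (haX : ⟪Na, X⟫ ≤ 0)
    (hb : ⟪Nb, b⟫ = 0) (hba : 0 < ⟪Nb, a⟫) (hbX : ⟪Nb, X⟫ ≤ 0)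
    (hz : trip a b z ≤ 0) (hza : 0 ≤ ⟪Na, z⟫) (hzb : 0 ≤ ⟪Nb, z⟫) : z ∈ hull a b X := by
  have h' := hX.ne
  have hc := cramer a b X z
  set γ := trip a b z / trip a b X
  set α := trip z b X / trip a b X
  set β := trip a z X / trip a b X
  have hzz : z = α • a + β • b + γ • X := by
    calc z = (trip a b X)⁻¹ • (trip a b X • z) := by rw [smul_smul, inv_mul_cancel₀ h', one_smul]
      _ = _ := by rw [hc]; simp only [smul_add, smul_smul, div_eq_inv_mul, α, β, γ]
  have hγ : 0 ≤ γ := div_nonneg_of_nonpos hz hX.le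
  refine ⟨α, β, γ, ?_, ?_, hγ, hzz⟩
  · rw [hzz, inner_add_right, inner_add_right, inner_smul_right, inner_smul_right,
      inner_smul_right, hb] at hzb
    by_contra hneg
    nlinarith
  · rw [hzz, inner_add_right, inner_add_right, inner_smul_right, inner_smul_right,
      inner_smul_right, ha] at hza
    by_contra hneg
    nlinarith

/-! ### Rotations of three-space -/

lemma basis_det_eq_trip (v : Fin 3 → E3) :
    (EuclideanSpace.basisFun (Fin 3) ℝ).toBasis.det v = trip (v 0) (v 1) (v 2) := by
  rw [Module.Basis.det_apply, Matrix.det_fin_three, trip_coord]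
  simp [Module.Basis.toMatrix_apply]
  ring

lemma trip_map (g : E3 ≃ₗᵢ[ℝ] E3) (a b c : E3) : trip (g a) (g b) (g c) =
    LinearMap.det (g.toLinearEquiv : E3 →ₗ[ℝ] E3) * trip a b c := by
  have := (EuclideanSpace.basisFun (Fin 3) ℝ).toBasis.det_comp
    (g.toLinearEquiv : E3 →ₗ[ℝ] E3) ![a, b, c]
  rw [basis_det_eq_trip, basis_det_eq_trip] at this
  simpa using this

lemma trip_map_of_op {g : E3 ≃ₗᵢ[ℝ] E3} (hg : OrientationPreserving g) (a b c : E3) :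
    trip (g a) (g b) (g c) = trip a b c := by
  rw [trip_map, hg, one_mul]

lemma cr_map_of_op {g : E3 ≃ₗᵢ[ℝ] E3} (hg : OrientationPreserving g) (a b : E3) :
    cr (g a) (g b) = g (cr a b) := by
  refine ext_inner_right ℝ fun z => ?_
  obtain ⟨w, rfl⟩ := g.surjective z
  rw [g.inner_map_map]
  exact trip_map_of_op hg a b w

lemma det_sq (g : E3 ≃ₗᵢ[ℝ] E3) : LinearMap.det (g.toLinearEquiv : E3 →ₗ[ℝ] E3) = 1 ∨
    LinearMap.det (g.toLinearEquiv : E3 →ₗ[ℝ] E3) = -1 := by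
  set e0 : E3 := !₂[1, 0, 0]
  set e1 : E3 := !₂[0, 1, 0]
  have h1 : ‖cr (g e0) (g e1)‖ ^ 2 = 1 := by
    rw [norm_cr_sq, g.norm_map, g.norm_map, g.inner_map_map, ← norm_cr_sq,
      ← real_inner_self_eq_norm_sq, inner_coord]
    simp [e0, e1]
  have h2 : cr (g e0) (g e1) =
      LinearMap.det (g.toLinearEquiv : E3 →ₗ[ℝ] E3) • g (cr e0 e1) := by
    refine ext_inner_right ℝ fun z => ?_
    obtain ⟨w, rfl⟩ := g.surjective z
    rw [inner_smul_left, g.inner_map_map]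
    exact trip_map g e0 e1 w
  rw [h2, norm_smul, mul_pow, g.norm_map, ← real_inner_self_eq_norm_sq (cr e0 e1),
    inner_coord] at h1
  simp only [e0, e1, cr_zero, cr_one, cr_two] at h1
  simp at h1
  exact h1

lemma op_refl : OrientationPreserving (LinearIsometryEquiv.refl ℝ E3) := by
  simp [OrientationPreserving]

lemma det_trans (g h : E3 ≃ₗᵢ[ℝ] E3) :
    LinearMap.det ((g.trans h).toLinearEquiv : E3 →ₗ[ℝ] E3) =
      LinearMap.det (h.toLinearEquiv : E3 →ₗ[ℝ] E3) *
      LinearMap.det (g.toLinearEquiv : E3 →ₗ[ℝ] E3) := by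
  rw [← LinearMap.det_comp]; rfl

lemma OrientationPreserving.trans {g h : E3 ≃ₗᵢ[ℝ] E3} (hg : OrientationPreserving g)
    (hh : OrientationPreserving h) : OrientationPreserving (g.trans h) := by
  unfold OrientationPreserving at *
  rw [det_trans, hg, hh, one_mul]

lemma OrientationPreserving.symm {g : E3 ≃ₗᵢ[ℝ] E3} (hg : OrientationPreserving g) :
    OrientationPreserving g.symm := by
  have := det_trans g g.symm
  rw [g.self_trans_symm, hg, mul_one] at this
  unfold OrientationPreserving
  rw [← this]
  exact op_refl

/-- The reflection in the plane orthogonal to a vector. -/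
noncomputable def refl (u : E3) : E3 ≃ₗᵢ[ℝ] E3 := (ℝ ∙ u)ᗮ.reflection

lemma refl_apply (u z : E3) : refl u z = z - (2 * ⟪u, z⟫ / ‖u‖ ^ 2) • u := by
  rw [refl, Submodule.reflection_orthogonal_apply, Submodule.reflection_singleton_apply]
  simp only [RCLike.ofReal_real_eq_id, id]
  module

lemma refl_of_inner_eq_zero {u z : E3} (h : ⟪u, z⟫ = 0) : refl u z = z := by
  rw [refl_apply, h]; simp

lemma refl_sub {a b : E3} (h : ‖a‖ = ‖b‖) : refl (a - b) a = b := Submodule.reflection_sub h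

lemma refl_sub' {a b : E3} (h : ‖a‖ = ‖b‖) : refl (a - b) b = a := by
  have e : refl (a - b) (refl (a - b) a) = a := Submodule.reflection_reflection _ _
  rwa [refl_sub h] at e

lemma det_refl {u : E3} (hu : u ≠ 0) :
    LinearMap.det ((refl u).toLinearEquiv : E3 →ₗ[ℝ] E3) = -1 := by
  have h := (ℝ ∙ u)ᗮ.det_reflection
  have h2 : Module.finrank ℝ ((ℝ ∙ u)ᗮ)ᗮ = 1 := by
    rw [Submodule.orthogonal_orthogonal]; exact finrank_span_singleton hu
  rw [h2, pow_one] at h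
  exact h

/-- A rotation carries any pair of linearly independent unit vectors to any other one with the
same inner product. -/
lemma exists_op_map {a b a' b' : E3} (ha : ‖a‖ = ‖a'‖) (hb : ‖b‖ = ‖b'‖)
    (hab : ⟪a, b⟫ = ⟪a', b'⟫) (hcr : cr a' b' ≠ 0) :
    ∃ g : E3 ≃ₗᵢ[ℝ] E3, OrientationPreserving g ∧ g a = a' ∧ g b = b' := by
  have h1 : refl (a - a') a = a' := Submodule.reflection_sub ha
  set b1 := refl (a - a') b
  have hb1 : ‖b1‖ = ‖b'‖ := by rw [← hb]; exact (refl (a - a')).norm_map b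
  have hi : ⟪a', b1⟫ = ⟪a', b'⟫ := by
    rw [← hab, ← h1]; exact (refl (a - a')).inner_map_map a b
  have h2 : refl (b1 - b') b1 = b' := Submodule.reflection_sub hb1
  have h3 : refl (b1 - b') a' = a' := refl_of_inner_eq_zero (by
    rw [real_inner_comm, inner_sub_right, hi, sub_self])
  set g0 := (refl (a - a')).trans (refl (b1 - b'))
  have ga : g0 a = a' := by simp [g0, h1, h3]
  have gb : g0 b = b' := by simpa [g0] using h2
  rcases det_sq g0 with h | h
  · exact ⟨g0, h, ga, gb⟩
  · refine ⟨g0.trans (refl (cr a' b')), ?_, ?_, ?_⟩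
    · rw [OrientationPreserving, det_trans, h, det_refl hcr]; norm_num
    · rw [LinearIsometryEquiv.trans_apply, ga]
      exact refl_of_inner_eq_zero (inner_cr_left _ _)
    · rw [LinearIsometryEquiv.trans_apply, gb]
      exact refl_of_inner_eq_zero (inner_cr_right _ _)

lemma isometry_ext {a b : E3} (hab : cr a b ≠ 0) {g h : E3 ≃ₗᵢ[ℝ] E3} (h1 : g a = h a)
    (h2 : g b = h b) (h3 : g (cr a b) = h (cr a b)) : g = h := by
  ext1 z
  have hpos : trip a b (cr a b) ≠ 0 := by
    rw [trip_cr]; exact pow_ne_zero 2 (norm_ne_zero_iff.2 hab)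
  have hc := cramer a b (cr a b) z
  have e1 := congrArg g hc
  have e2 := congrArg h hc
  simp only [map_add, map_smul] at e1 e2
  rw [h1, h2, h3, ← e2] at e1
  exact smul_right_injective E3 hpos e1

/-- An isometry permuting `a` and `b` maps their cross product to itself or to its negative. -/
lemma map_cr_of_perm {a b : E3} {g : E3 ≃ₗᵢ[ℝ] E3}
    (h : (g a = a ∧ g b = b) ∨ (g a = b ∧ g b = a)) :
    g (cr a b) = cr a b ∨ g (cr a b) = - cr a b := by
  have key : cr (g a) (g b) =
      LinearMap.det (g.toLinearEquiv : E3 →ₗ[ℝ] E3) • g (cr a b) := by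
    refine ext_inner_right ℝ fun z => ?_
    obtain ⟨w, rfl⟩ := g.surjective z
    rw [inner_smul_left, g.inner_map_map]
    exact trip_map g a b w
  have hs : cr (g a) (g b) = cr a b ∨ cr (g a) (g b) = - cr a b := by
    rcases h with ⟨h1, h2⟩ | ⟨h1, h2⟩
    · left; rw [h1, h2]
    · right; rw [h1, h2, cr_swap]
  rcases det_sq g with hd | hd <;> rw [hd] at key <;> simp only [one_smul, neg_smul] at key <;>
    rcases hs with hs | hs <;> rw [hs] at key
  · left; exact key.symm
  · right; exact key.symm
  · right; exact (neg_eq_iff_eq_neg.1 key.symm)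
  · left; exact (neg_injective key).symm

/-- A non-trivial isometry permuting `a` and `b` is the reflection in the plane spanned by `a`
and `b`, or it interchanges `a` and `b`. -/
lemma perm_cases {a b : E3} (hab : cr a b ≠ 0) {g : E3 ≃ₗᵢ[ℝ] E3}
    (hg : g ≠ LinearIsometryEquiv.refl ℝ E3)
    (h : (g a = a ∧ g b = b) ∨ (g a = b ∧ g b = a)) :
    g (cr a b) = - cr a b ∨ (g a = b ∧ g b = a ∧ g (cr a b) = cr a b) := by
  rcases map_cr_of_perm h with h' | h'
  · right
    rcases h with ⟨h1, h2⟩ | ⟨h1, h2⟩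
    · exact absurd (isometry_ext hab (by simpa using h1) (by simpa using h2)
        (by simpa using h')) hg
    · exact ⟨h1, h2, h'⟩
  · exact Or.inl h'

/-! ### Pairs of points of maximal distance -/

/-- In the cone spanned by unit vectors, among which one pair has a strictly smaller inner product
than all the others, that pair is the only pair of unit vectors with minimal inner product. -/
lemma inner_ge_of_mem_cone {ι : Type*} [Fintype ι] (w : ι → E3) (hw : ∀ i, ‖w i‖ = 1)
    {i₀ j₀ : ι} (hne : i₀ ≠ j₀)
    (hc : 0 ≤ ⟪w i₀, w j₀⟫)
    (h : ∀ i j, ⟪w i, w j⟫ ≤ ⟪w i₀, w j₀⟫ → (i = i₀ ∧ j = j₀) ∨ (i = j₀ ∧ j = i₀))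
    {z z' : E3} (hz : ‖z‖ = 1) (hz' : ‖z'‖ = 1) {l m : ι → ℝ} (hl : ∀ i, 0 ≤ l i)
    (hm : ∀ i, 0 ≤ m i) (hzl : z = ∑ i, l i • w i) (hzm : z' = ∑ i, m i • w i) :
    ⟪w i₀, w j₀⟫ ≤ ⟪z, z'⟫ ∧
      (⟪z, z'⟫ = ⟪w i₀, w j₀⟫ → (z = w i₀ ∧ z' = w j₀) ∨ (z = w j₀ ∧ z' = w i₀)) := by
  set c := ⟪w i₀, w j₀⟫ with hcdef
  have hexp : ⟪z, z'⟫ = ∑ i, ∑ j, l i * m j * ⟪w i, w j⟫ := by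
    rw [hzl, hzm, sum_inner]
    refine Finset.sum_congr rfl fun i _ => ?_
    rw [inner_sum]
    refine Finset.sum_congr rfl fun j _ => ?_
    rw [inner_smul_left, inner_smul_right]; simp; ring
  have hsl : 1 ≤ ∑ i, l i := by
    calc (1 : ℝ) = ‖z‖ := hz.symm
      _ ≤ ∑ i, ‖l i • w i‖ := by rw [hzl]; exact norm_sum_le _ _
      _ = ∑ i, l i := by
        refine Finset.sum_congr rfl fun i _ => ?_
        rw [norm_smul, hw, mul_one, Real.norm_of_nonneg (hl i)]
  have hsm : 1 ≤ ∑ i, m i := by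
    calc (1 : ℝ) = ‖z'‖ := hz'.symm
      _ ≤ ∑ i, ‖m i • w i‖ := by rw [hzm]; exact norm_sum_le _ _
      _ = ∑ i, m i := by
        refine Finset.sum_congr rfl fun i _ => ?_
        rw [norm_smul, hw, mul_one, Real.norm_of_nonneg (hm i)]
  have hge : ∀ i j, c ≤ ⟪w i, w j⟫ := by
    intro i j
    by_contra hlt
    push Not at hlt
    rcases h i j hlt.le with ⟨rfl, rfl⟩ | ⟨rfl, rfl⟩
    · exact absurd hlt (lt_irrefl _)
    · rw [real_inner_comm] at hlt; exact absurd hlt (lt_irrefl _)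
  have hlm : (1 : ℝ) ≤ (∑ i, l i) * ∑ j, m j := by nlinarith
  have hdiff : ⟪z, z'⟫ - c * ((∑ i, l i) * ∑ j, m j) =
      ∑ i, ∑ j, l i * m j * (⟪w i, w j⟫ - c) := by
    rw [hexp, Finset.sum_mul_sum, Finset.mul_sum, ← Finset.sum_sub_distrib]
    refine Finset.sum_congr rfl fun i _ => ?_
    rw [Finset.mul_sum, ← Finset.sum_sub_distrib]
    refine Finset.sum_congr rfl fun j _ => ?_
    ring
  have hterm : ∀ i j, 0 ≤ l i * m j * (⟪w i, w j⟫ - c) := fun i j =>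
    mul_nonneg (mul_nonneg (hl i) (hm j)) (sub_nonneg.2 (hge i j))
  have hnn : 0 ≤ ∑ i, ∑ j, l i * m j * (⟪w i, w j⟫ - c) :=
    Finset.sum_nonneg fun i _ => Finset.sum_nonneg fun j _ => hterm i j
  refine ⟨by nlinarith, fun heq => ?_⟩
  have hzero : ∑ i, ∑ j, l i * m j * (⟪w i, w j⟫ - c) = 0 := by nlinarith
  have hall : ∀ i j, l i * m j * (⟪w i, w j⟫ - c) = 0 := by
    intro i j
    have h1 := (Finset.sum_eq_zero_iff_of_nonneg
      (fun i _ => Finset.sum_nonneg fun j _ => hterm i j)).1 hzero i (Finset.mem_univ _)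
    exact (Finset.sum_eq_zero_iff_of_nonneg (fun j _ => hterm i j)).1 h1 j (Finset.mem_univ _)
  have hpair : ∀ i j, l i ≠ 0 → m j ≠ 0 → (i = i₀ ∧ j = j₀) ∨ (i = j₀ ∧ j = i₀) := by
    intro i j hi hj
    have := hall i j
    have : ⟪w i, w j⟫ - c = 0 := by
      rcases mul_eq_zero.1 this with h' | h'
      · rcases mul_eq_zero.1 h' with h'' | h''
        · exact absurd h'' hi
        · exact absurd h'' hj
      · exact h'
    exact h i j (by linarith)
  obtain ⟨i, -, hi⟩ : ∃ i ∈ Finset.univ, l i ≠ 0 := by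
    apply Finset.exists_ne_zero_of_sum_ne_zero (f := l); linarith
  obtain ⟨j, -, hj⟩ : ∃ j ∈ Finset.univ, m j ≠ 0 := by
    apply Finset.exists_ne_zero_of_sum_ne_zero (f := m); linarith
  have single : ∀ (n : ι → ℝ) (y : E3) (k : ι), (∀ i, 0 ≤ n i) → ‖y‖ = 1 →
      y = ∑ i, n i • w i → (∀ i, n i ≠ 0 → i = k) → y = w k := by
    intro n y k hn hy hyn hk
    have hy' : y = n k • w k := by
      rw [hyn]
      refine Finset.sum_eq_single k (fun b _ hb => ?_) (fun hk => absurd (Finset.mem_univ _) hk)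
      rw [not_imp_comm.1 (hk b) hb, zero_smul]
    rw [hy', norm_smul, hw, mul_one, Real.norm_of_nonneg (hn k)] at hy
    rw [hy', hy, one_smul]
  rcases hpair i j hi hj with ⟨rfl, rfl⟩ | ⟨rfl, rfl⟩
  · refine Or.inl ⟨single l z i hl hz hzl fun k hk => ?_, single m z' j hm hz' hzm fun k hk => ?_⟩
    · rcases hpair k j hk hj with h' | h'
      · exact h'.1
      · exact absurd h'.2.symm hne
    · rcases hpair i k hi hk with h' | h'
      · exact h'.2
      · exact absurd h'.1 hne
  · refine Or.inr ⟨single l z i hl hz hzl fun k hk => ?_, single m z' j hm hz' hzm fun k hk => ?_⟩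
    · rcases hpair k j hk hj with h' | h'
      · exact absurd h'.2 hne.symm.symm
      · exact h'.1
    · rcases hpair i k hi hk with h' | h'
      · exact absurd h'.1.symm hne
      · exact h'.2

/-- Two unit vectors `a`, `b` are the only diametral pair of the union of the cones over the
triangles `a b X` and `a b Y` as soon as all other pairs of vertices are closer to each other. -/
lemma inner_ge_of_mem_hull {a b X Y : E3} (ha : ‖a‖ = 1) (hb : ‖b‖ = 1) (hX : ‖X‖ = 1)
    (hY : ‖Y‖ = 1) (hc : 0 ≤ ⟪a, b⟫) (hc1 : ⟪a, b⟫ < 1) (haX : ⟪a, b⟫ < ⟪a, X⟫)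
    (hbX : ⟪a, b⟫ < ⟪b, X⟫) (haY : ⟪a, b⟫ < ⟪a, Y⟫) (hbY : ⟪a, b⟫ < ⟪b, Y⟫)
    (hXY : ⟪a, b⟫ < ⟪X, Y⟫) {z z' : E3} (hz : ‖z‖ = 1) (hz' : ‖z'‖ = 1)
    (hzm : z ∈ hull a b X ∪ hull a b Y) (hzm' : z' ∈ hull a b X ∪ hull a b Y) :
    ⟪a, b⟫ ≤ ⟪z, z'⟫ ∧ (⟪z, z'⟫ = ⟪a, b⟫ → (z = a ∧ z' = b) ∨ (z = b ∧ z' = a)) := by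
  have rep : ∀ y ∈ hull a b X ∪ hull a b Y, ∃ l : Fin 4 → ℝ, (∀ i, 0 ≤ l i) ∧
      y = ∑ i, l i • (![a, b, X, Y] : Fin 4 → E3) i := by
    rintro y (⟨α, β, γ, h1, h2, h3, rfl⟩ | ⟨α, β, γ, h1, h2, h3, rfl⟩)
    · refine ⟨![α, β, γ, 0], ?_, ?_⟩
      · intro i; fin_cases i <;> simp [h1, h2, h3]
      · simp [Fin.sum_univ_four]
    · refine ⟨![α, β, 0, γ], ?_, ?_⟩
      · intro i; fin_cases i <;> simp [h1, h2, h3]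
      · simp [Fin.sum_univ_four]
  obtain ⟨l, hl, hzl⟩ := rep z hzm
  obtain ⟨m, hm, hzl'⟩ := rep z' hzm'
  refine inner_ge_of_mem_cone (![a, b, X, Y] : Fin 4 → E3) ?_ (i₀ := 0) (j₀ := 1) (by decide) hc ?_
    hz hz' hl hm hzl hzl'
  · intro i; fin_cases i <;> simp [ha, hb, hX, hY]
  · intro i j
    fin_cases i <;> fin_cases j <;> simp [ha, hb, hX, hY, hc1, haX, hbX, haY, hbY, hXY,
      real_inner_comm a b, real_inner_comm a X, real_inner_comm a Y, real_inner_comm b X,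
      real_inner_comm b Y, real_inner_comm X Y]

end SphericalPlane

namespace SphericalPlane

/-! ### Convex cones and their charts -/

/-- A closed convex cone with interior points in `ℝ³`, different from the whole space: the cone
over a closed convex set of the sphere. -/
structure Body (K : Set E3) : Prop where
  closed : IsClosed K
  add : ∀ z ∈ K, ∀ w ∈ K, z + w ∈ K
  smul : ∀ t : ℝ, 0 ≤ t → ∀ z ∈ K, t • z ∈ K
  int : (interior K).Nonempty
  ne : K ≠ univ

namespace Body

variable {K : Set E3}

lemma zero_mem (hK : Body K) : (0 : E3) ∈ K := by
  obtain ⟨o, ho⟩ := hK.int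
  simpa using hK.smul 0 le_rfl o (interior_subset ho)

lemma add_mem_interior (hK : Body K) {z w : E3} (hz : z ∈ interior K) (hw : w ∈ K) :
    z + w ∈ interior K := by
  rw [mem_interior] at hz ⊢
  obtain ⟨U, hU, hUo, hzU⟩ := hz
  refine ⟨(fun y => y + w) '' U, ?_, (Homeomorph.addRight w).isOpenMap U hUo, ⟨z, hzU, rfl⟩⟩
  rintro _ ⟨y, hy, rfl⟩
  exact hK.add y (hU hy) w hw

lemma smul_mem_interior (hK : Body K) {z : E3} (hz : z ∈ interior K) {t : ℝ} (ht : 0 < t) :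
    t • z ∈ interior K := by
  rw [mem_interior] at hz ⊢
  obtain ⟨U, hU, hUo, hzU⟩ := hz
  refine ⟨(fun y => t • y) '' U, ?_, (Homeomorph.smulOfNeZero t ht.ne').isOpenMap U hUo,
    ⟨z, hzU, rfl⟩⟩
  rintro _ ⟨y, hy, rfl⟩
  exact hK.smul t ht.le y (hU hy)

lemma smul_mem_iff (hK : Body K) {z : E3} {t : ℝ} (ht : 0 < t) : t • z ∈ K ↔ z ∈ K := by
  refine ⟨fun h => ?_, hK.smul t ht.le z⟩
  have := hK.smul t⁻¹ (by positivity) _ h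
  rwa [smul_smul, inv_mul_cancel₀ ht.ne', one_smul] at this

lemma smul_mem_interior_iff (hK : Body K) {z : E3} {t : ℝ} (ht : 0 < t) :
    t • z ∈ interior K ↔ z ∈ interior K := by
  refine ⟨fun h => ?_, fun h => hK.smul_mem_interior h ht⟩
  have := hK.smul_mem_interior h (inv_pos.2 ht)
  rwa [smul_smul, inv_mul_cancel₀ ht.ne', one_smul] at this

lemma eventually_add_smul_mem {z : E3} (hz : z ∈ interior K) (w : E3) :
    ∀ᶠ t in 𝓝 (0 : ℝ), z + t • w ∈ K := by
  have hc : Tendsto (fun t : ℝ => z + t • w) (𝓝 0) (𝓝 z) := by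
    have : Continuous fun t : ℝ => z + t • w := by fun_prop
    simpa using this.tendsto 0
  exact hc.eventually (mem_interior_iff_mem_nhds.1 hz)

lemma exists_add_smul_mem {z : E3} (hz : z ∈ interior K) (w : E3) :
    ∃ t : ℝ, 0 < t ∧ z + t • w ∈ K := by
  have h := (eventually_add_smul_mem hz w).filter_mono (nhdsWithin_le_nhds (s := Ioi (0 : ℝ)))
  obtain ⟨t, ht, ht0⟩ := (h.and self_mem_nhdsWithin).exists
  exact ⟨t, ht0, ht⟩

lemma neg_notMem (hK : Body K) {z : E3} (hz : z ∈ interior K) : -z ∉ K := by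
  intro hn
  apply hK.ne
  rw [eq_univ_iff_forall]
  intro w
  obtain ⟨t, ht, h⟩ := exists_add_smul_mem hz w
  have := hK.add _ h _ hn
  rw [add_neg_cancel_comm] at this
  exact (hK.smul_mem_iff ht).1 this

lemma ne_zero_of_mem_interior (hK : Body K) {z : E3} (hz : z ∈ interior K) : z ≠ 0 := by
  rintro rfl
  exact hK.neg_notMem hz (by simpa using hK.zero_mem)

lemma image (hK : Body K) (g : E3 ≃ₗᵢ[ℝ] E3) : Body (g '' K) where
  closed := g.toHomeomorph.isClosedMap K hK.closed
  add := by
    rintro _ ⟨z, hz, rfl⟩ _ ⟨w, hw, rfl⟩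
    exact ⟨z + w, hK.add z hz w hw, map_add g z w⟩
  smul := by
    rintro t ht _ ⟨z, hz, rfl⟩
    exact ⟨t • z, hK.smul t ht z hz, map_smul g t z⟩
  int := by
    have : interior (g '' K) = g '' interior K := (g.toHomeomorph.image_interior K).symm
    rw [this]
    exact hK.int.image g
  ne := by
    intro h
    apply hK.ne
    rw [eq_univ_iff_forall] at h ⊢
    intro z
    obtain ⟨w, hw, hwz⟩ := h (g z)
    rwa [← g.injective hwz]

lemma interior_image (g : E3 ≃ₗᵢ[ℝ] E3) (K : Set E3) : interior (g '' K) = g '' interior K :=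
  (g.toHomeomorph.image_interior K).symm

lemma frontier_image (g : E3 ≃ₗᵢ[ℝ] E3) (K : Set E3) : frontier (g '' K) = g '' frontier K :=
  (g.toHomeomorph.image_frontier K).symm

lemma mem_frontier_iff (hK : Body K) {z : E3} : z ∈ frontier K ↔ z ∈ K ∧ z ∉ interior K := by
  rw [hK.closed.frontier_eq]; rfl

lemma smul_mem_frontier_iff (hK : Body K) {z : E3} {t : ℝ} (ht : 0 < t) :
    t • z ∈ frontier K ↔ z ∈ frontier K := by
  rw [hK.mem_frontier_iff, hK.mem_frontier_iff, hK.smul_mem_iff ht, hK.smul_mem_interior_iff ht]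

end Body

/-- In the affine plane `z 2 = 1` the cone `K` is the epigraph of the convex function `f`, which is
finite on the whole line. Such a function exists if the vector `(0, 1, 0)` is interior to `K`. -/
structure Chart (K : Set E3) (f : ℝ → ℝ) : Prop where
  convex : ConvexOn ℝ univ f
  mem_iff : ∀ z : E3, 0 < z 2 → (z ∈ K ↔ f (z 0 / z 2) ≤ z 1 / z 2)

lemma Body.exists_chart {K : Set E3} (hK : Body K) (h1 : (!₂[0, 1, 0] : E3) ∈ interior K) :
    ∃ f, Chart K f := by
  have up : ∀ z ∈ K, ∀ t : ℝ, 0 ≤ t → z + t • (!₂[0, 1, 0] : E3) ∈ K := fun z hz t ht =>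
    hK.add z hz _ (hK.smul t ht _ (interior_subset h1))
  set S : ℝ → Set ℝ := fun u => {v | (!₂[u, v, 1] : E3) ∈ K} with hS
  have hne : ∀ u, (S u).Nonempty := by
    intro u
    obtain ⟨t, ht, h⟩ := Body.exists_add_smul_mem h1 !₂[u, 0, 1]
    refine ⟨t⁻¹, ?_⟩
    have := hK.smul t⁻¹ (by positivity) _ h
    show (!₂[u, t⁻¹, 1] : E3) ∈ K
    convert this using 1
    apply ext_coord <;> simp [ht.ne']
  have hbdd : ∀ u, BddBelow (S u) := by
    intro u
    by_contra hb
    apply hK.neg_notMem h1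
    have hlim : Tendsto (fun n : ℕ => (n + 1 : ℝ)⁻¹ • (!₂[u, -(n + 1 : ℝ), 1] : E3)) atTop
        (𝓝 (-!₂[0, 1, 0])) := by
      have e : ∀ n : ℕ, (n + 1 : ℝ)⁻¹ • (!₂[u, -(n + 1 : ℝ), 1] : E3) =
          (1 / ((n : ℝ) + 1)) • (!₂[u, 0, 1] : E3) + -!₂[0, 1, 0] := by
        intro n
        have : (n + 1 : ℝ) ≠ 0 := by positivity
        apply ext_coord <;> simp
        field_simp
        ring
      simp_rw [e]
      have := (tendsto_one_div_add_atTop_nhds_zero_nat (𝕜 := ℝ)).smul_const (!₂[u, 0, 1] : E3)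
      simpa using this.add_const (-(!₂[0, 1, 0] : E3))
    refine hK.closed.mem_of_tendsto hlim (Eventually.of_forall fun n => ?_)
    refine hK.smul _ (by positivity) _ ?_
    obtain ⟨v, hv, hvn⟩ := not_bddBelow_iff.1 hb (-(n + 1 : ℝ))
    have := up _ hv (-(n + 1 : ℝ) - v) (by linarith)
    convert this using 1
    apply ext_coord <;> simp
  have hcl : ∀ u, IsClosed (S u) := by
    intro u
    refine hK.closed.preimage ?_
    fun_prop
  set f : ℝ → ℝ := fun u => sInf (S u)
  have hfm : ∀ u, f u ∈ S u := fun u => (hcl u).csInf_mem (hne u) (hbdd u)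
  have hmem : ∀ u v, v ∈ S u ↔ f u ≤ v := by
    intro u v
    refine ⟨fun h => csInf_le (hbdd u) h, fun h => ?_⟩
    have := up _ (hfm u) (v - f u) (by linarith)
    show (!₂[u, v, 1] : E3) ∈ K
    convert this using 1
    apply ext_coord <;> simp
  refine ⟨f, ⟨convex_univ, ?_⟩, ?_⟩
  · intro u _ v _ a b ha hb hab
    rw [← hmem]
    have := hK.add _ (hK.smul a ha _ (hfm u)) _ (hK.smul b hb _ (hfm v))
    show (!₂[_, _, 1] : E3) ∈ K
    convert this using 1
    apply ext_coord <;> simp [hab]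
  · intro z hz
    rw [← hmem]
    have : z = z 2 • (!₂[z 0 / z 2, z 1 / z 2, 1] : E3) := by
      apply ext_coord <;> simp <;> field_simp
    conv_lhs => rw [this]
    exact hK.smul_mem_iff hz

/-- The point of the boundary of the epigraph of `f` over `u`, as a vector of `ℝ³`. -/
noncomputable def vec (f : ℝ → ℝ) (u : ℝ) : E3 := !₂[u, f u, 1]

/-- The point of the unit sphere represented by `vec f u`. -/
noncomputable def pt (f : ℝ → ℝ) (u : ℝ) : E3 := ‖vec f u‖⁻¹ • vec f u

@[simp] lemma vec_zero (f : ℝ → ℝ) (u : ℝ) : vec f u 0 = u := by simp [vec]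
@[simp] lemma vec_one (f : ℝ → ℝ) (u : ℝ) : vec f u 1 = f u := by simp [vec]
@[simp] lemma vec_two (f : ℝ → ℝ) (u : ℝ) : vec f u 2 = 1 := by simp [vec]

lemma norm_vec_pos (f : ℝ → ℝ) (u : ℝ) : 0 < ‖vec f u‖ := by
  refine norm_pos_iff.2 fun h => ?_
  have := congrArg (fun z : E3 => z 2) h
  simp at this

lemma norm_vec_sq (f : ℝ → ℝ) (u : ℝ) : ‖vec f u‖ ^ 2 = u ^ 2 + f u ^ 2 + 1 := by
  rw [← real_inner_self_eq_norm_sq, inner_coord]; simp; ring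

@[simp] lemma norm_pt (f : ℝ → ℝ) (u : ℝ) : ‖pt f u‖ = 1 := by
  rw [pt, norm_smul, norm_inv, norm_norm, inv_mul_cancel₀ (norm_vec_pos f u).ne']

lemma vec_eq_smul_pt (f : ℝ → ℝ) (u : ℝ) : vec f u = ‖vec f u‖ • pt f u := by
  rw [pt, smul_smul, mul_inv_cancel₀ (norm_vec_pos f u).ne', one_smul]

lemma pt_two_pos (f : ℝ → ℝ) (u : ℝ) : 0 < pt f u 2 := by
  simpa [pt] using norm_vec_pos f u

lemma pt_injective (f : ℝ → ℝ) : Function.Injective (pt f) := by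
  intro u v h
  have h2 := congrArg (fun z : E3 => z 2) h
  have h0 := congrArg (fun z : E3 => z 0) h
  simp only [pt, PiLp.smul_apply, vec_two, vec_zero, smul_eq_mul, mul_one] at h2 h0
  rw [h2] at h0
  exact mul_left_cancel₀ (inv_ne_zero (norm_vec_pos f v).ne') h0

lemma pt_of_frontier_coord {f : ℝ → ℝ} {z : E3} (hz : ‖z‖ = 1) (h2 : 0 < z 2)
    (h : f (z 0 / z 2) = z 1 / z 2) : z = pt f (z 0 / z 2) := by
  have e : z = z 2 • vec f (z 0 / z 2) := by
    apply ext_coord <;> simp [h] <;> field_simp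
  have hn : ‖vec f (z 0 / z 2)‖ = (z 2)⁻¹ := by
    have : ‖z‖ = z 2 * ‖vec f (z 0 / z 2)‖ := by
      conv_lhs => rw [e, norm_smul, Real.norm_of_nonneg h2.le]
    rw [hz] at this
    field_simp; linarith
  rw [pt, hn, inv_inv]; exact e

/-- `t` is the slope of a line supporting the graph of `f` at `u`. -/
def SubG (f : ℝ → ℝ) (u t : ℝ) : Prop := ∀ v, f u + t * (v - u) ≤ f v

lemma SubG.le_slope {f : ℝ → ℝ} {u v t : ℝ} (h : SubG f u t) (huv : u < v) :
    t ≤ (f v - f u) / (v - u) := by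
  rw [le_div_iff₀ (by linarith)]; linarith [h v]

lemma SubG.slope_le {f : ℝ → ℝ} {u v t : ℝ} (h : SubG f v t) (huv : u < v) :
    (f v - f u) / (v - u) ≤ t := by
  rw [div_le_iff₀ (by linarith)]; linarith [h u]

/-- The right derivative of a convex function on the line. -/
noncomputable def dR (f : ℝ → ℝ) (u : ℝ) : ℝ := derivWithin f (Ioi u) u

/-- The left derivative of a convex function on the line. -/
noncomputable def dL (f : ℝ → ℝ) (u : ℝ) : ℝ := derivWithin f (Iio u) u

lemma hasDerivWithinAt_dR {f : ℝ → ℝ} (hf : ConvexOn ℝ univ f) (u : ℝ) :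
    HasDerivWithinAt f (dR f u) (Ioi u) u :=
  hf.hasDerivWithinAt_rightDeriv_of_mem_interior (by simp)

lemma hasDerivWithinAt_dL {f : ℝ → ℝ} (hf : ConvexOn ℝ univ f) (u : ℝ) :
    HasDerivWithinAt f (dL f u) (Iio u) u :=
  hf.hasDerivWithinAt_leftDeriv_of_mem_interior (by simp)

lemma dL_le_dR {f : ℝ → ℝ} (hf : ConvexOn ℝ univ f) (u : ℝ) : dL f u ≤ dR f u :=
  hf.leftDeriv_le_rightDeriv_of_mem_interior (by simp)

lemma subG_of_between {f : ℝ → ℝ} (hf : ConvexOn ℝ univ f) {u t : ℝ} (h1 : dL f u ≤ t)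
    (h2 : t ≤ dR f u) : SubG f u t := by
  intro v
  rcases lt_trichotomy u v with h | h | h
  · have := hf.rightDeriv_le_slope_of_mem_interior (x := u) (y := v) (by simp) (by simp) h
    rw [slope_def_field, le_div_iff₀ (by linarith)] at this
    have h3 : t * (v - u) ≤ dR f u * (v - u) := mul_le_mul_of_nonneg_right h2 (by linarith)
    have h4 : dR f u * (v - u) ≤ f v - f u := this
    linarith
  · subst h; simp
  · have := hf.slope_le_leftDeriv_of_mem_interior (x := v) (y := u) (by simp) (by simp) h
    rw [slope_def_field, div_le_iff₀ (by linarith)] at this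
    have h3 : dL f u * (u - v) ≤ t * (u - v) := mul_le_mul_of_nonneg_right h1 (by linarith)
    have h4 : f u - f v ≤ dL f u * (u - v) := this
    linarith

lemma subG_dR {f : ℝ → ℝ} (hf : ConvexOn ℝ univ f) (u : ℝ) : SubG f u (dR f u) :=
  subG_of_between hf (dL_le_dR hf u) le_rfl

lemma subG_dL {f : ℝ → ℝ} (hf : ConvexOn ℝ univ f) (u : ℝ) : SubG f u (dL f u) :=
  subG_of_between hf le_rfl (dL_le_dR hf u)

lemma continuous_of_convex {f : ℝ → ℝ} (hf : ConvexOn ℝ univ f) : Continuous f :=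
  hf.locallyLipschitz.continuous

/-- The slopes of supporting lines to the right of `u` tend to the right derivative at `u`. -/
lemma eventually_subG_right {f : ℝ → ℝ} (hf : ConvexOn ℝ univ f) (u : ℝ) {ε : ℝ} (hε : 0 < ε) :
    ∀ᶠ v in 𝓝[>] u, ∀ t, SubG f v t → dR f u ≤ t ∧ t < dR f u + ε := by
  have hd := hasDerivWithinAt_iff_tendsto_slope.1 (hasDerivWithinAt_dR hf u)
  rw [sdiff_singleton_eq_self (by simp)] at hd
  obtain ⟨w, hw, hwu⟩ := ((hd.eventually (gt_mem_nhds (lt_add_of_pos_right (dR f u) hε))).and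
    self_mem_nhdsWithin).exists
  replace hwu : u < w := hwu
  rw [slope_def_field] at hw
  have hc : ContinuousAt (fun v => (f w - f v) / (w - v)) u := by
    have := (continuous_of_convex hf)
    exact ContinuousAt.div (by fun_prop) (by fun_prop) (by linarith)
  have h1 := (hc.eventually (gt_mem_nhds hw)).filter_mono (nhdsWithin_le_nhds (s := Ioi u))
  have h2 : ∀ᶠ v in 𝓝[>] u, v < w :=
    (gt_mem_nhds hwu).filter_mono nhdsWithin_le_nhds
  filter_upwards [h1, h2, self_mem_nhdsWithin] with v hv1 hv2 hv3 t ht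
  exact ⟨((subG_dR hf u).le_slope hv3).trans (ht.slope_le hv3), (ht.le_slope hv2).trans_lt hv1⟩

/-- The slopes of supporting lines to the left of `u` tend to the left derivative at `u`. -/
lemma eventually_subG_left {f : ℝ → ℝ} (hf : ConvexOn ℝ univ f) (u : ℝ) {ε : ℝ} (hε : 0 < ε) :
    ∀ᶠ v in 𝓝[<] u, ∀ t, SubG f v t → t ≤ dL f u ∧ dL f u - ε < t := by
  have hd := hasDerivWithinAt_iff_tendsto_slope.1 (hasDerivWithinAt_dL hf u)
  rw [sdiff_singleton_eq_self (by simp)] at hd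
  obtain ⟨w, hw, hwu⟩ := ((hd.eventually (lt_mem_nhds (sub_lt_self (dL f u) hε))).and
    self_mem_nhdsWithin).exists
  replace hwu : w < u := hwu
  rw [slope_comm, slope_def_field] at hw
  have hc : ContinuousAt (fun v => (f v - f w) / (v - w)) u := by
    have := (continuous_of_convex hf)
    exact ContinuousAt.div (by fun_prop) (by fun_prop) (by linarith)
  have h1 := (hc.eventually (lt_mem_nhds hw)).filter_mono (nhdsWithin_le_nhds (s := Iio u))
  have h2 : ∀ᶠ v in 𝓝[<] u, w < v :=
    (lt_mem_nhds hwu).filter_mono nhdsWithin_le_nhds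
  filter_upwards [h1, h2, self_mem_nhdsWithin] with v hv1 hv2 hv3 t ht
  exact ⟨(ht.le_slope hv3).trans ((subG_dL hf u).slope_le hv3), hv1.trans_le (ht.slope_le hv2)⟩

/-- Near a point of differentiability, the slopes of all supporting lines are close. -/
lemma eventually_subG {f : ℝ → ℝ} (hf : ConvexOn ℝ univ f) {u : ℝ} (hu : dL f u = dR f u)
    {ε : ℝ} (hε : 0 < ε) : ∀ᶠ v in 𝓝 u, ∀ t, SubG f v t → |t - dR f u| < ε := by
  rw [← nhdsLT_sup_nhdsGE, ← Ioi_insert, nhdsWithin_insert, eventually_sup, eventually_sup]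
  refine ⟨?_, ?_, ?_⟩
  · filter_upwards [eventually_subG_left hf u hε] with v hv t ht
    have := hv t ht
    rw [abs_lt]; constructor <;> linarith [this.1, this.2]
  · show ∀ t, SubG f u t → |t - dR f u| < ε
    intro t ht
    have h1 : t ≤ dR f u := by
      have hd := hasDerivWithinAt_iff_tendsto_slope.1 (hasDerivWithinAt_dR hf u)
      rw [sdiff_singleton_eq_self (by simp)] at hd
      refine ge_of_tendsto hd ?_
      filter_upwards [self_mem_nhdsWithin] with v hv
      rw [slope_def_field]; exact ht.le_slope hv
    have h2 : dL f u ≤ t := by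
      have hd := hasDerivWithinAt_iff_tendsto_slope.1 (hasDerivWithinAt_dL hf u)
      rw [sdiff_singleton_eq_self (by simp)] at hd
      refine le_of_tendsto hd ?_
      filter_upwards [self_mem_nhdsWithin] with v hv
      rw [slope_comm, slope_def_field]; exact ht.slope_le hv
    have : t = dR f u := le_antisymm h1 (hu ▸ h2)
    simpa [this] using hε
  · filter_upwards [eventually_subG_right hf u hε] with v hv t ht
    have := hv t ht
    rw [abs_lt]; constructor <;> linarith [this.1, this.2]

/-- A convex function on the line is differentiable somewhere. -/
lemma exists_dL_eq_dR {f : ℝ → ℝ} (hf : ConvexOn ℝ univ f) : ∃ u, dL f u = dR f u := by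
  obtain ⟨C, t, ht, hC⟩ := hf.locallyLipschitz 0
  obtain ⟨r, hr, hrt⟩ := Metric.mem_nhds_iff.1 ht
  have h := (hC.mono hrt).ae_differentiableWithinAt_of_mem_real
  have hpos : MeasureTheory.volume (Metric.ball (0 : ℝ) r) ≠ 0 :=
    (Metric.measure_ball_pos _ _ hr).ne'
  obtain ⟨u, hu, hd⟩ : ∃ u ∈ Metric.ball (0 : ℝ) r,
      DifferentiableWithinAt ℝ f (Metric.ball 0 r) u := by
    by_contra hcon
    push Not at hcon
    apply hpos
    refine MeasureTheory.measure_mono_null ?_ (MeasureTheory.ae_iff.1 h)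
    intro v hv hv'
    exact hcon v hv (hv' hv)
  have hda := (hd.differentiableAt (Metric.isOpen_ball.mem_nhds hu)).hasDerivAt
  refine ⟨u, ?_⟩
  rw [dL, dR, hda.hasDerivWithinAt.derivWithin (uniqueDiffWithinAt_Iio u),
    hda.hasDerivWithinAt.derivWithin (uniqueDiffWithinAt_Ioi u)]

end SphericalPlane

namespace SphericalPlane

/-! ### Thin arcs -/

/-- The inner normal, in `ℝ³`, of the line of slope `t` through the point of the graph over `u`. -/
noncomputable def nrm (f : ℝ → ℝ) (u t : ℝ) : E3 := !₂[-t, 1, t * u - f u]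

lemma inner_nrm (f : ℝ → ℝ) (u t : ℝ) (z : E3) :
    ⟪nrm f u t, z⟫ = -t * z 0 + z 1 + (t * u - f u) * z 2 := by
  simp [inner_coord, nrm]

@[simp] lemma inner_nrm_pt (f : ℝ → ℝ) (u t : ℝ) : ⟪nrm f u t, pt f u⟫ = 0 := by
  rw [pt, inner_smul_right, inner_nrm]; simp

lemma inner_nrm_nrm (f : ℝ → ℝ) (u t s : ℝ) :
    ⟪nrm f u t, nrm f u s⟫ = t * s + 1 + (t * u - f u) * (s * u - f u) := by
  simp [inner_coord, nrm]

/-- Supporting lines of the graph give supporting planes of the whole cone, also outside of the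
half-space that the chart covers. -/
lemma Chart.nrm_nonneg {K : Set E3} (hK : Body K) {f : ℝ → ℝ} (hf : Chart K f) {u t : ℝ}
    (h : SubG f u t) {z : E3} (hz : z ∈ K) : 0 ≤ ⟪nrm f u t, z⟫ := by
  have hu : vec f u ∈ K := by rw [hf.mem_iff _ (by simp)]; simp
  obtain ⟨ε, hε, hpos⟩ : ∃ ε : ℝ, 0 < ε ∧ 0 < 1 + ε * z 2 := by
    refine ⟨(1 + |z 2|)⁻¹, by positivity, ?_⟩
    have h1 : -|z 2| ≤ z 2 := neg_abs_le _
    have h2 : 0 < 1 + |z 2| := by positivity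
    have : 1 + (1 + |z 2|)⁻¹ * z 2 = (1 + |z 2|)⁻¹ * (1 + |z 2| + z 2) := by field_simp
    rw [this]
    have : 0 < 1 + |z 2| + z 2 := by linarith
    positivity
  have hy := hK.add _ hu _ (hK.smul ε hε.le z hz)
  set y := vec f u + ε • z with hydef
  have hy2 : y 2 = 1 + ε * z 2 := by simp [hydef]
  rw [← hy2] at hpos
  rw [hf.mem_iff y hpos] at hy
  have h3 := (h (y 0 / y 2)).trans hy
  have h4 : 0 ≤ ⟪nrm f u t, y⟫ := by
    rw [inner_nrm]
    have h5 : (f u + t * (y 0 / y 2 - u)) * y 2 ≤ y 1 / y 2 * y 2 :=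
      mul_le_mul_of_nonneg_right h3 hpos.le
    have e1 : y 1 / y 2 * y 2 = y 1 := div_mul_cancel₀ _ hpos.ne'
    have e2 : y 0 / y 2 * y 2 = y 0 := div_mul_cancel₀ _ hpos.ne'
    have e3 : (f u + t * (y 0 / y 2 - u)) * y 2 =
        f u * y 2 + t * (y 0 / y 2 * y 2) - t * u * y 2 := by
      ring
    rw [e1, e3, e2] at h5
    linarith
  have h6 : ⟪nrm f u t, y⟫ = ε * ⟪nrm f u t, z⟫ := by
    rw [hydef, inner_add_right, inner_smul_right, inner_nrm]; simp
  rw [h6] at h4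
  exact nonneg_of_mul_nonneg_right h4 hε

lemma Chart.pt_mem {K : Set E3} {f : ℝ → ℝ} (hK : Body K) (hf : Chart K f) (u : ℝ) :
    pt f u ∈ K := by
  refine hK.smul _ (by positivity) _ ?_
  rw [hf.mem_iff _ (by simp)]; simp

lemma Chart.mem_interior_iff {K : Set E3} {f : ℝ → ℝ} (hf : Chart K f) {z : E3} (hz : 0 < z 2) :
    z ∈ interior K ↔ f (z 0 / z 2) < z 1 / z 2 := by
  constructor
  · intro h
    obtain ⟨t, ht, hm⟩ := Body.exists_add_smul_mem h !₂[0, -1, 0]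
    rw [hf.mem_iff _ (by simpa using hz)] at hm
    simp only [PiLp.add_apply, PiLp.smul_apply, smul_eq_mul] at hm
    simp at hm
    refine hm.trans_lt ?_
    gcongr
    linarith
  · intro h
    have hc := continuous_of_convex hf.convex
    have h0 : ContinuousAt (fun y : E3 => f (y 0 / y 2)) z :=
      hc.continuousAt.comp (ContinuousAt.div (by fun_prop) (by fun_prop) hz.ne')
    have h1 : ContinuousAt (fun y : E3 => y 1 / y 2) z :=
      ContinuousAt.div (by fun_prop) (by fun_prop) hz.ne'
    have h2 : ContinuousAt (fun y : E3 => y 2) z := by fun_prop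
    rw [mem_interior_iff_mem_nhds]
    filter_upwards [h0.eventually_lt h1 h, h2.eventually (lt_mem_nhds hz)] with y hy hy2
    exact (hf.mem_iff y hy2).2 hy.le

lemma pt_zero_div (f : ℝ → ℝ) (u : ℝ) : pt f u 0 / pt f u 2 = u := by
  have h := norm_vec_pos f u
  simp [pt]; field_simp

lemma pt_one_div (f : ℝ → ℝ) (u : ℝ) : pt f u 1 / pt f u 2 = f u := by
  have h := norm_vec_pos f u
  simp [pt]; field_simp

lemma Chart.pt_mem_frontier {K : Set E3} {f : ℝ → ℝ} (hK : Body K) (hf : Chart K f) (u : ℝ) :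
    pt f u ∈ frontier K := by
  rw [hK.mem_frontier_iff]
  refine ⟨hf.pt_mem hK u, ?_⟩
  rw [hf.mem_interior_iff (pt_two_pos f u), pt_zero_div, pt_one_div]
  exact lt_irrefl _

lemma Chart.eq_pt_of_mem_frontier {K : Set E3} {f : ℝ → ℝ} (hK : Body K) (hf : Chart K f) {z : E3}
    (hz : ‖z‖ = 1) (h2 : 0 < z 2) (h : z ∈ frontier K) :
    f (z 0 / z 2) = z 1 / z 2 ∧ z = pt f (z 0 / z 2) := by
  rw [hK.mem_frontier_iff, hf.mem_iff z h2, hf.mem_interior_iff h2] at h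
  have := le_antisymm h.1 (not_lt.1 h.2)
  exact ⟨this, pt_of_frontier_coord hz h2 this⟩

section chord

variable (f : ℝ → ℝ) (u v : ℝ)

/-- The slope of the chord of the graph of `f` over `[u, v]`. -/
noncomputable def slp : ℝ := (f v - f u) / (v - u)

variable {f u v}

lemma slp_mul (huv : u < v) : slp f u v * (v - u) = f v - f u :=
  div_mul_cancel₀ _ (by linarith)

lemma nrm_slp (huv : u < v) : nrm f v (slp f u v) = nrm f u (slp f u v) := by
  have := slp_mul (f := f) huv
  apply ext_coord <;> simp [nrm]
  linarith

lemma cr_pt (huv : u < v) : cr (pt f u) (pt f v) =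
    ((v - u) / (‖vec f u‖ * ‖vec f v‖)) • nrm f u (slp f u v) := by
  have h := slp_mul (f := f) huv
  have h1 := (norm_vec_pos f u).ne'
  have h2 := (norm_vec_pos f v).ne'
  apply ext_coord <;> simp [pt, nrm] <;> field_simp
  · linarith
  · linear_combination (-u) * h

lemma trip_pt (huv : u < v) (z : E3) : trip (pt f u) (pt f v) z =
    ((v - u) / (‖vec f u‖ * ‖vec f v‖)) * ⟪nrm f u (slp f u v), z⟫ := by
  rw [trip, cr_pt huv, inner_smul_left]; rfl

lemma chord_coeff_pos (huv : u < v) : 0 < (v - u) / (‖vec f u‖ * ‖vec f v‖) := by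
  have h1 := norm_vec_pos f u
  have h2 := norm_vec_pos f v
  have : 0 < v - u := by linarith
  positivity

lemma trip_pt_vec_neg_iff (huv : u < v) (z : E3) :
    trip (pt f u) (pt f v) z < 0 ↔ ⟪nrm f u (slp f u v), z⟫ < 0 := by
  rw [trip_pt huv, mul_neg_iff]
  have := chord_coeff_pos (f := f) huv
  constructor
  · rintro (h | h)
    · exact h.2
    · linarith [h.1]
  · intro h; exact Or.inl ⟨this, h⟩

lemma inner_nrm_slp_pt (huv : u < v) (t : ℝ) :
    ⟪nrm f u t, pt f v⟫ = (v - u) / ‖vec f v‖ * (slp f u v - t) := by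
  have h := slp_mul (f := f) huv
  have h2 := (norm_vec_pos f v).ne'
  rw [pt, inner_smul_right, inner_nrm]
  simp
  field_simp
  linear_combination (-1 : ℝ) * h

lemma inner_nrm_slp_pt' (huv : u < v) (t : ℝ) :
    ⟪nrm f v t, pt f u⟫ = (v - u) / ‖vec f u‖ * (t - slp f u v) := by
  have h := slp_mul (f := f) huv
  have h2 := (norm_vec_pos f u).ne'
  rw [pt, inner_smul_right, inner_nrm]
  simp
  field_simp
  linear_combination h

/-- If the slopes of the supporting lines at the ends of an arc differ little, the arc is contained
in a flat triangle over its chord. -/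
lemma Chart.mem_hull_of_slopes {K : Set E3} (hK : Body K) (hf : Chart K f) {s t η : ℝ}
    (huv : u < v) (hs : SubG f u s) (ht : SubG f v t)
    (h1 : (slp f u v - s) * ‖vec f u‖ ≤ η * ⟪nrm f u s, nrm f u (slp f u v)⟫)
    (h2 : (t - slp f u v) * ‖vec f v‖ ≤ η * ⟪nrm f v t, nrm f v (slp f u v)⟫)
    (hη : 0 < η) {z : E3} (hz : z ∈ K) (hneg : trip (pt f u) (pt f v) z < 0) :
    z ∈ hull (pt f u) (pt f v) (pt f u + pt f v - η • cr (pt f u) (pt f v)) := by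
  have hP := norm_vec_pos f u
  have hQ := norm_vec_pos f v
  have huv' : 0 < v - u := by linarith
  have hzu := hf.nrm_nonneg hK hs hz
  have hzv := hf.nrm_nonneg hK ht hz
  have hneg' := (trip_pt_vec_neg_iff huv z).1 hneg
  have hs1 : s < slp f u v := by
    refine lt_of_le_of_ne (hs.le_slope huv) ?_
    rintro rfl
    linarith
  have ht1 : slp f u v < t := by
    refine lt_of_le_of_ne (ht.slope_le huv) ?_
    intro h
    rw [← nrm_slp huv, h] at hneg'
    linarith
  have hcr : 0 < ‖cr (pt f u) (pt f v)‖ ^ 2 := by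
    rcases (norm_nonneg (cr (pt f u) (pt f v))).eq_or_lt' with h | h
    · rw [norm_eq_zero] at h
      simp [trip, h] at hneg
    · positivity
  refine mem_hull_of_supports (Na := nrm f u s) (Nb := nrm f v t) ?_ ?_ ?_ ?_ ?_ ?_ ?_ hneg.le
    hzu hzv
  · rw [trip_sub, trip_add, trip_smul]; simp; positivity
  · simp
  · rw [inner_nrm_slp_pt huv]
    have : 0 < slp f u v - s := by linarith
    positivity
  · rw [inner_sub_right, inner_add_right, inner_smul_right, inner_nrm_slp_pt huv, cr_pt huv,
      inner_smul_right]
    have : (v - u) / ‖vec f v‖ * (slp f u v - s) - η * ((v - u) / (‖vec f u‖ * ‖vec f v‖) *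
        ⟪nrm f u s, nrm f u (slp f u v)⟫) = (v - u) / (‖vec f u‖ * ‖vec f v‖) *
        ((slp f u v - s) * ‖vec f u‖ - η * ⟪nrm f u s, nrm f u (slp f u v)⟫) := by
      field_simp
    simp only [inner_nrm_pt, zero_add]
    rw [this]
    exact mul_nonpos_of_nonneg_of_nonpos (by positivity) (by linarith)
  · simp
  · rw [inner_nrm_slp_pt' huv]
    have : 0 < t - slp f u v := by linarith
    positivity
  · rw [inner_sub_right, inner_add_right, inner_smul_right, inner_nrm_slp_pt' huv, cr_pt huv,
      inner_smul_right, ← nrm_slp huv]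
    have : (v - u) / ‖vec f u‖ * (t - slp f u v) - η * ((v - u) / (‖vec f u‖ * ‖vec f v‖) *
        ⟪nrm f v t, nrm f v (slp f u v)⟫) = (v - u) / (‖vec f u‖ * ‖vec f v‖) *
        ((t - slp f u v) * ‖vec f v‖ - η * ⟪nrm f v t, nrm f v (slp f u v)⟫) := by
      field_simp
    simp only [inner_nrm_pt, add_zero]
    rw [this]
    exact mul_nonpos_of_nonneg_of_nonpos (by positivity) (by linarith)

end chord

/-- Close slopes at points close to `a` satisfy the estimates that make an arc flat. -/
lemma exists_slope_estimate {f : ℝ → ℝ} (hf : Continuous f) (a S : ℝ) {η : ℝ} (hη : 0 < η) :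
    ∃ ε > 0, ∀ u, |u - a| < ε → ∀ t s, |t - S| < ε → |s - S| < ε →
      |s - t| * ‖vec f u‖ < η * ⟪nrm f u t, nrm f u s⟫ := by
  set F : ℝ × ℝ × ℝ → ℝ := fun p => η * (p.2.1 * p.2.2 + 1 +
    (p.2.1 * p.1 - f p.1) * (p.2.2 * p.1 - f p.1)) -
      |p.2.2 - p.2.1| * √(p.1 ^ 2 + f p.1 ^ 2 + 1) with hF
  have hc : Continuous F := by fun_prop
  have h0 : 0 < F (a, S, S) := by
    simp only [hF, sub_self, abs_zero, zero_mul, sub_zero]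
    nlinarith [mul_self_nonneg S, mul_self_nonneg (S * a - f a), hη]
  obtain ⟨ε, hε, h⟩ := Metric.eventually_nhds_iff.1 (hc.continuousAt.eventually (lt_mem_nhds h0))
  refine ⟨ε, hε, fun u hu t s ht hs => ?_⟩
  have := h (y := (u, t, s)) (by
    simp only [Prod.dist_eq, Real.dist_eq]
    exact max_lt hu (max_lt ht hs))
  rw [inner_nrm_nrm, ← Real.sqrt_sq (norm_nonneg (vec f u)), norm_vec_sq]
  simp only [hF] at this
  linarith

lemma slp_between {f : ℝ → ℝ} {u v s t S ε : ℝ} (huv : u < v) (hs : SubG f u s) (ht : SubG f v t)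
    (h1 : |s - S| < ε) (h2 : |t - S| < ε) : |slp f u v - S| < ε := by
  have h3 : s ≤ slp f u v := hs.le_slope huv
  have h4 : slp f u v ≤ t := ht.slope_le huv
  rw [abs_lt] at *
  constructor <;> linarith [h1.1, h2.2]

/-- `K` lies, beyond the chord from `p` to `q`, in the isosceles triangle of slope `η`. -/
def Flat (K : Set E3) (η : ℝ) (p q : E3) : Prop :=
  ∀ z ∈ K, trip p q z < 0 → z ∈ hull p q (p + q - η • cr p q)

/-- Near a point of differentiability all arcs are flat. -/
lemma Chart.eventually_flat {K : Set E3} (hK : Body K) {f : ℝ → ℝ} (hf : Chart K f) {a : ℝ}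
    (ha : dL f a = dR f a) {η : ℝ} (hη : 0 < η) :
    ∃ ρ > 0, ∀ u v, |u - a| < ρ → |v - a| < ρ → u < v → Flat K η (pt f u) (pt f v) := by
  obtain ⟨ε, hε, h⟩ := exists_slope_estimate (continuous_of_convex hf.convex) a (dR f a) hη
  obtain ⟨ρ, hρ, h'⟩ := Metric.eventually_nhds_iff.1 (eventually_subG hf.convex ha hε)
  refine ⟨min ρ ε, lt_min hρ hε, fun u v hu hv huv z hz hneg => ?_⟩
  have hs := subG_dR hf.convex u
  have ht := subG_dR hf.convex v
  have hs' := h' (lt_of_lt_of_le hu (min_le_left _ _)) _ hs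
  have ht' := h' (lt_of_lt_of_le hv (min_le_left _ _)) _ ht
  have hm := slp_between huv hs ht hs' ht'
  refine hf.mem_hull_of_slopes hK huv hs ht ?_ ?_ hη hz hneg
  · refine (mul_le_mul_of_nonneg_right (le_abs_self _) (norm_nonneg _)).trans
      (h u (lt_of_lt_of_le hu (min_le_right _ _)) _ _ hs' hm).le
  · rw [← neg_sub (slp f u v)]
    refine (mul_le_mul_of_nonneg_right (neg_le_abs _) (norm_nonneg _)).trans
      (h v (lt_of_lt_of_le hv (min_le_right _ _)) _ _ ht' hm).le

lemma continuous_vec {f : ℝ → ℝ} (hf : Continuous f) : Continuous (vec f) := by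
  unfold vec; fun_prop

lemma continuous_pt {f : ℝ → ℝ} (hf : Continuous f) : Continuous (pt f) := by
  have := continuous_vec hf
  exact (this.norm.inv₀ fun u => (norm_vec_pos f u).ne').smul this

/-- Near a point of differentiability, the inner side of a short chord contains any triangle of
given shape. -/
lemma Chart.eventually_mem_interior {K : Set E3} {f : ℝ → ℝ} (hf : Chart K f) {a : ℝ}
    (ha : dL f a = dR f a) (A : ℝ) {M : ℝ} (hM : 0 < M) :
    ∃ ρ > 0, ∀ u v, |u - a| < ρ → |v - a| < ρ → u < v →
      pt f u + A • (pt f v - pt f u) + M • cr (pt f u) (pt f v) ∈ interior K := by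
  have hfc := continuous_of_convex hf.convex
  have hη : 0 < M / (1 + |A|) := by positivity
  obtain ⟨ε, hε, h⟩ := exists_slope_estimate hfc a (dR f a) hη
  obtain ⟨ρ, hρ, h'⟩ := Metric.eventually_nhds_iff.1 (eventually_subG hf.convex ha hε)
  set y : ℝ × ℝ → E3 := fun w => pt f w.1 + A • (pt f w.2 - pt f w.1) +
    M • cr (pt f w.1) (pt f w.2)
  have hpc := continuous_pt hfc
  have hyc : Continuous y := by
    have h1 : Continuous fun w : ℝ × ℝ => cr (pt f w.1) (pt f w.2) :=
      continuous_cr.comp (by fun_prop : Continuous fun w : ℝ × ℝ => (pt f w.1, pt f w.2))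
    fun_prop
  have hya : y (a, a) = pt f a := by
    have : cr (pt f a) (pt f a) = 0 := by apply ext_coord <;> simp <;> ring
    simp [y, this]
  have h2 : ∀ᶠ w in 𝓝 (a, a), 0 < y w 2 := by
    have hc2 : ContinuousAt (fun w => y w 2) (a, a) := by fun_prop
    exact hc2.eventually (lt_mem_nhds (by show 0 < y (a, a) 2; rw [hya]; exact pt_two_pos f a))
  have h3 : ∀ᶠ w in 𝓝 (a, a), dist (y w 0 / y w 2) a < ρ := by
    have hc2 : ContinuousAt (fun w => y w 0 / y w 2) (a, a) :=
      ContinuousAt.div (by fun_prop) (by fun_prop) (by rw [hya]; exact (pt_two_pos f a).ne')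
    have : y (a, a) 0 / y (a, a) 2 = a := by rw [hya, pt_zero_div]
    have h4 := hc2.tendsto
    rw [this] at h4
    exact h4.eventually (Metric.ball_mem_nhds a hρ)
  obtain ⟨δ, hδ, h5⟩ := Metric.eventually_nhds_iff.1 (h2.and h3)
  refine ⟨min δ (min ρ ε), by positivity, fun u v hu hv huv => ?_⟩
  simp only [lt_min_iff] at hu hv
  obtain ⟨hy2, hy0⟩ := h5 (y := (u, v)) (by
    simp only [Prod.dist_eq, Real.dist_eq]; exact max_lt hu.1 hv.1)
  change y (u, v) ∈ interior K
  rw [hf.mem_interior_iff hy2]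
  set Y := y (u, v) with hY
  set w := Y 0 / Y 2
  have hs := subG_dR hf.convex u
  have ht := subG_dR hf.convex v
  have hw := subG_dR hf.convex w
  have hm := slp_between huv hs ht (h' hu.2.1 _ hs) (h' hv.2.1 _ ht)
  have hw' := h' hy0 _ hw
  have hest := h u hu.2.2 _ _ hw' hm
  -- the supporting line at `w` passes below the graph at `u`
  have hbelow := hw u
  have hpos : 0 < ⟪nrm f u (dR f w), Y⟫ := by
    have e : ⟪nrm f u (dR f w), Y⟫ = (v - u) / (‖vec f u‖ * ‖vec f v‖) *
        (A * ((slp f u v - dR f w) * ‖vec f u‖) +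
          M * ⟪nrm f u (dR f w), nrm f u (slp f u v)⟫) := by
      have hP := norm_vec_pos f u
      have hQ := norm_vec_pos f v
      simp only [hY, y]
      rw [inner_add_right, inner_add_right, inner_smul_right, inner_smul_right, inner_sub_right,
        cr_pt huv, inner_smul_right, inner_nrm_slp_pt huv, inner_nrm_pt]
      field_simp
      ring
    rw [e]
    refine mul_pos (chord_coeff_pos huv) ?_
    have hA : -(|A| * (|slp f u v - dR f w| * ‖vec f u‖)) ≤
        A * ((slp f u v - dR f w) * ‖vec f u‖) := by
      have := neg_abs_le (A * ((slp f u v - dR f w) * ‖vec f u‖))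
      rwa [abs_mul, abs_mul, abs_of_nonneg (norm_nonneg (vec f u))] at this
    have hA0 := abs_nonneg A
    have hX : 0 ≤ |slp f u v - dR f w| * ‖vec f u‖ := by positivity
    have h6 : (1 + |A|) * (|slp f u v - dR f w| * ‖vec f u‖) <
        M * ⟪nrm f u (dR f w), nrm f u (slp f u v)⟫ := by
      rw [div_mul_eq_mul_div, lt_div_iff₀ (by positivity)] at hest
      linarith
    nlinarith
  rw [inner_nrm] at hpos
  rw [lt_div_iff₀ hy2]
  have e2 : w * Y 2 = Y 0 := div_mul_cancel₀ _ hy2.ne'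
  have h6 : (f w + dR f w * (u - w)) * Y 2 ≤ f u * Y 2 :=
    mul_le_mul_of_nonneg_right hbelow hy2.le
  have h7 : (f w + dR f w * (u - w)) * Y 2 =
      f w * Y 2 + dR f w * u * Y 2 - dR f w * (w * Y 2) := by ring
  rw [h7, e2] at h6
  linarith

end SphericalPlane

namespace SphericalPlane

/-! ### Lenses -/

lemma hull_smul_right {a b X : E3} {t : ℝ} (ht : 0 < t) : hull a b X ⊆ hull a b (t • X) := by
  rintro _ ⟨α, β, γ, h1, h2, h3, rfl⟩
  refine ⟨α, β, γ / t, h1, h2, by positivity, ?_⟩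
  rw [smul_smul, div_mul_cancel₀ _ ht.ne']

lemma hull_swap (a b X : E3) : hull a b X ⊆ hull b a X := by
  rintro _ ⟨α, β, γ, h1, h2, h3, rfl⟩
  exact ⟨β, α, γ, h2, h1, h3, by abel⟩

/-- The apex of the flat triangle over the chord from `p` to `q`; `η` may be negative. -/
noncomputable def apex (η : ℝ) (p q : E3) : E3 := p + q - η • cr p q

lemma apex_swap (η : ℝ) (p q : E3) : apex η q p = apex (-η) p q := by
  rw [apex, apex, cr_swap q p]; module

lemma norm_apex_sq {p q : E3} (hp : ‖p‖ = 1) (hq : ‖q‖ = 1) (η : ℝ) : ‖apex η p q‖ ^ 2 =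
    2 + 2 * ⟪p, q⟫ + η ^ 2 * (1 - ⟪p, q⟫ ^ 2) := by
  have h := norm_cr_sq p q
  rw [hp, hq] at h
  have h1 : ⟪p + q, cr p q⟫ = 0 := by
    rw [inner_add_left, real_inner_comm, inner_cr_left, real_inner_comm, inner_cr_right, add_zero]
  rw [apex, norm_sub_sq_real, norm_smul, mul_pow, h, inner_smul_right, h1, norm_add_sq_real, hp, hq,
    Real.norm_eq_abs, sq_abs]
  ring

lemma inner_apex_left {p q : E3} (hp : ‖p‖ = 1) (η : ℝ) : ⟪p, apex η p q⟫ = 1 + ⟪p, q⟫ := by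
  rw [apex, inner_sub_right, inner_add_right, inner_smul_right, real_inner_self_eq_norm_sq, hp,
    real_inner_comm (cr p q) p, inner_cr_left]
  ring

lemma inner_apex_right {p q : E3} (hq : ‖q‖ = 1) (η : ℝ) : ⟪q, apex η p q⟫ = 1 + ⟪p, q⟫ := by
  rw [apex, inner_sub_right, inner_add_right, inner_smul_right, real_inner_self_eq_norm_sq, hq,
    real_inner_comm (cr p q) q, inner_cr_right, real_inner_comm]
  ring

lemma inner_apex_apex {p q : E3} (hp : ‖p‖ = 1) (hq : ‖q‖ = 1) (η : ℝ) :
    ⟪apex η p q, apex (-η) p q⟫ = 2 + 2 * ⟪p, q⟫ - η ^ 2 * (1 - ⟪p, q⟫ ^ 2) := by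
  have h := norm_cr_sq p q
  rw [hp, hq] at h
  have h1 := inner_cr_left p q
  have h2 := inner_cr_right p q
  simp only [apex, inner_sub_left, inner_sub_right, inner_add_left, inner_add_right,
    inner_smul_left, inner_smul_right, real_inner_self_eq_norm_sq, hp, hq, h, h1, h2,
    real_inner_comm (cr p q) p, real_inner_comm (cr p q) q, real_inner_comm p q]
  simp
  ring

/-- The distances of the apices of two flat triangles over the same chord to each other and to the
ends of the chord are smaller than the length of the chord. -/
lemma apex_ineq {p q : E3} (hp : ‖p‖ = 1) (hq : ‖q‖ = 1) (hc : 0 ≤ ⟪p, q⟫) (hc1 : ⟪p, q⟫ < 1)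
    {η : ℝ} (hη : η ^ 2 < 1) :
    0 < ‖apex η p q‖ ∧ ⟪p, q⟫ * ‖apex η p q‖ < 1 + ⟪p, q⟫ ∧
    ⟪p, q⟫ * (‖apex η p q‖ * ‖apex (-η) p q‖) < ⟪apex η p q, apex (-η) p q⟫ := by
  set c := ⟪p, q⟫ with hcdef
  have h1 := norm_apex_sq hp hq η
  have h2 := norm_apex_sq hp hq (-η)
  rw [← hcdef] at h1 h2
  have hcc : 0 < 1 - c ^ 2 := by nlinarith
  have hpos : 0 < ‖apex η p q‖ := by
    rcases (norm_nonneg (apex η p q)).eq_or_lt' with h | h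
    · rw [h] at h1; nlinarith [mul_nonneg (sq_nonneg η) hcc.le]
    · exact h
  have heq : ‖apex (-η) p q‖ = ‖apex η p q‖ := by
    rw [neg_sq, ← h1] at h2
    exact (pow_left_inj₀ (norm_nonneg _) (norm_nonneg _) two_ne_zero).1 h2
  refine ⟨hpos, ?_, ?_⟩
  · refine lt_of_pow_lt_pow_left₀ 2 (by linarith) ?_
    rw [mul_pow, h1]
    nlinarith [mul_nonneg (sq_nonneg c) hcc.le, mul_nonneg hc hcc.le,
      mul_nonneg (mul_nonneg (sq_nonneg c) hcc.le) (by linarith : 0 ≤ 1 - η ^ 2)]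
  · rw [heq, ← sq, h1, inner_apex_apex hp hq]
    nlinarith [mul_pos hcc (by linarith : 0 < 1 - η ^ 2), mul_nonneg hc (sub_pos.2 hc1).le,
      mul_nonneg (mul_nonneg hc hcc.le) (by linarith : 0 ≤ 1 - η ^ 2), sq_nonneg η]

/-- The chord is the only diameter of the union of the two flat triangles over it. -/
lemma inner_ge_of_mem_apex {p q : E3} (hp : ‖p‖ = 1) (hq : ‖q‖ = 1) (hc : 0 ≤ ⟪p, q⟫)
    (hc1 : ⟪p, q⟫ < 1) {η : ℝ} (hη : η ^ 2 < 1) {z z' : E3} (hz : ‖z‖ = 1) (hz' : ‖z'‖ = 1)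
    (hzm : z ∈ hull p q (apex η p q) ∪ hull p q (apex (-η) p q))
    (hzm' : z' ∈ hull p q (apex η p q) ∪ hull p q (apex (-η) p q)) :
    ⟪p, q⟫ ≤ ⟪z, z'⟫ ∧ (⟪z, z'⟫ = ⟪p, q⟫ → (z = p ∧ z' = q) ∨ (z = q ∧ z' = p)) := by
  obtain ⟨h1, h2, h3⟩ := apex_ineq hp hq hc hc1 hη
  obtain ⟨h1', h2', -⟩ := apex_ineq hp hq hc hc1 (η := -η) (by simpa using hη)
  have n1 : ‖(‖apex η p q‖⁻¹ • apex η p q)‖ = 1 := by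
    rw [norm_smul, norm_inv, norm_norm, inv_mul_cancel₀ h1.ne']
  have n2 : ‖(‖apex (-η) p q‖⁻¹ • apex (-η) p q)‖ = 1 := by
    rw [norm_smul, norm_inv, norm_norm, inv_mul_cancel₀ h1'.ne']
  have sub : ∀ y ∈ hull p q (apex η p q) ∪ hull p q (apex (-η) p q),
      y ∈ hull p q (‖apex η p q‖⁻¹ • apex η p q) ∪
        hull p q (‖apex (-η) p q‖⁻¹ • apex (-η) p q) := by
    rintro y (hy | hy)
    · exact Or.inl (hull_smul_right (inv_pos.2 h1) hy)
    · exact Or.inr (hull_smul_right (inv_pos.2 h1') hy)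
  refine inner_ge_of_mem_hull hp hq n1 n2 hc hc1 ?_ ?_ ?_ ?_ ?_ hz hz' (sub z hzm) (sub z' hzm')
  · rw [inner_smul_right, inner_apex_left hp, inv_mul_eq_div, lt_div_iff₀ h1]; exact h2
  · rw [inner_smul_right, inner_apex_right hq, inv_mul_eq_div, lt_div_iff₀ h1]; exact h2
  · rw [inner_smul_right, inner_apex_left hp, inv_mul_eq_div, lt_div_iff₀ h1']; exact h2'
  · rw [inner_smul_right, inner_apex_right hq, inv_mul_eq_div, lt_div_iff₀ h1']; exact h2'
  · rw [inner_smul_left, inner_smul_right, ← mul_assoc]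
    have : (starRingEnd ℝ) ‖apex η p q‖⁻¹ * ‖apex (-η) p q‖⁻¹ =
        (‖apex η p q‖ * ‖apex (-η) p q‖)⁻¹ := by
      rw [mul_inv]; rfl
    rw [this, inv_mul_eq_div, lt_div_iff₀ (by positivity)]
    exact h3

/-- Homogeneous inequalities valid on the flat triangle hold on the part of `K` in the plane of the
chord, which is approximated by points of `K` beyond the chord. -/
lemma inner_nonneg_of_flat {K : Set E3} (hK : Body K) {p q w : E3} {η : ℝ} (hw : w ∈ K)
    (hneg : trip p q w < 0) (hF : Flat K η p q) {z : E3} (hz : z ∈ K) (h0 : trip p q z ≤ 0)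
    {n1 n2 n3 : E3}
    (hh : ∀ y ∈ hull p q (apex η p q), 0 ≤ ⟪n1, y⟫ ∧ 0 ≤ ⟪n2, y⟫ ∧ 0 ≤ ⟪n3, y⟫) :
    0 ≤ ⟪n1, z⟫ ∧ 0 ≤ ⟪n2, z⟫ ∧ 0 ≤ ⟪n3, z⟫ := by
  have hmem : ∀ t : ℝ, 0 < t → z + t • w ∈ hull p q (apex η p q) := by
    intro t ht
    refine hF _ (hK.add _ hz _ (hK.smul t ht.le _ hw)) ?_
    rw [trip_add, trip_smul]
    nlinarith
  have lim : ∀ n : E3, (∀ t : ℝ, 0 < t → 0 ≤ ⟪n, z + t • w⟫) → 0 ≤ ⟪n, z⟫ := by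
    intro n hn
    have hc : Continuous fun t : ℝ => ⟪n, z + t • w⟫ := by fun_prop
    have ht := (hc.tendsto 0).mono_left (nhdsWithin_le_nhds (s := Ioi 0))
    simp only [zero_smul, add_zero] at ht
    refine ge_of_tendsto ht ?_
    filter_upwards [self_mem_nhdsWithin] with t ht'
    exact hn t ht'
  exact ⟨lim n1 fun t ht => (hh _ (hmem t ht)).1, lim n2 fun t ht => (hh _ (hmem t ht)).2.1,
    lim n3 fun t ht => (hh _ (hmem t ht)).2.2⟩

/-- If `K` has points beyond the chord, then also the part of `K` in the plane of the chord is
contained in the flat triangle. -/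
lemma Flat.mem_hull {K : Set E3} (hK : Body K) {p q w : E3} {η : ℝ} (hη : 0 < η) (hw : w ∈ K)
    (hneg : trip p q w < 0) (hF : Flat K η p q) {z : E3} (hz : z ∈ K) (h0 : trip p q z ≤ 0) :
    z ∈ hull p q (apex η p q) := by
  have hcr : 0 < ‖cr p q‖ ^ 2 := by
    rcases (norm_nonneg (cr p q)).eq_or_lt' with h | h
    · rw [norm_eq_zero] at h
      simp [trip, h] at hneg
    · positivity
  set Y := apex η p q with hY
  have hdet : 0 < trip q p Y := by
    rw [trip_swap, hY, apex, trip_sub, trip_add, trip_smul]; simp; positivity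
  have e : ∀ a b y : E3, ⟪cr a b, y⟫ = trip a b y := fun a b y => rfl
  have := inner_nonneg_of_flat hK hw hneg hF hz h0 (n1 := cr q p) (n2 := cr p Y) (n3 := cr Y q) (by
    rintro _ ⟨α, β, γ, h1, h2, h3, rfl⟩
    have e1 := trip_rot q p Y
    have e2 := trip_rot p Y q
    have d1 : 0 < trip p Y q := e1 ▸ hdet
    have d2 : 0 < trip Y q p := e2 ▸ d1
    simp only [e, ← hY, trip_add, trip_smul, trip_self_left, trip_self_right, mul_zero,
      zero_add, add_zero]
    exact ⟨mul_nonneg h3 hdet.le, mul_nonneg h2 d1.le, mul_nonneg h1 d2.le⟩)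
  simp only [e] at this
  refine hull_swap _ _ _ (mem_hull_of_trip hdet ?_ ?_ this.1)
  · rw [trip_rot]; exact this.2.1
  · rw [trip_rot, trip_rot]; exact this.2.2

/-- Two convex cones that overlap in a lens with vertices `p` and `q`; the first one has points
beyond the chord. -/
structure Lens (K M : Set E3) (p q : E3) : Prop where
  hK : Body K
  hM : Body M
  np : ‖p‖ = 1
  nq : ‖q‖ = 1
  pos : 0 ≤ ⟪p, q⟫
  lt : ⟪p, q⟫ < 1
  pK : p ∈ K
  qK : q ∈ K
  pM : p ∈ M
  qM : q ∈ M
  flatK : Flat K (1 / 2) p q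
  flatM : Flat M (1 / 2) q p
  intK : apex (-(1 / 2)) p q ∈ interior K
  intM : apex (1 / 2) p q ∈ interior M
  curved : ∃ w ∈ K, trip p q w < 0

namespace Lens

variable {K M : Set E3} {p q : E3}

lemma cr_ne (h : Lens K M p q) : cr p q ≠ 0 := by
  intro h0
  obtain ⟨w, -, hw⟩ := h.curved
  simp [trip, h0] at hw

lemma memM (h : Lens K M p q) {z : E3} (hz : z ∈ M) (h0 : 0 < trip p q z) :
    z ∈ hull p q (apex (-(1 / 2)) p q) := by
  have h1 := h.flatM z hz (by rw [trip_swap]; linarith)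
  have h2 := hull_swap _ _ _ h1
  have h3 : q + p - (1 / 2 : ℝ) • cr q p = apex (1 / 2) q p := rfl
  rwa [h3, apex_swap] at h2

lemma mem_union (h : Lens K M p q) {z : E3} (hzK : z ∈ K) (hzM : z ∈ M) :
    z ∈ hull p q (apex (1 / 2) p q) ∪ hull p q (apex (-(1 / 2)) p q) := by
  obtain ⟨w, hw, hneg⟩ := h.curved
  rcases le_or_gt (trip p q z) 0 with h0 | h0
  · exact Or.inl (h.flatK.mem_hull h.hK (by norm_num) hw hneg hzK h0)
  · exact Or.inr (h.memM hzM h0)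

lemma mem_interior_of_hull {B : Set E3} (hB : Body B) (hp : p ∈ B) (hq : q ∈ B) {X : E3}
    (hX : X ∈ interior B) {z : E3} (hz : z ∈ hull p q X) (h0 : trip p q z ≠ 0) :
    z ∈ interior B := by
  obtain ⟨α, β, γ, h1, h2, h3, rfl⟩ := hz
  have hγ : 0 < γ := by
    refine lt_of_le_of_ne h3 fun h => h0 ?_
    rw [← h, trip_add, trip_add, trip_smul, trip_smul, trip_smul]; simp
  rw [add_comm]
  exact hB.add_mem_interior (hB.smul_mem_interior hX hγ)
    (hB.add _ (hB.smul _ h1 _ hp) _ (hB.smul _ h2 _ hq))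

lemma mem_interior_M (h : Lens K M p q) {z : E3} (hz : z ∈ K) (h0 : trip p q z < 0) :
    z ∈ interior M :=
  mem_interior_of_hull h.hM h.pM h.qM h.intM (h.flatK z hz h0) h0.ne

lemma mem_interior_K (h : Lens K M p q) {z : E3} (hz : z ∈ M) (h0 : 0 < trip p q z) :
    z ∈ interior K :=
  mem_interior_of_hull h.hK h.pK h.qK h.intK (h.memM hz h0) h0.ne'

lemma inner_ge (h : Lens K M p q) {z z' : E3} (hz : ‖z‖ = 1) (hz' : ‖z'‖ = 1)
    (hzm : z ∈ K ∩ M) (hzm' : z' ∈ K ∩ M) :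
    ⟪p, q⟫ ≤ ⟪z, z'⟫ ∧ (⟪z, z'⟫ = ⟪p, q⟫ → (z = p ∧ z' = q) ∨ (z = q ∧ z' = p)) :=
  inner_ge_of_mem_apex h.np h.nq h.pos h.lt (by norm_num) hz hz'
    (h.mem_union hzm.1 hzm.2) (h.mem_union hzm'.1 hzm'.2)

lemma interior_nonempty (h : Lens K M p q) : (interior (K ∩ M)).Nonempty := by
  obtain ⟨w, hw, hneg⟩ := h.curved
  have hc : Continuous fun t : ℝ => trip p q (w + t • apex (-(1 / 2)) p q) := by
    simp only [trip]; fun_prop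
  have h1 : ∀ᶠ t in 𝓝[>] (0 : ℝ), trip p q (w + t • apex (-(1 / 2)) p q) < 0 := by
    refine ((hc.tendsto 0).eventually (gt_mem_nhds ?_)).filter_mono nhdsWithin_le_nhds
    simpa using hneg
  obtain ⟨t, ht, ht0⟩ := (h1.and self_mem_nhdsWithin).exists
  have hint : w + t • apex (-(1 / 2)) p q ∈ interior K := by
    rw [add_comm]; exact h.hK.add_mem_interior (h.hK.smul_mem_interior h.intK ht0) hw
  refine ⟨w + t • apex (-(1 / 2)) p q, ?_⟩
  rw [interior_inter]
  exact ⟨hint, h.mem_interior_M (interior_subset hint) ht⟩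

/-- Symmetries of a lens preserve its unique diametral pair. -/
lemma perm (h : Lens K M p q) {g : E3 ≃ₗᵢ[ℝ] E3} (hg : g '' (K ∩ M) = K ∩ M) :
    (g p = p ∧ g q = q) ∨ (g p = q ∧ g q = p) := by
  have hm : ∀ z ∈ K ∩ M, g z ∈ K ∩ M := fun z hz => hg ▸ ⟨z, hz, rfl⟩
  exact (h.inner_ge (by rw [g.norm_map, h.np]) (by rw [g.norm_map, h.nq]) (hm p ⟨h.pK, h.pM⟩)
    (hm q ⟨h.qK, h.qM⟩)).2 (g.inner_map_map p q)

/-- Beyond the chord, the boundary of the lens is the boundary of `K`. -/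
lemma mem_frontier_K_iff (h : Lens K M p q) {z : E3} (hneg : trip p q z < 0) :
    z ∈ frontier K ↔ z ∈ frontier (K ∩ M) := by
  rw [h.hK.mem_frontier_iff, (h.hK.closed.inter h.hM.closed).frontier_eq, interior_inter]
  refine ⟨fun hz => ?_, fun hz => ⟨hz.1.1, fun hi => hz.2 ⟨hi, h.mem_interior_M hz.1.1 hneg⟩⟩⟩
  exact ⟨⟨hz.1, interior_subset (h.mem_interior_M hz.1 hneg)⟩, fun hi => hz.2 hi.1⟩

/-- On the inner side of the chord, the boundary of the lens is the boundary of `M`. -/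
lemma mem_frontier_M_iff (h : Lens K M p q) {z : E3} (hpos : 0 < trip p q z) :
    z ∈ frontier M ↔ z ∈ frontier (K ∩ M) := by
  rw [h.hM.mem_frontier_iff, (h.hK.closed.inter h.hM.closed).frontier_eq, interior_inter]
  refine ⟨fun hz => ?_, fun hz => ⟨hz.1.2, fun hi => hz.2 ⟨h.mem_interior_K hz.1.2 hpos, hi⟩⟩⟩
  exact ⟨⟨interior_subset (h.mem_interior_K hz.1 hpos), hz.1⟩, fun hi => hz.2 hi.2⟩

lemma map_mem_frontier {g : E3 ≃ₗᵢ[ℝ] E3} (hg : g '' (K ∩ M) = K ∩ M) {z : E3} :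
    g z ∈ frontier (K ∩ M) ↔ z ∈ frontier (K ∩ M) := by
  have : frontier (K ∩ M) = g '' frontier (K ∩ M) := by
    rw [← Body.frontier_image, hg]
  conv_lhs => rw [this]
  exact g.injective.mem_set_image

end Lens

end SphericalPlane

namespace SphericalPlane

/-! ### Symmetric and congruent arcs -/

/-- The arc of the curve `γ` over `[u, v]` has a symmetry interchanging its ends. -/
def SymArc (γ : ℝ → E3) (u v : ℝ) : Prop :=
  ∃ g : E3 ≃ₗᵢ[ℝ] E3, g (γ u) = γ v ∧ g (γ v) = γ u ∧
    ∀ x ∈ Ioo u v, ∃ y ∈ Ioo u v, g (γ x) = γ y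

/-- The arcs of the curves `γ` over `[u, v]` and `γ'` over `[u', v']` are congruent, with either
correspondence of their ends. -/
def CongArc (γ : ℝ → E3) (u v : ℝ) (γ' : ℝ → E3) (u' v' : ℝ) : Prop :=
  ∃ g : E3 ≃ₗᵢ[ℝ] E3, ((g (γ u) = γ' u' ∧ g (γ v) = γ' v') ∨ (g (γ u) = γ' v' ∧ g (γ v) = γ' u')) ∧
    (∀ x ∈ Ioo u v, ∃ y ∈ Ioo u' v', g (γ x) = γ' y) ∧
    ∀ y ∈ Ioo u' v', ∃ x ∈ Ioo u v, g (γ x) = γ' y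

lemma CongArc.symm {γ γ' : ℝ → E3} {u v u' v' : ℝ} (h : CongArc γ u v γ' u' v') :
    CongArc γ' u' v' γ u v := by
  obtain ⟨g, h1, h2, h3⟩ := h
  refine ⟨g.symm, ?_, ?_, ?_⟩
  · rcases h1 with ⟨h1, h1'⟩ | ⟨h1, h1'⟩
    · left; rw [← h1, ← h1']; simp
    · right; rw [← h1, ← h1']; simp
  · intro y hy
    obtain ⟨x, hx, hxy⟩ := h3 y hy
    exact ⟨x, hx, by rw [← hxy]; simp⟩
  · intro x hx
    obtain ⟨y, hy, hxy⟩ := h2 x hx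
    exact ⟨y, hy, by rw [← hxy]; simp⟩

lemma CongArc.trans {γ γ' γ'' : ℝ → E3} {u v u' v' u'' v'' : ℝ} (h : CongArc γ u v γ' u' v')
    (h' : CongArc γ' u' v' γ'' u'' v'') : CongArc γ u v γ'' u'' v'' := by
  obtain ⟨g, h1, h2, h3⟩ := h
  obtain ⟨k, h1', h2', h3'⟩ := h'
  refine ⟨g.trans k, ?_, ?_, ?_⟩
  · simp only [LinearIsometryEquiv.trans_apply]
    rcases h1 with ⟨a, b⟩ | ⟨a, b⟩ <;> rcases h1' with ⟨c, d⟩ | ⟨c, d⟩ <;> rw [a, b, c, d] <;> simp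
  · intro x hx
    obtain ⟨y, hy, hxy⟩ := h2 x hx
    obtain ⟨z, hz, hyz⟩ := h2' y hy
    exact ⟨z, hz, by rw [LinearIsometryEquiv.trans_apply, hxy, hyz]⟩
  · intro z hz
    obtain ⟨y, hy, hyz⟩ := h3' z hz
    obtain ⟨x, hx, hxy⟩ := h3 y hy
    exact ⟨x, hx, by rw [LinearIsometryEquiv.trans_apply, hxy, hyz]⟩

lemma SymArc.of_cong {γ γ' : ℝ → E3} {u v u' v' : ℝ} (hs : SymArc γ u v)
    (h : CongArc γ u v γ' u' v') : SymArc γ' u' v' := by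
  obtain ⟨s, s1, s2, s3⟩ := hs
  obtain ⟨g, h1, h2, h3⟩ := h
  refine ⟨(g.symm.trans s).trans g, ?_, ?_, ?_⟩
  · simp only [LinearIsometryEquiv.trans_apply]
    rcases h1 with ⟨a, b⟩ | ⟨a, b⟩ <;> rw [← a, ← b] <;> simp [s1, s2]
  · simp only [LinearIsometryEquiv.trans_apply]
    rcases h1 with ⟨a, b⟩ | ⟨a, b⟩ <;> rw [← a, ← b] <;> simp [s1, s2]
  · intro y hy
    obtain ⟨x, hx, hxy⟩ := h3 y hy
    obtain ⟨x', hx', hxx'⟩ := s3 x hx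
    obtain ⟨y', hy', hyy'⟩ := h2 x' hx'
    refine ⟨y', hy', ?_⟩
    simp only [LinearIsometryEquiv.trans_apply]
    rw [← hxy, g.symm_apply_apply, hxx', hyy']

/-- A chart of `K` in which all arcs over subintervals `[u, v]` of `(a - ρ, a + ρ)` are thin: beyond
the chord, `K` lies in a flat triangle over the chord, and the apex of the reflected triangle on the
inner side is an interior point of `K`. -/
structure FlatChart (K : Set E3) (f : ℝ → ℝ) (a ρ : ℝ) : Prop where
  body : Body K
  chart : Chart K f
  ρpos : 0 < ρ
  flat : ∀ u v, |u - a| < ρ → |v - a| < ρ → u < v → Flat K (1 / 2) (pt f u) (pt f v)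
  inner : ∀ u v, |u - a| < ρ → |v - a| < ρ → u < v →
    apex (-(1 / 2)) (pt f u) (pt f v) ∈ interior K
  up : ∀ u v, |u - a| < ρ → |v - a| < ρ → u < v → 0 < apex (1 / 2) (pt f u) (pt f v) 2
  pos : ∀ u v, |u - a| < ρ → |v - a| < ρ → 0 < ⟪pt f u, pt f v⟫

lemma Chart.exists_flatChart {K : Set E3} {f : ℝ → ℝ} (hK : Body K) (hf : Chart K f) {a : ℝ}
    (ha : dL f a = dR f a) : ∃ ρ, FlatChart K f a ρ := by
  obtain ⟨ρ₁, h1, h1'⟩ := hf.eventually_flat hK ha (η := 1 / 2) (by norm_num)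
  obtain ⟨ρ₂, h2, h2'⟩ := hf.eventually_mem_interior ha (1 / 2) (M := 1 / 4) (by norm_num)
  have hpc := continuous_pt (continuous_of_convex hf.convex)
  have hcr : Continuous fun w : ℝ × ℝ => cr (pt f w.1) (pt f w.2) :=
      continuous_cr.comp (by fun_prop : Continuous fun w : ℝ × ℝ => (pt f w.1, pt f w.2))
  have h3 : ∀ᶠ w in 𝓝 (a, a), 0 < apex (1 / 2) (pt f w.1) (pt f w.2) 2 := by
    have hc : Continuous fun w : ℝ × ℝ => apex (1 / 2) (pt f w.1) (pt f w.2) 2 := by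
      unfold apex; fun_prop
    refine (hc.tendsto (a, a)).eventually (lt_mem_nhds ?_)
    have := pt_two_pos f a
    simp [apex]
    linarith
  have h4 : ∀ᶠ w in 𝓝 (a, a), 0 < ⟪pt f w.1, pt f w.2⟫ := by
    have hc : Continuous fun w : ℝ × ℝ => ⟪pt f w.1, pt f w.2⟫ := by fun_prop
    refine (hc.tendsto (a, a)).eventually (lt_mem_nhds ?_)
    simp only [real_inner_self_eq_norm_sq, norm_pt]
    norm_num
  obtain ⟨δ, hδ, h5⟩ := Metric.eventually_nhds_iff.1 (h3.and h4)
  have h6 : ∀ u v, |u - a| < δ → |v - a| < δ → dist (u, v) (a, a) < δ := fun u v hu hv => by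
    simp only [Prod.dist_eq, Real.dist_eq]; exact max_lt hu hv
  refine ⟨min δ (min ρ₁ ρ₂), hK, hf, by positivity, ?_, ?_, ?_, ?_⟩
  · intro u v hu hv huv
    simp only [lt_min_iff] at hu hv
    exact h1' u v hu.2.1 hv.2.1 huv
  · intro u v hu hv huv
    simp only [lt_min_iff] at hu hv
    have := hK.smul_mem_interior (h2' u v hu.2.2 hv.2.2 huv) (t := 2) (by norm_num)
    convert this using 1
    rw [apex]; module
  · intro u v hu hv huv
    simp only [lt_min_iff] at hu hv
    exact (h5 (h6 u v hu.1 hv.1)).1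
  · intro u v hu hv
    simp only [lt_min_iff] at hu hv
    exact (h5 (h6 u v hu.1 hv.1)).2

section chord

variable {f : ℝ → ℝ}

lemma inner_nrm_pt_eq (u t x : ℝ) :
    ⟪nrm f u t, pt f x⟫ = ‖vec f x‖⁻¹ * (f x - (f u + t * (x - u))) := by
  rw [pt, inner_smul_right, inner_nrm, vec_zero, vec_one, vec_two]; ring

/-- Beyond the chord there are only points over the chord. -/
lemma mem_Ioo_of_trip_neg (hf : ConvexOn ℝ univ f) {u v x : ℝ} (huv : u < v)
    (h : trip (pt f u) (pt f v) (pt f x) < 0) : x ∈ Ioo u v := by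
  rw [trip_pt_vec_neg_iff huv] at h
  have hx := norm_vec_pos f x
  have h' := h
  rw [← nrm_slp huv] at h'
  rw [inner_nrm_pt_eq] at h h'
  have k := (mul_neg_iff.1 h).resolve_right (fun h => by linarith [inv_pos.2 hx])
  have k' := (mul_neg_iff.1 h').resolve_right (fun h => by linarith [inv_pos.2 hx])
  have hs := subG_dR hf u
  have ht := subG_dR hf v
  have h1 : dR f u ≤ slp f u v := hs.le_slope huv
  have h2 : slp f u v ≤ dR f v := ht.slope_le huv
  constructor
  · by_contra hcon
    push Not at hcon
    have := hs x
    nlinarith [k.2, mul_nonneg (sub_nonneg.2 h1) (sub_nonneg.2 hcon)]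
  · by_contra hcon
    push Not at hcon
    have := ht x
    nlinarith [k'.2, mul_nonneg (sub_nonneg.2 h2) (sub_nonneg.2 hcon)]

lemma trip_nonpos_of_mem_Ioo (hf : ConvexOn ℝ univ f) {u v x : ℝ} (hx : x ∈ Ioo u v) :
    trip (pt f u) (pt f v) (pt f x) ≤ 0 := by
  have huv := hx.1.trans hx.2
  rw [trip_pt huv, inner_nrm_pt_eq]
  refine mul_nonpos_of_nonneg_of_nonpos (chord_coeff_pos huv).le
    (mul_nonpos_of_nonneg_of_nonpos (inv_nonneg.2 (norm_nonneg _)) ?_)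
  have h := subG_dR hf x
  have h1 := h u
  have h2 := h v
  have h3 := slp_mul (f := f) huv
  have h4 : (f x - (f u + slp f u v * (x - u))) * (v - u) ≤ 0 := by
    have h5 : slp f u v * (v - u) * (x - u) = (f v - f u) * (x - u) := by rw [h3]
    have k1 := mul_le_mul_of_nonneg_right h1 (sub_nonneg.2 hx.2.le)
    have k2 := mul_le_mul_of_nonneg_right h2 (sub_nonneg.2 hx.1.le)
    nlinarith
  by_contra hcon
  push Not at hcon
  nlinarith [mul_pos hcon (sub_pos.2 huv)]

/-- If the graph touches its chord in an interior point, it contains the chord. -/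
lemma eq_chord_of_touch (hf : ConvexOn ℝ univ f) {u v x : ℝ} (hx : x ∈ Ioo u v)
    (h : trip (pt f u) (pt f v) (pt f x) = 0) {y : ℝ} (hy : y ∈ Ioo u v) :
    f y = f u + slp f u v * (y - u) := by
  have huv := hx.1.trans hx.2
  have conv : ∀ w, trip (pt f u) (pt f v) (pt f w) =
      (v - u) / (‖vec f u‖ * ‖vec f v‖) * (‖vec f w‖⁻¹ * (f w - (f u + slp f u v * (w - u)))) := by
    intro w; rw [trip_pt huv, inner_nrm_pt_eq]
  have hcx : f x = f u + slp f u v * (x - u) := by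
    rw [conv] at h
    have h1 := (chord_coeff_pos (f := f) huv).ne'
    have h2 := (inv_pos.2 (norm_vec_pos f x)).ne'
    have := (mul_eq_zero.1 ((mul_eq_zero.1 h).resolve_left h1)).resolve_left h2
    linarith
  have hle : f y ≤ f u + slp f u v * (y - u) := by
    have h0 := trip_nonpos_of_mem_Ioo hf hy
    rw [conv] at h0
    by_contra hcon
    push Not at hcon
    have := mul_pos (chord_coeff_pos (f := f) huv)
      (mul_pos (inv_pos.2 (norm_vec_pos f y)) (sub_pos.2 hcon))
    linarith
  refine le_antisymm hle ?_
  have hs := subG_dR hf x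
  have h1 := hs u
  have h2 := hs v
  have h3 := hs y
  have h4 := slp_mul (f := f) huv
  have e1 : dR f x = slp f u v := by
    refine le_antisymm ?_ ?_
    · have : (dR f x - slp f u v) * (v - x) ≤ 0 := by nlinarith
      have := hx.2
      nlinarith
    · have : (slp f u v - dR f x) * (x - u) ≤ 0 := by nlinarith
      have := hx.1
      nlinarith
  rw [e1] at h3
  linarith

lemma pt_of_straight (hf : ConvexOn ℝ univ f) {u v x : ℝ} (hx : x ∈ Ioo u v)
    (h : trip (pt f u) (pt f v) (pt f x) = 0) : ∃ α β : ℝ, 0 < α ∧ 0 < β ∧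
      pt f x = α • pt f u + β • pt f v := by
  have huv := hx.1.trans hx.2
  have hfx := eq_chord_of_touch hf hx h hx
  have h4 := slp_mul (f := f) huv
  have hu := norm_vec_pos f u
  have hv := norm_vec_pos f v
  have hxx := norm_vec_pos f x
  have h1 : 0 < v - u := by linarith
  have h2 : 0 < v - x := by linarith [hx.2]
  have h3 : 0 < x - u := by linarith [hx.1]
  refine ⟨‖vec f x‖⁻¹ * ((v - x) / (v - u)) * ‖vec f u‖,
    ‖vec f x‖⁻¹ * ((x - u) / (v - u)) * ‖vec f v‖, by positivity, by positivity, ?_⟩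
  have e : vec f x = ((v - x) / (v - u)) • vec f u + ((x - u) / (v - u)) • vec f v := by
    apply ext_coord <;> simp <;> field_simp
    · ring
    · rw [hfx]; linear_combination (x - u) * h4
    · ring
  rw [mul_smul _ ‖vec f u‖, mul_smul _ ‖vec f v‖, ← vec_eq_smul_pt, ← vec_eq_smul_pt, mul_smul,
    mul_smul, ← smul_add, ← e, pt]

lemma straight_to_pt (hf : ConvexOn ℝ univ f) {u v x : ℝ} (hx : x ∈ Ioo u v)
    (h : trip (pt f u) (pt f v) (pt f x) = 0) {α β : ℝ} (hα : 0 < α) (hβ : 0 < β)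
    (hn : ‖α • pt f u + β • pt f v‖ = 1) : ∃ y ∈ Ioo u v, α • pt f u + β • pt f v = pt f y := by
  have huv := hx.1.trans hx.2
  have h4 := slp_mul (f := f) huv
  have hu := norm_vec_pos f u
  have hv := norm_vec_pos f v
  set A := α * ‖vec f u‖⁻¹
  set B := β * ‖vec f v‖⁻¹
  have hA : 0 < A := by positivity
  have hB : 0 < B := by positivity
  set z := α • pt f u + β • pt f v with hz
  have e : z = A • vec f u + B • vec f v := by
    rw [hz, pt, pt, smul_smul, smul_smul]
  have e0 : z 0 = A * u + B * v := by rw [e]; simp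
  have e1 : z 1 = A * f u + B * f v := by rw [e]; simp
  have e2 : z 2 = A + B := by rw [e]; simp
  have h2 : 0 < z 2 := by rw [e2]; positivity
  have hy : z 0 / z 2 ∈ Ioo u v := by
    constructor
    · rw [lt_div_iff₀ h2, e0, e2]; nlinarith
    · rw [div_lt_iff₀ h2, e0, e2]; nlinarith
  refine ⟨_, hy, pt_of_frontier_coord hn h2 ?_⟩
  rw [eq_chord_of_touch hf hx h hy, e0, e1, e2]
  have : A + B ≠ 0 := by positivity
  field_simp
  linear_combination B * h4

end chord

namespace FlatChart

variable {K : Set E3} {f : ℝ → ℝ} {a ρ : ℝ}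

lemma convex (h : FlatChart K f a ρ) : ConvexOn ℝ univ f := h.chart.convex

lemma mem (h : FlatChart K f a ρ) (u : ℝ) : pt f u ∈ K := h.chart.pt_mem h.body u

lemma two_pos (h : FlatChart K f a ρ) {u v : ℝ} (hu : |u - a| < ρ) (hv : |v - a| < ρ)
    (huv : u < v) {z : E3} (hz : z ∈ K) (hneg : trip (pt f u) (pt f v) z < 0) : 0 < z 2 := by
  obtain ⟨α, β, γ, h1, h2, h3, hzz⟩ := h.flat u v hu hv huv z hz hneg
  have hγ : 0 < γ := by
    refine lt_of_le_of_ne h3 fun h0 => hneg.ne ?_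
    rw [hzz, ← h0, trip_add, trip_add, trip_smul, trip_smul, trip_smul]; simp
  have hY := h.up u v hu hv huv
  have p1 := pt_two_pos f u
  have p2 := pt_two_pos f v
  have e : z 2 = α * pt f u 2 + β * pt f v 2 + γ * apex (1 / 2) (pt f u) (pt f v) 2 := by
    rw [hzz, apex]; simp
  rw [e]
  positivity

/-- The boundary of `K` beyond a chord is the arc over the chord. -/
lemma exists_pt (h : FlatChart K f a ρ) {u v : ℝ} (hu : |u - a| < ρ) (hv : |v - a| < ρ)
    (huv : u < v) {z : E3} (hz : z ∈ frontier K) (hn : ‖z‖ = 1)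
    (hneg : trip (pt f u) (pt f v) z < 0) : ∃ x ∈ Ioo u v, z = pt f x := by
  have hzK := (h.body.mem_frontier_iff.1 hz).1
  have hz2 := h.two_pos hu hv huv hzK hneg
  have he := (h.chart.eq_pt_of_mem_frontier h.body hn hz2 hz).2
  rw [he] at hneg
  exact ⟨_, mem_Ioo_of_trip_neg h.convex huv hneg, he⟩

lemma inner_lt_one {u v : ℝ} (huv : u ≠ v) : ⟪pt f u, pt f v⟫ < 1 := by
  refine lt_of_le_of_ne ?_ fun he => huv ?_
  · have := real_inner_le_norm (pt f u) (pt f v)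
    simpa using this
  · exact pt_injective f ((inner_eq_one_iff_of_norm_eq_one (norm_pt f u) (norm_pt f v)).1 he)

lemma pt_mem_hull (h : FlatChart K f a ρ) {u v x : ℝ} (hu : |u - a| < ρ) (hv : |v - a| < ρ)
    (hx : x ∈ Ioo u v) : pt f x ∈ hull (pt f u) (pt f v) (apex (1 / 2) (pt f u) (pt f v)) := by
  rcases (trip_nonpos_of_mem_Ioo h.convex hx).lt_or_eq with h0 | h0
  · exact h.flat u v hu hv (hx.1.trans hx.2) _ (h.mem x) h0
  · obtain ⟨α, β, h1, h2, e⟩ := pt_of_straight h.convex hx h0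
    exact ⟨α, β, 0, h1.le, h2.le, le_rfl, by rw [e]; simp⟩

lemma inner_lt_left (h : FlatChart K f a ρ) {u v x : ℝ} (hu : |u - a| < ρ) (hv : |v - a| < ρ)
    (hx : x ∈ Ioo u v) : ⟪pt f u, pt f v⟫ < ⟪pt f u, pt f x⟫ := by
  have huv := hx.1.trans hx.2
  obtain ⟨h1, h2⟩ := inner_ge_of_mem_apex (norm_pt f u) (norm_pt f v) (h.pos u v hu hv).le
    (inner_lt_one huv.ne) (η := 1 / 2) (by norm_num) (norm_pt f u) (norm_pt f x)
    (Or.inl (left_mem_hull _ _ _)) (Or.inl (h.pt_mem_hull hu hv hx))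
  refine lt_of_le_of_ne h1 fun he => ?_
  rcases h2 he.symm with h3 | h3
  · exact hx.2.ne (pt_injective f h3.2)
  · exact huv.ne (pt_injective f h3.1)

lemma inner_lt_right (h : FlatChart K f a ρ) {u v x : ℝ} (hu : |u - a| < ρ) (hv : |v - a| < ρ)
    (hx : x ∈ Ioo u v) : ⟪pt f u, pt f v⟫ < ⟪pt f x, pt f v⟫ := by
  have huv := hx.1.trans hx.2
  obtain ⟨h1, h2⟩ := inner_ge_of_mem_apex (norm_pt f u) (norm_pt f v) (h.pos u v hu hv).le
    (inner_lt_one huv.ne) (η := 1 / 2) (by norm_num) (norm_pt f x) (norm_pt f v)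
    (Or.inl (h.pt_mem_hull hu hv hx)) (Or.inl (mid_mem_hull _ _ _))
  refine lt_of_le_of_ne h1 fun he => ?_
  rcases h2 he.symm with h3 | h3
  · exact hx.1.ne' (pt_injective f h3.1)
  · exact huv.ne' (pt_injective f h3.2)

/-- An isometry that interchanges the ends of a chord, preserves its sides and the boundary of `K`
beyond the chord is a symmetry of the arc. -/
lemma symArc (h : FlatChart K f a ρ) {u v : ℝ} (hu : |u - a| < ρ) (hv : |v - a| < ρ)
    (huv : u < v) {g : E3 ≃ₗᵢ[ℝ] E3} (g1 : g (pt f u) = pt f v) (g2 : g (pt f v) = pt f u)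
    (g3 : g (cr (pt f u) (pt f v)) = cr (pt f u) (pt f v))
    (hg : ∀ z ∈ frontier K, trip (pt f u) (pt f v) z < 0 → g z ∈ frontier K) :
    SymArc (pt f) u v := by
  refine ⟨g, g1, g2, fun x hx => ?_⟩
  rcases (trip_nonpos_of_mem_Ioo h.convex hx).lt_or_eq with h0 | h0
  · have := hg _ (h.chart.pt_mem_frontier h.body x) h0
    refine h.exists_pt hu hv huv this (by simp) ?_
    rwa [trip, ← g3, g.inner_map_map]
  · obtain ⟨α, β, h1, h2, e⟩ := pt_of_straight h.convex hx h0
    have e' : g (pt f x) = β • pt f u + α • pt f v := by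
      rw [e, map_add, map_smul, map_smul, g1, g2, add_comm]
    rw [e']
    exact straight_to_pt h.convex hx h0 h2 h1 (by rw [← e', g.norm_map, norm_pt])

end FlatChart

/-- The placement of `L` for which `K` and `L` overlap in a lens bounded by given arcs. -/
lemma FlatChart.lens {K L : Set E3} {f h : ℝ → ℝ} {a ρ b σ : ℝ} (hK : FlatChart K f a ρ)
    (hL : FlatChart L h b σ) {u v w x : ℝ} (hu : |u - a| < ρ) (hv : |v - a| < ρ) (huv : u < v)
    (hw : |w - b| < σ) (hx : |x - b| < σ) (hwx : w < x)
    (hcurved : ∃ z ∈ K, trip (pt f u) (pt f v) z < 0)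
    {φ : E3 ≃ₗᵢ[ℝ] E3} (hφ : OrientationPreserving φ) (φ1 : φ (pt h w) = pt f v)
    (φ2 : φ (pt h x) = pt f u) : Lens K (φ '' L) (pt f u) (pt f v) where
  hK := hK.body
  hM := hL.body.image φ
  np := norm_pt f u
  nq := norm_pt f v
  pos := (hK.pos u v hu hv).le
  lt := FlatChart.inner_lt_one huv.ne
  pK := hK.mem u
  qK := hK.mem v
  pM := ⟨pt h x, hL.mem x, φ2⟩
  qM := ⟨pt h w, hL.mem w, φ1⟩
  flatK := hK.flat u v hu hv huv
  flatM := by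
    rintro _ ⟨z, hz, rfl⟩ hneg
    rw [← φ1, ← φ2, trip_map_of_op hφ] at hneg
    obtain ⟨α, β, γ, h1, h2, h3, e⟩ := hL.flat w x hw hx hwx z hz hneg
    refine ⟨α, β, γ, h1, h2, h3, ?_⟩
    rw [e, ← φ1, ← φ2, cr_map_of_op hφ]
    simp only [map_add, map_smul, map_sub]
  intK := hK.inner u v hu hv huv
  intM := by
    rw [Body.interior_image]
    refine ⟨_, hL.inner w x hw hx hwx, ?_⟩
    have : apex (1 / 2) (pt f u) (pt f v) = apex (-(1 / 2)) (pt f v) (pt f u) := by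
      rw [apex_swap]
    rw [this, ← φ1, ← φ2, apex, apex, cr_map_of_op hφ]
    simp only [map_add, map_smul, map_sub]
  curved := hcurved

/-- A non-trivial symmetry of a lens either exhibits its two arcs as congruent, or is a symmetry of
both arcs that interchanges the vertices. -/
lemma FlatChart.arcs_of_symmetry {K L : Set E3} {f h : ℝ → ℝ} {a ρ b σ : ℝ}
    (hK : FlatChart K f a ρ) (hL : FlatChart L h b σ) {u v w x : ℝ} (hu : |u - a| < ρ)
    (hv : |v - a| < ρ) (huv : u < v) (hw : |w - b| < σ) (hx : |x - b| < σ) (hwx : w < x)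
    (hcurved : ∃ z ∈ K, trip (pt f u) (pt f v) z < 0)
    {φ : E3 ≃ₗᵢ[ℝ] E3} (hφ : OrientationPreserving φ) (φ1 : φ (pt h w) = pt f v)
    (φ2 : φ (pt h x) = pt f u) {g : E3 ≃ₗᵢ[ℝ] E3} (hg1 : g ≠ LinearIsometryEquiv.refl ℝ E3)
    (hg : g '' (K ∩ φ '' L) = K ∩ φ '' L) :
    CongArc (pt f) u v (pt h) w x ∨ (SymArc (pt f) u v ∧ SymArc (pt h) w x ∧
      g (pt f u) = pt f v ∧ g (pt f v) = pt f u ∧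
      g (cr (pt f u) (pt f v)) = cr (pt f u) (pt f v)) := by
  have hl := hK.lens hL hu hv huv hw hx hwx hcurved hφ φ1 φ2
  set p := pt f u
  set q := pt f v
  have htφ : ∀ z, trip p q (φ z) = - trip (pt h w) (pt h x) z := by
    intro z; rw [trip_swap, ← φ1, ← φ2, trip_map_of_op hφ]
  have hφf : ∀ z, φ z ∈ frontier (φ '' L) ↔ z ∈ frontier L := by
    intro z; rw [Body.frontier_image]; exact φ.injective.mem_set_image
  have hperm := hl.perm hg
  rcases perm_cases hl.cr_ne hg1 hperm with hc | ⟨g1, g2, g3⟩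
  · left
    have htg : ∀ z, trip p q (g z) = - trip p q z := by
      intro z
      have : cr p q = g (- cr p q) := by rw [map_neg, hc, neg_neg]
      rw [trip, this, g.inner_map_map, inner_neg_left]; rfl
    obtain ⟨s, hs, hsneg⟩ : ∃ s ∈ Ioo u v, trip p q (pt f s) < 0 := by
      by_contra hcon
      push Not at hcon
      obtain ⟨z, hz, hneg⟩ := hcurved
      -- a point beyond the chord yields a boundary point beyond the chord
      have hz2 := hK.two_pos hu hv huv hz hneg
      have hm := (hK.chart.mem_iff z hz2).1 hz
      have hneg2 := (trip_pt_vec_neg_iff huv z).1 hneg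
      rw [inner_nrm] at hneg2
      have hlt : trip p q (pt f (z 0 / z 2)) < 0 := by
        rw [trip_pt_vec_neg_iff huv, inner_nrm_pt_eq]
        refine mul_neg_of_pos_of_neg (inv_pos.2 (norm_vec_pos _ _)) ?_
        have e0 : z 0 / z 2 * z 2 = z 0 := div_mul_cancel₀ _ hz2.ne'
        rw [le_div_iff₀ hz2] at hm
        have : (f (z 0 / z 2) - (f u + slp f u v * (z 0 / z 2 - u))) * z 2 < 0 := by
          have e3 : (f (z 0 / z 2) - (f u + slp f u v * (z 0 / z 2 - u))) * z 2 =
            f (z 0 / z 2) * z 2 - f u * z 2 - slp f u v * (z 0 / z 2 * z 2) +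
              slp f u v * u * z 2 := by
            ring
          rw [e3, e0]; linarith
        by_contra hcon'
        push Not at hcon'
        nlinarith [mul_nonneg hcon' hz2.le]
      exact absurd hlt (not_lt.2 (hcon _ (mem_Ioo_of_trip_neg hK.convex huv hlt)))
    have hKneg : ∀ y ∈ Ioo u v, trip p q (pt f y) < 0 := by
      intro y hy
      refine lt_of_le_of_ne (trip_nonpos_of_mem_Ioo hK.convex hy) fun h0 => hsneg.ne ?_
      have := eq_chord_of_touch hK.convex hy h0 hs
      rw [trip_pt huv, inner_nrm_pt_eq, this]; simp
    have hto : ∀ y ∈ Ioo u v, ∃ t ∈ Ioo w x, φ.symm (g (pt f y)) = pt h t := by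
      intro y hy
      have hy0 := hKneg y hy
      have h1 : 0 < trip p q (g (pt f y)) := by rw [htg]; linarith
      have h2 := (hl.mem_frontier_M_iff h1).2 ((Lens.map_mem_frontier hg).2
        ((hl.mem_frontier_K_iff hy0).1 (hK.chart.pt_mem_frontier hK.body y)))
      have e : g (pt f y) = φ (φ.symm (g (pt f y))) := by simp
      rw [e] at h1 h2
      rw [htφ] at h1
      refine hL.exists_pt hw hx hwx ((hφf _).1 h2) (by simp) (by linarith)
    have hLneg : ∀ y ∈ Ioo w x, trip (pt h w) (pt h x) (pt h y) < 0 := by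
      obtain ⟨t, ht, hst⟩ := hto s hs
      have h1 : trip (pt h w) (pt h x) (pt h t) < 0 := by
        rw [← hst]
        have := htφ (φ.symm (g (pt f s)))
        rw [φ.apply_symm_apply, htg] at this
        linarith
      intro y hy
      refine lt_of_le_of_ne (trip_nonpos_of_mem_Ioo hL.convex hy) fun h0 => h1.ne ?_
      have := eq_chord_of_touch hL.convex hy h0 ht
      rw [trip_pt hwx, inner_nrm_pt_eq, this]; simp
    refine ⟨g.trans φ.symm, ?_, ?_, ?_⟩
    · have e1 : φ.symm q = pt h w := by rw [← φ1]; simp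
      have e2 : φ.symm p = pt h x := by rw [← φ2]; simp
      simp only [LinearIsometryEquiv.trans_apply]
      rcases hperm with ⟨k1, k2⟩ | ⟨k1, k2⟩ <;> rw [k1, k2, e1, e2] <;> simp
    · intro y hy
      simpa using hto y hy
    · intro y hy
      have hy0 := hLneg y hy
      have h1 : 0 < trip p q (φ (pt h y)) := by rw [htφ]; linarith
      have h1' : trip p q (g.symm (φ (pt h y))) < 0 := by
        have := htg (g.symm (φ (pt h y)))
        rw [g.apply_symm_apply] at this
        linarith
      have h2 : g.symm (φ (pt h y)) ∈ frontier K := by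
        rw [hl.mem_frontier_K_iff h1', ← Lens.map_mem_frontier hg, g.apply_symm_apply,
          ← hl.mem_frontier_M_iff h1, hφf]
        exact hL.chart.pt_mem_frontier hL.body y
      obtain ⟨s, hs, e⟩ := hK.exists_pt hu hv huv h2 (by simp) h1'
      refine ⟨s, hs, ?_⟩
      rw [LinearIsometryEquiv.trans_apply, ← e]; simp
  · right
    have htg : ∀ z, trip p q (g z) = trip p q z := by
      intro z; conv_lhs => rw [trip, ← g3, g.inner_map_map]
      rfl
    refine ⟨hK.symArc hu hv huv g1 g2 g3 fun z hz hneg => ?_, ?_, g1, g2, g3⟩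
    · have h1 : trip p q (g z) < 0 := by rw [htg]; exact hneg
      rw [hl.mem_frontier_K_iff h1, Lens.map_mem_frontier hg, ← hl.mem_frontier_K_iff hneg]
      exact hz
    · have e1 : φ.symm q = pt h w := by rw [← φ1]; simp
      have e2 : φ.symm p = pt h x := by rw [← φ2]; simp
      refine hL.symArc hw hx hwx (g := (φ.trans g).trans φ.symm) ?_ ?_ ?_ fun z hz hneg => ?_
      · simp only [LinearIsometryEquiv.trans_apply]; rw [φ1, g2, e2]
      · simp only [LinearIsometryEquiv.trans_apply]; rw [φ2, g1, e1]
      · simp only [LinearIsometryEquiv.trans_apply]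
        have : φ (cr (pt h w) (pt h x)) = - cr p q := by
          rw [← cr_map_of_op hφ, φ1, φ2, cr_swap]
        rw [this, map_neg, g3, ← this, φ.symm_apply_apply]
      · simp only [LinearIsometryEquiv.trans_apply]
        have h1 : 0 < trip p q (φ z) := by rw [htφ]; linarith
        have h1' : 0 < trip p q (g (φ z)) := by rw [htg]; exact h1
        rw [← hφf, φ.apply_symm_apply, hl.mem_frontier_M_iff h1', Lens.map_mem_frontier hg,
          ← hl.mem_frontier_M_iff h1, hφf]
        exact hz

end SphericalPlane

namespace SphericalPlane

/-! ### Curves whose arcs are symmetric or congruent -/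

/-- A convex curve on the unit sphere, parametrized over the interval `(a - ρ, a + ρ)`, along which
distances to a fixed point of the curve increase on either side of the point. -/
structure MonoCurve (γ : ℝ → E3) (a ρ : ℝ) : Prop where
  ρpos : 0 < ρ
  cont : Continuous γ
  norm : ∀ u, ‖γ u‖ = 1
  left : ∀ u v w, a - ρ < u → u < v → v < w → w < a + ρ → dist (γ u) (γ v) < dist (γ u) (γ w)
  right : ∀ u v w, a - ρ < u → u < v → v < w → w < a + ρ → dist (γ v) (γ w) < dist (γ u) (γ w)
  inj : Function.Injective γ
  cr_ne : ∀ u v, u < v → cr (γ u) (γ v) ≠ 0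
  convex : ∀ u v w, u < v → v < w → 0 ≤ trip (γ u) (γ v) (γ w)

lemma dist_lt_of_inner_lt {a b c d : E3} (ha : ‖a‖ = 1) (hb : ‖b‖ = 1) (hc : ‖c‖ = 1)
    (hd : ‖d‖ = 1) (h : ⟪c, d⟫ < ⟪a, b⟫) : dist a b < dist c d := by
  rw [dist_eq_norm, dist_eq_norm]
  refine lt_of_pow_lt_pow_left₀ 2 (norm_nonneg _) ?_
  rw [norm_sub_sq_real, norm_sub_sq_real, ha, hb, hc, hd]
  linarith

lemma inner_eq_of_dist_eq {a b c d : E3} (ha : ‖a‖ = 1) (hb : ‖b‖ = 1) (hc : ‖c‖ = 1)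
    (hd : ‖d‖ = 1) (h : dist a b = dist c d) : ⟪a, b⟫ = ⟪c, d⟫ := by
  rw [dist_eq_norm, dist_eq_norm] at h
  have := congrArg (· ^ 2) h
  simp only [norm_sub_sq_real, ha, hb, hc, hd] at this
  linarith

lemma FlatChart.monoCurve {K : Set E3} {f : ℝ → ℝ} {a ρ : ℝ} (h : FlatChart K f a ρ) :
    MonoCurve (pt f) a ρ where
  ρpos := h.ρpos
  cont := continuous_pt (continuous_of_convex h.convex)
  norm := norm_pt f
  left := fun u v w hu huv hvw hw => dist_lt_of_inner_lt (by simp) (by simp) (by simp) (by simp)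
    (h.inner_lt_left (abs_sub_lt_iff.2 ⟨by linarith, by linarith⟩)
      (abs_sub_lt_iff.2 ⟨by linarith, by linarith⟩) ⟨huv, hvw⟩)
  right := fun u v w hu huv hvw hw => dist_lt_of_inner_lt (by simp) (by simp) (by simp) (by simp)
    (h.inner_lt_right (abs_sub_lt_iff.2 ⟨by linarith, by linarith⟩)
      (abs_sub_lt_iff.2 ⟨by linarith, by linarith⟩) ⟨huv, hvw⟩)
  inj := pt_injective f
  cr_ne := fun u v huv h0 => by
    rw [cr_pt huv] at h0
    have := congrArg (fun z : E3 => z 1) h0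
    simp [nrm] at this
    exact (chord_coeff_pos (f := f) huv).ne' (by simpa using this)
  convex := fun u v w huv hvw => by
    have := trip_nonpos_of_mem_Ioo h.convex (u := u) (v := w) (x := v) ⟨huv, hvw⟩
    rw [trip_swap'] at this
    linarith

namespace MonoCurve

variable {γ : ℝ → E3} {a ρ : ℝ}

/-- Two points on the same side of a point `u` at the same distance from it coincide. -/
lemma eq_of_dist_right (h : MonoCurve γ a ρ) {u v w : ℝ} (hu : a - ρ < u) (huv : u < v)
    (huw : u < w) (hv : v < a + ρ) (hw : w < a + ρ) (he : dist (γ u) (γ v) = dist (γ u) (γ w)) :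
    v = w := by
  rcases lt_trichotomy v w with h1 | h1 | h1
  · exact absurd he (h.left u v w hu huv h1 hw).ne
  · exact h1
  · exact absurd he (h.left u w v hu huw h1 hv).ne'

lemma eq_of_dist_left (h : MonoCurve γ a ρ) {u v w : ℝ} (hu : a - ρ < u) (hv : a - ρ < v)
    (huw : u < w) (hvw : v < w) (hw : w < a + ρ) (he : dist (γ u) (γ w) = dist (γ v) (γ w)) :
    u = v := by
  rcases lt_trichotomy u v with h1 | h1 | h1
  · exact absurd he (h.right u v w hu h1 hvw hw).ne'
  · exact h1
  · exact absurd he (h.right v u w hv h1 huw hw).ne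

/-- The order of two points can be read off from their distances to a point on their left. -/
lemma lt_of_dist_lt (h : MonoCurve γ a ρ) {u v w : ℝ} (hu : a - ρ < u) (huw : u < w)
    (hv : v < a + ρ) (he : dist (γ u) (γ v) < dist (γ u) (γ w)) : v < w := by
  by_contra hcon
  rcases (not_lt.1 hcon).eq_or_lt with h1 | h1
  · rw [h1] at he; exact lt_irrefl _ he
  · exact lt_asymm he (h.left u w v hu huw h1 hv)

lemma lt_of_dist_lt' (h : MonoCurve γ a ρ) {u v w : ℝ} (hu : a - ρ < u) (hvw : v < w)
    (hw : w < a + ρ) (he : dist (γ u) (γ w) < dist (γ v) (γ w)) : v < u := by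
  by_contra hcon
  rcases (not_lt.1 hcon).eq_or_lt with h1 | h1
  · rw [h1] at he; exact lt_irrefl _ he
  · exact lt_asymm he (h.right u v w hu h1 hvw hw)

lemma dist_pos (h : MonoCurve γ a ρ) {u v : ℝ} (huv : u < v) : 0 < dist (γ u) (γ v) :=
  _root_.dist_pos.2 fun he => huv.ne (h.inj he)

/-- Intermediate values: a point at a prescribed smaller distance. -/
lemma exists_dist_eq (h : MonoCurve γ a ρ) {u v s : ℝ} (huv : u < v) (hs : 0 < s)
    (hsv : s < dist (γ u) (γ v)) : ∃ w ∈ Ioo u v, dist (γ u) (γ w) = s := by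
  have hc := h.cont
  have hcont : ContinuousOn (fun w => dist (γ u) (γ w)) (Icc u v) := by fun_prop
  have := intermediate_value_Ioo huv.le hcont
  simp only [dist_self] at this
  exact this ⟨hs, hsv⟩

lemma exists_mid (h : MonoCurve γ a ρ) {u v : ℝ} (huv : u < v) :
    ∃ m ∈ Ioo u v, dist (γ u) (γ m) = dist (γ m) (γ v) := by
  have hc := h.cont
  have hcont : ContinuousOn (fun w => dist (γ u) (γ w) - dist (γ w) (γ v)) (Icc u v) := by fun_prop
  have hd := h.dist_pos huv
  have := intermediate_value_Ioo huv.le hcont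
  simp only [dist_self] at this
  obtain ⟨m, hm, he⟩ := this (show (0 : ℝ) ∈ Ioo _ _ from ⟨by linarith, by linarith⟩)
  exact ⟨m, hm, sub_eq_zero.1 he⟩

lemma mid_unique (h : MonoCurve γ a ρ) {u v m m' : ℝ} (hu : a - ρ < u) (hv : v < a + ρ)
    (hm : m ∈ Ioo u v) (hm' : m' ∈ Ioo u v) (he : dist (γ u) (γ m) = dist (γ m) (γ v))
    (he' : dist (γ u) (γ m') = dist (γ m') (γ v)) : m = m' := by
  rcases lt_trichotomy m m' with h1 | h1 | h1
  · have k1 := h.left u m m' hu hm.1 h1 (hm'.2.trans hv)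
    have k2 := h.right m m' v (hu.trans hm.1) h1 hm'.2 hv
    linarith
  · exact h1
  · have k1 := h.left u m' m hu hm'.1 h1 (hm.2.trans hv)
    have k2 := h.right m' m v (hu.trans hm'.1) h1 hm.2 hv
    linarith

end MonoCurve

/-- Over the interval `(a - ρ, a + ρ)`, inscribed polygons with equal sides have equal angles and
equal chords of consecutive arcs have equal chords of their halves. -/
structure Rigid (γ : ℝ → E3) (a ρ : ℝ) : Prop where
  iso : ∀ p₀ p₁ p₂ p₃, a - ρ < p₀ → p₀ < p₁ → p₁ < p₂ → p₂ < p₃ → p₃ < a + ρ →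
    dist (γ p₀) (γ p₁) = dist (γ p₁) (γ p₂) → dist (γ p₁) (γ p₂) = dist (γ p₂) (γ p₃) →
    dist (γ p₀) (γ p₂) = dist (γ p₁) (γ p₃)
  half : ∀ u m v m' w, a - ρ < u → m ∈ Ioo u v → m' ∈ Ioo v w → w < a + ρ →
    dist (γ u) (γ v) = dist (γ v) (γ w) → dist (γ u) (γ m) = dist (γ m) (γ v) →
    dist (γ v) (γ m') = dist (γ m') (γ w) → dist (γ u) (γ m) = dist (γ v) (γ m')

/-- A unit vector is determined by its inner products with two others and by the side of their
plane on which it lies. -/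
lemma eq_of_inner_of_trip {b c z w : E3} (hbc : cr b c ≠ 0) (hz : ‖z‖ = 1) (hw : ‖w‖ = 1)
    (hb : ⟪b, z⟫ = ⟪b, w⟫) (hc : ⟪c, z⟫ = ⟪c, w⟫) (hz0 : 0 ≤ trip b c z) (hw0 : 0 ≤ trip b c w) :
    z = w := by
  have hpos : trip b c (cr b c) ≠ 0 := by
    rw [trip_cr]; exact pow_ne_zero 2 (norm_ne_zero_iff.2 hbc)
  refine eq_of_inner_eq hpos hb hc ?_
  have gram : ∀ y : E3, trip b c y ^ 2 = ‖y‖ ^ 2 * (‖b‖ ^ 2 * ‖c‖ ^ 2 - ⟪b, c⟫ ^ 2)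
      - ‖b‖ ^ 2 * ⟪c, y⟫ ^ 2 - ‖c‖ ^ 2 * ⟪b, y⟫ ^ 2 + 2 * ⟪b, c⟫ * ⟪b, y⟫ * ⟪c, y⟫ := by
    intro y
    simp only [← real_inner_self_eq_norm_sq, inner_coord, trip_coord]; ring
  have : trip b c z ^ 2 = trip b c w ^ 2 := by rw [gram, gram, hz, hw, hb, hc]
  exact (pow_left_inj₀ hz0 hw0 two_ne_zero).1 this

/-- Four consecutive vertices of an inscribed convex polygon with equal sides and equal angles lie
on a circle. -/
lemma coplanar_of_isosceles {p₀ p₁ p₂ p₃ : E3} (h0 : ‖p₀‖ = 1) (h1 : ‖p₁‖ = 1) (h2 : ‖p₂‖ = 1)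
    (h3 : ‖p₃‖ = 1) (hne : cr p₁ p₂ ≠ 0) (e1 : dist p₀ p₁ = dist p₂ p₃)
    (e2 : dist p₀ p₂ = dist p₁ p₃) (t1 : 0 ≤ trip p₀ p₁ p₂) (t2 : 0 ≤ trip p₁ p₂ p₃) :
    ∃ t : ℝ, p₃ - p₀ = t • (p₂ - p₁) := by
  have hn : p₁ - p₂ ≠ 0 := by
    intro h
    rw [sub_eq_zero.1 h] at hne
    exact hne (by apply ext_coord <;> simp <;> ring)
  set s := refl (p₁ - p₂) with hs
  have s1 : s p₁ = p₂ := refl_sub (by rw [h1, h2])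
  have s2 : s p₂ = p₁ := refl_sub' (by rw [h1, h2])
  have key : s p₀ = p₃ := by
    refine eq_of_inner_of_trip hne (by rw [s.norm_map, h0]) h3 ?_ ?_ ?_ t2
    · rw [← s2, s.inner_map_map]
      refine inner_eq_of_dist_eq h2 h0 ?_ h3 ?_
      · rw [s.norm_map, h2]
      · rw [dist_comm, e2, s2]
    · rw [← s1, s.inner_map_map]
      refine inner_eq_of_dist_eq h1 h0 ?_ h3 ?_
      · rw [s.norm_map, h1]
      · rw [dist_comm, e1, s1]
    · have : trip (s p₂) (s p₁) (s p₀) = - trip p₂ p₁ p₀ := by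
        rw [trip_map, hs, det_refl hn]; ring
      rw [s1, s2] at this
      rw [this, trip_swap, neg_neg, ← trip_rot]
      exact t1
  rw [hs, refl_apply] at key
  refine ⟨2 * ⟪p₁ - p₂, p₀⟫ / ‖p₁ - p₂‖ ^ 2, ?_⟩
  rw [← key]
  module

/-- The points `u`, `m`, `v` of the curve, with `m` the midpoint of the arc over `[u, v]`, lie in
the plane with normal `N` and offset `c`. -/
structure Good (γ : ℝ → E3) (N : E3) (c u m v : ℝ) : Prop where
  mem : m ∈ Ioo u v
  mid : dist (γ u) (γ m) = dist (γ m) (γ v)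
  hu : ⟪N, γ u⟫ = c
  hm : ⟪N, γ m⟫ = c
  hv : ⟪N, γ v⟫ = c

/-- If the ends and the midpoint of an arc of a rigid curve are in a plane, so are the midpoints of
its halves, since the five points form two overlapping isosceles trapezoids. -/
lemma MonoCurve.good_halves {γ : ℝ → E3} {a ρ : ℝ} (h : MonoCurve γ a ρ) (hr : Rigid γ a ρ)
    {N : E3} {c u m v : ℝ} (hu : a - ρ < u) (hv : v < a + ρ)
    (hg : Good γ N c u m v) :
    (∃ m₁, Good γ N c u m₁ m) ∧ ∃ m₂, Good γ N c m m₂ v := by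
  obtain ⟨m₁, hm₁, e₁⟩ := h.exists_mid hg.mem.1
  obtain ⟨m₂, hm₂, e₂⟩ := h.exists_mid hg.mem.2
  have e := hr.half u m₁ m m₂ v hu hm₁ hm₂ hv hg.mid e₁ e₂
  have i₁ := hr.iso u m₁ m m₂ hu hm₁.1 hm₁.2 hm₂.1 (hm₂.2.trans hv) e₁ (by rw [← e₁, e])
  have i₂ := hr.iso m₁ m m₂ v (hu.trans hm₁.1) hm₁.2 hm₂.1 hm₂.2 hv (by rw [← e₁, e]) e₂
  obtain ⟨s, hs⟩ := coplanar_of_isosceles (h.norm u) (h.norm m₁) (h.norm m) (h.norm m₂)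
    (h.cr_ne _ _ hm₁.2) e i₁ (h.convex _ _ _ hm₁.1 hm₁.2) (h.convex _ _ _ hm₁.2 hm₂.1)
  obtain ⟨t, ht⟩ := coplanar_of_isosceles (h.norm m₁) (h.norm m) (h.norm m₂) (h.norm v)
    (h.cr_ne _ _ hm₂.1) (by rw [← e₁, e, e₂]) i₂ (h.convex _ _ _ hm₁.2 hm₂.1)
    (h.convex _ _ _ hm₂.1 hm₂.2)
  -- the normal `N` takes equal values at `m₁`, `m₂`; both equations involve the same two unknowns
  have k1 := congrArg (fun y => ⟪N, y⟫) hs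
  have k2 := congrArg (fun y => ⟪N, y⟫) ht
  simp only [inner_sub_right, inner_smul_right] at k1 k2
  rw [hg.hu, hg.hm] at k1
  rw [hg.hm, hg.hv] at k2
  have l1 : 1 < |s| := by
    have := congrArg (‖·‖) hs
    rw [norm_smul, Real.norm_eq_abs, ← dist_eq_norm, ← dist_eq_norm, dist_comm, dist_comm (γ m)]
      at this
    have h1 := h.right u m m₂ hu hg.mem.1 hm₂.1 (hm₂.2.trans hv)
    have h2 := h.dist_pos hm₁.2
    rw [this, ← e, e₁] at h1
    exact lt_of_mul_lt_mul_right (by linarith) h2.le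
  have l2 : 1 < |t| := by
    have := congrArg (‖·‖) ht
    rw [norm_smul, Real.norm_eq_abs, ← dist_eq_norm, ← dist_eq_norm, dist_comm, dist_comm (γ m₂)]
      at this
    have h1 := h.right m₁ m v (hu.trans hm₁.1) hm₁.2 hg.mem.2 hv
    have h3 := h.left m m₂ v (hu.trans hg.mem.1) hm₂.1 hm₂.2 hv
    have h2 := h.dist_pos hm₂.1
    rw [this] at h1
    exact lt_of_mul_lt_mul_right (by linarith) h2.le
  have l3 : s * t ≠ 1 := fun he => by
    have := congrArg abs he
    rw [abs_mul, abs_one] at this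
    nlinarith
  have x2 : ⟪N, γ m₂⟫ = c := by
    have : (1 - s * t) * (⟪N, γ m₂⟫ - c) = 0 := by linear_combination k1 + s * k2
    exact sub_eq_zero.1 ((mul_eq_zero.1 this).resolve_left fun h0 => l3 (by linarith))
  have x1 : ⟪N, γ m₁⟫ = c := by rw [x2] at k2; linarith
  exact ⟨⟨m₁, hm₁, e₁, hg.hu, x1, hg.hm⟩, m₂, hm₂, e₂, hg.hm, x2, hg.hv⟩

/-- Repeated halving shows that the whole arc lies in the plane: the halves that contain a given
point shrink to it. -/
lemma MonoCurve.planar_of_good {γ : ℝ → E3} {a ρ : ℝ} (h : MonoCurve γ a ρ) (hr : Rigid γ a ρ)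
    {N : E3} {c u m v : ℝ} (hu : a - ρ < u) (hv : v < a + ρ) (hg : Good γ N c u m v) {x : ℝ}
    (hx : x ∈ Icc u v) : ⟪N, γ x⟫ = c := by
  let S := {p : ℝ × ℝ × ℝ // Good γ N c p.1 p.2.1 p.2.2 ∧ u ≤ p.1 ∧ p.2.2 ≤ v ∧ x ∈ Icc p.1 p.2.2}
  have step : ∀ p : S, ∃ q : S, p.1.1 ≤ q.1.1 ∧ q.1.2.2 ≤ p.1.2.2 ∧
      (q.1.1 = p.1.2.1 ∨ q.1.2.2 = p.1.2.1) := by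
    rintro ⟨⟨u', m', v'⟩, hg', h1, h2, h3⟩
    obtain ⟨⟨m₁, g1⟩, m₂, g2⟩ := h.good_halves hr (hu.trans_le h1) (h2.trans_lt hv) hg'
    rcases le_total x m' with hxm | hxm
    · exact ⟨⟨(u', m₁, m'), g1, h1, hg'.mem.2.le.trans h2, h3.1, hxm⟩, le_rfl, hg'.mem.2.le,
        Or.inr rfl⟩
    · exact ⟨⟨(m', m₂, v'), g2, h1.trans hg'.mem.1.le, h2, hxm, h3.2⟩, hg'.mem.1.le, le_rfl,
        Or.inl rfl⟩
  choose next hn1 hn2 hn3 using step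
  let p : ℕ → S := fun n => next^[n] ⟨(u, m, v), hg, le_rfl, le_rfl, hx⟩
  have hp : ∀ n, p (n + 1) = next (p n) := fun n => Function.iterate_succ_apply' _ _ _
  have mono : Monotone fun n => (p n).1.1 := monotone_nat_of_le_succ fun n => by
    rw [hp]; exact hn1 _
  have anti : Antitone fun n => (p n).1.2.2 := antitone_nat_of_succ_le fun n => by
    rw [hp]; exact hn2 _
  have t1 := tendsto_atTop_ciSup mono ⟨x, by rintro _ ⟨n, rfl⟩; exact (p n).2.2.2.2.1⟩
  have t2 := tendsto_atTop_ciInf anti ⟨x, by rintro _ ⟨n, rfl⟩; exact (p n).2.2.2.2.2⟩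
  set U := ⨆ n, (p n).1.1
  set V := ⨅ n, (p n).1.2.2
  have hU : U ≤ x := le_of_tendsto' t1 fun n => (p n).2.2.2.2.1
  have hV : x ≤ V := ge_of_tendsto' t2 fun n => (p n).2.2.2.2.2
  have s1 := (h.cont.tendsto U).comp t1
  have s2 := (h.cont.tendsto V).comp t2
  have d1 := s1.dist (s1.comp (tendsto_add_atTop_nat 1))
  have d2 := s2.dist (s2.comp (tendsto_add_atTop_nat 1))
  have d3 := s1.dist s2
  have d4 := (d1.add d2).const_mul 2
  simp only [dist_self, add_zero, mul_zero] at d4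
  have hle : dist (γ U) (γ V) ≤ 0 := by
    refine le_of_tendsto_of_tendsto' d3 d4 fun n => ?_
    simp only [Function.comp_apply]
    have hmid := (p n).2.1.mid
    have htri := dist_triangle (γ (p n).1.1) (γ (p n).1.2.1) (γ (p n).1.2.2)
    have n1 : 0 ≤ dist (γ (p n).1.1) (γ (p (n + 1)).1.1) := dist_nonneg
    have n2 : 0 ≤ dist (γ (p n).1.2.2) (γ (p (n + 1)).1.2.2) := dist_nonneg
    rw [hp] at n1 n2 ⊢
    rcases hn3 (p n) with h3 | h3
    · rw [h3] at n1 ⊢; linarith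
    · rw [h3] at n2 ⊢; rw [dist_comm (γ (p n).1.2.2)] at n2 ⊢; linarith
  have hUV : U = V := h.inj (dist_le_zero.1 hle)
  have hxU : U = x := le_antisymm hU (hV.trans hUV.ge)
  have hc : Continuous fun y => ⟪N, γ y⟫ := by have := h.cont; fun_prop
  have := ((hc.tendsto U).comp t1)
  rw [← hxU]
  exact tendsto_nhds_unique this (tendsto_const_nhds.congr fun n => (p n).2.1.hu.symm)

/-- Three distinct points of the sphere span a plane. -/
lemma cr_sub_ne_zero {x y z : E3} (hx : ‖x‖ = 1) (hy : ‖y‖ = 1) (hz : ‖z‖ = 1) (hxy : x ≠ y)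
    (hxz : x ≠ z) (hyz : y ≠ z) : cr (y - x) (z - x) ≠ 0 := by
  intro h0
  have hne : ‖z - x‖ ^ 2 ≠ 0 := pow_ne_zero 2 (norm_ne_zero_iff.2 (sub_ne_zero.2 hxz.symm))
  have key : ‖z - x‖ ^ 2 • (y - x) - ⟪y - x, z - x⟫ • (z - x) =
      cr (z - x) (cr (y - x) (z - x)) := by
    rw [← real_inner_self_eq_norm_sq, inner_coord, inner_coord]
    apply ext_coord <;> simp <;> ring
  have key2 : cr (z - x) (0 : E3) = 0 := by apply ext_coord <;> simp
  rw [h0, key2, sub_eq_zero] at key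
  set t := ⟪y - x, z - x⟫ / ‖z - x‖ ^ 2 with ht
  have e : y = x + t • (z - x) := by
    have : y - x = t • (z - x) := by
      rw [ht, div_eq_inv_mul, mul_smul, ← key, smul_smul, inv_mul_cancel₀ hne, one_smul]
    rw [← this]; abel
  have n1 : ‖y‖ ^ 2 = ‖x‖ ^ 2 + t * (‖z‖ ^ 2 - ‖x‖ ^ 2 - ‖z - x‖ ^ 2) + t ^ 2 * ‖z - x‖ ^ 2 := by
    rw [e]
    simp only [← real_inner_self_eq_norm_sq, inner_coord]; simp; ring
  rw [hx, hy, hz] at n1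
  have n2 : ‖z - x‖ ^ 2 * (t * (t - 1)) = 0 := by linear_combination -n1
  rcases mul_eq_zero.1 ((mul_eq_zero.1 n2).resolve_left hne) with h | h
  · exact hxy (by rw [e, h]; simp)
  · exact hyz (by rw [e, sub_eq_zero.1 h]; simp)

/-- A rigid curve is locally planar, hence an arc of a circle. -/
lemma MonoCurve.exists_plane {γ : ℝ → E3} {a ρ : ℝ} (h : MonoCurve γ a ρ) (hr : Rigid γ a ρ) :
    ∃ N : E3, ∃ c r : ℝ, N ≠ 0 ∧ 0 < r ∧ ∀ x, |x - a| < r → ⟪N, γ x⟫ = c := by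
  have hρ := h.ρpos
  obtain ⟨m, hm, e⟩ := h.exists_mid (show a - ρ / 2 < a + ρ / 2 by linarith)
  set u := a - ρ / 2
  set v := a + ρ / 2
  set N := cr (γ m - γ u) (γ v - γ u) with hN
  have z1 : ⟪N, γ m - γ u⟫ = 0 := inner_cr_left _ _
  have z2 : ⟪N, γ v - γ u⟫ = 0 := inner_cr_right _ _
  rw [inner_sub_right, sub_eq_zero] at z1 z2
  refine ⟨N, ⟪N, γ u⟫, ρ / 2, ?_, by linarith, fun x hx => ?_⟩
  · exact cr_sub_ne_zero (h.norm _) (h.norm _) (h.norm _) (fun he => hm.1.ne (h.inj he))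
      (fun he => (hm.1.trans hm.2).ne (h.inj he)) (fun he => hm.2.ne (h.inj he))
  · rw [abs_sub_lt_iff] at hx
    exact h.planar_of_good hr (u := u) (m := m) (v := v) (by simp only [u]; linarith)
      (by simp only [v]; linarith) ⟨hm, e, rfl, z1, z2⟩
      ⟨by simp only [u]; linarith, by simp only [v]; linarith⟩

end SphericalPlane

namespace SphericalPlane

namespace MonoCurve

variable {γ : ℝ → E3} {a ρ : ℝ}

lemma shrink (h : MonoCurve γ a ρ) {ρ' : ℝ} (h0 : 0 < ρ') (h1 : ρ' ≤ ρ) : MonoCurve γ a ρ' where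
  ρpos := h0
  cont := h.cont
  norm := h.norm
  left := fun u v w hu huv hvw hw => h.left u v w (by linarith) huv hvw (by linarith)
  right := fun u v w hu huv hvw hw => h.right u v w (by linarith) huv hvw (by linarith)
  inj := h.inj
  cr_ne := h.cr_ne
  convex := h.convex

lemma exists_small (h : MonoCurve γ a ρ) {ℓ : ℝ} (hℓ : 0 < ℓ) : ∃ ρ', 0 < ρ' ∧ ρ' ≤ ρ ∧
    ∀ u v, a - ρ' < u → u < a + ρ' → a - ρ' < v → v < a + ρ' → dist (γ u) (γ v) < ℓ := by
  obtain ⟨δ, hδ, h1⟩ := Metric.continuousAt_iff.1 (h.cont.continuousAt (x := a)) (ℓ / 2)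
    (half_pos hℓ)
  refine ⟨min δ ρ, lt_min hδ h.ρpos, min_le_right _ _, fun u v hu hu' hv hv' => ?_⟩
  have hm := min_le_left δ ρ
  have k1 := h1 (x := u) (by rw [Real.dist_eq, abs_sub_lt_iff]; constructor <;> linarith)
  have k2 := h1 (x := v) (by rw [Real.dist_eq, abs_sub_lt_iff]; constructor <;> linarith)
  have := dist_triangle_right (γ u) (γ v) (γ a)
  linarith

/-- A curve all of whose arcs are symmetric is rigid. -/
lemma rigid_of_symArc (h : MonoCurve γ a ρ)
    (hs : ∀ u v, a - ρ < u → u < v → v < a + ρ → SymArc γ u v) : Rigid γ a ρ where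
  iso := by
    intro p₀ p₁ p₂ p₃ h0 h01 h12 h23 h3 e1 e2
    obtain ⟨g, g0, g3, hg⟩ := hs p₀ p₃ h0 (h01.trans (h12.trans h23)) h3
    obtain ⟨y, hy, gy⟩ := hg p₁ ⟨h01, h12.trans h23⟩
    obtain ⟨y', hy', gy'⟩ := hg p₂ ⟨h01.trans h12, h23⟩
    have d1 := g.dist_map (γ p₀) (γ p₁)
    rw [g0, gy, dist_comm, e1, e2] at d1
    have := h.eq_of_dist_left (h0.trans hy.1) ((h0.trans h01).trans h12) hy.2 h23 h3 d1
    subst this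
    have d2 := g.dist_map (γ y) (γ p₃)
    rw [g3, gy', ← e2, ← e1, dist_comm] at d2
    have := h.eq_of_dist_right h0 hy'.1 h01 (hy'.2.trans h3) (h12.trans (h23.trans h3)) d2
    subst this
    have d3 := g.dist_map (γ p₀) (γ y)
    rw [g0, gy'] at d3
    rw [← d3, dist_comm]
  half := by
    intro u m v m' w hu hm hm' hw e em em'
    have hu_v := hm.1.trans hm.2
    have hv_w := hm'.1.trans hm'.2
    obtain ⟨g, g0, g3, hg⟩ := hs u w hu (hu_v.trans hv_w) hw
    obtain ⟨y, hy, gy⟩ := hg v ⟨hu_v, hv_w⟩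
    obtain ⟨y', hy', gy'⟩ := hg m ⟨hm.1, hm.2.trans hv_w⟩
    have d1 := g.dist_map (γ u) (γ v)
    rw [g0, gy, dist_comm, e] at d1
    have := h.eq_of_dist_left (hu.trans hy.1) (hu.trans hu_v) hy.2 hv_w hw d1
    subst this
    have d2 := g.dist_map (γ u) (γ m)
    have d3 := g.dist_map (γ m) (γ y)
    rw [g0, gy'] at d2
    rw [gy', gy] at d3
    have d4 := h.left u m y hu hm.1 hm.2 (hv_w.trans hw)
    have hlt : y < y' := h.lt_of_dist_lt' (hu.trans hy'.1) hv_w hw (by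
      rw [dist_comm, d2, ← e]; exact d4)
    have := h.mid_unique (hu.trans hu_v) hw hm' ⟨hlt, hy'.2⟩ em' (by
      rw [dist_comm, d3, ← em, ← d2, dist_comm])
    subst this
    rw [← d2, dist_comm, em']

/-- A curve is rigid if isometries that preserve its direction carry any of its points to any
other one. -/
lemma rigid_of_direct (h : MonoCurve γ a ρ) {ρ' : ℝ} (hρ : ρ' ≤ ρ)
    (hs : ∀ w w', a - ρ' < w → w < a + ρ' → a - ρ' < w' → w' < a + ρ' → ∃ g : E3 ≃ₗᵢ[ℝ] E3,
      g (γ w) = γ w' ∧ ∀ x, w < x → x < a + ρ' → ∃ y, w' < y ∧ y < a + ρ ∧ g (γ x) = γ y) :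
    Rigid γ a ρ' where
  iso := by
    intro p₀ p₁ p₂ p₃ h0 h01 h12 h23 h3 e1 e2
    obtain ⟨g, g0, hg⟩ := hs p₀ p₁ h0 (by linarith) (by linarith) (by linarith)
    obtain ⟨y, hy, hyρ, gy⟩ := hg p₁ h01 (by linarith)
    obtain ⟨y', hy', hyρ', gy'⟩ := hg p₂ (h01.trans h12) (by linarith)
    have d1 := g.dist_map (γ p₀) (γ p₁)
    rw [g0, gy, e1] at d1
    have := h.eq_of_dist_right (by linarith) hy h12 hyρ (by linarith) d1
    subst this
    have d2 := g.dist_map (γ p₁) (γ y)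
    rw [gy, gy', e2] at d2
    have d3 := g.dist_map (γ p₀) (γ y)
    rw [g0, gy'] at d3
    have hlt : y < y' := h.lt_of_dist_lt (by linarith) hy' (by linarith) (by
      rw [d3, ← e1]
      exact h.left p₀ p₁ y (by linarith) h01 h12 (by linarith))
    have := h.eq_of_dist_right (by linarith) hlt h23 hyρ' (by linarith) d2
    subst this
    exact d3.symm
  half := by
    intro u m v m' w hu hm hm' hw e em em'
    have hu_v := hm.1.trans hm.2
    have hv_w := hm'.1.trans hm'.2
    obtain ⟨g, g0, hg⟩ := hs u v hu (by linarith) (by linarith) (by linarith)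
    obtain ⟨y, hy, hyρ, gy⟩ := hg v hu_v (by linarith)
    obtain ⟨y', hy', hyρ', gy'⟩ := hg m hm.1 (by linarith [hm.2])
    have d1 := g.dist_map (γ u) (γ v)
    rw [g0, gy, e] at d1
    have := h.eq_of_dist_right (by linarith) hy hv_w hyρ (by linarith) d1
    subst this
    have d2 := g.dist_map (γ u) (γ m)
    have d3 := g.dist_map (γ m) (γ v)
    rw [g0, gy'] at d2
    rw [gy', gy] at d3
    have hlt : y' < y := h.lt_of_dist_lt (by linarith) hv_w hyρ' (by
      rw [d2, ← e]
      exact h.left u m v (by linarith) hm.1 hm.2 (by linarith))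
    have := h.mid_unique (by linarith) hyρ hm' ⟨hy', hlt⟩ em' (by rw [d2, d3, em])
    subst this
    exact d2.symm

/-- If all pairs of points of an arc at equal distances from its two ends are also at equal
distances from the opposite ends, the arc is symmetric. -/
lemma symArc_of_dist (h : MonoCurve γ a ρ) {u v : ℝ} (huv : u < v) (hu : a - ρ < u)
    (hv : v < a + ρ) (hd : ∀ x ∈ Ioo u v, ∀ y ∈ Ioo u v, dist (γ u) (γ x) = dist (γ y) (γ v) →
      dist (γ x) (γ v) = dist (γ u) (γ y)) : SymArc γ u v := by
  have hn : γ u - γ v ≠ 0 := sub_ne_zero.2 fun he => huv.ne (h.inj he)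
  set s := refl (γ u - γ v) with hs
  have s1 : s (γ u) = γ v := refl_sub (by rw [h.norm, h.norm])
  have s2 : s (γ v) = γ u := refl_sub' (by rw [h.norm, h.norm])
  refine ⟨s, s1, s2, fun x hx => ?_⟩
  have hc := h.cont
  have hcont : ContinuousOn (fun w => dist (γ w) (γ v)) (Icc u v) := by fun_prop
  obtain ⟨y, hy, hxy⟩ := intermediate_value_Ioo' huv.le hcont
    (show dist (γ u) (γ x) ∈ _ from ⟨by rw [dist_self]; exact h.dist_pos hx.1,
      h.left u x v hu hx.1 hx.2 hv⟩)
  refine ⟨y, hy, ?_⟩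
  have e := hd x hx y hy hxy.symm
  have hc' : cr (γ v) (γ u) ≠ 0 := by
    rw [cr_swap, neg_ne_zero]; exact h.cr_ne u v huv
  have ht : ∀ w ∈ Ioo u v, 0 ≤ trip (γ v) (γ u) (γ w) := fun w hw => by
    rw [trip_rot]; exact h.convex _ _ _ hw.1 hw.2
  refine eq_of_inner_of_trip hc' (by rw [s.norm_map, h.norm]) (h.norm _) ?_ ?_ ?_ (ht y hy)
  · rw [← s1, s.inner_map_map, s1]
    exact inner_eq_of_dist_eq (h.norm _) (h.norm _) (h.norm _) (h.norm _) (by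
      rw [← hxy, dist_comm])
  · rw [← s2, s.inner_map_map, s2]
    exact inner_eq_of_dist_eq (h.norm _) (h.norm _) (h.norm _) (h.norm _) (by rw [← e, dist_comm])
  · have : trip (s (γ u)) (s (γ v)) (s (γ x)) = - trip (γ u) (γ v) (γ x) := by
      rw [trip_map, hs, det_refl hn]; ring
    rw [s1, s2] at this
    rw [this, trip_swap, neg_neg]
    exact ht x hx

/-- Suppose that, for each small `ℓ`, the arcs of chord `ℓ` are all symmetric or all congruent.
Then the curve is rigid. If arcs of some chord `ℓ` are asymmetric, a congruence between two of them
either preserves or reverses the orientation of the curve, and by continuity the same alternative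
holds for all of them. -/
lemma exists_rigid (h : MonoCurve γ a ρ) {ℓ₁ : ℝ} (hℓ₁ : 0 < ℓ₁)
    (hd : ∀ ℓ, 0 < ℓ → ℓ < ℓ₁ →
      (∀ u v, a - ρ < u → u < v → v < a + ρ → dist (γ u) (γ v) = ℓ → SymArc γ u v) ∨
      (∀ u v u' v', a - ρ < u → u < v → v < a + ρ → dist (γ u) (γ v) = ℓ → a - ρ < u' → u' < v' →
        v' < a + ρ → dist (γ u') (γ v') = ℓ → CongArc γ u v γ u' v')) :
    ∃ ρ', 0 < ρ' ∧ ρ' ≤ ρ ∧ Rigid γ a ρ' := by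
  have hρ := h.ρpos
  by_cases hall : ∃ ℓ₂, 0 < ℓ₂ ∧ ∀ ℓ, 0 < ℓ → ℓ < ℓ₂ →
      ∀ u v, a - ρ < u → u < v → v < a + ρ → dist (γ u) (γ v) = ℓ → SymArc γ u v
  · obtain ⟨ℓ₂, hℓ₂, hs⟩ := hall
    obtain ⟨ρ', h0, h1, h2⟩ := h.exists_small hℓ₂
    refine ⟨ρ', h0, h1, (h.shrink h0 h1).rigid_of_symArc fun u v hu huv hv => ?_⟩
    exact hs _ (h.dist_pos huv) (h2 u v hu (by linarith) (by linarith) hv) u v (by linarith) huv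
      (by linarith) rfl
  push Not at hall
  have hℓ₂ := h.dist_pos (show a + ρ / 4 < a + ρ / 2 by linarith)
  obtain ⟨ℓ, hℓ, hℓm, u, v, hu, huv, hv, huvℓ, hns⟩ :=
    hall (min ℓ₁ (dist (γ (a + ρ / 4)) (γ (a + ρ / 2)))) (lt_min hℓ₁ hℓ₂)
  rw [lt_min_iff] at hℓm
  have hcong := (hd ℓ hℓ hℓm.1).resolve_left fun hs => hns (hs u v hu huv hv huvℓ)
  have hJ : ∀ w ∈ Icc (a - ρ / 4) (a + ρ / 4),
      dist (γ (a + ρ / 4)) (γ (a + ρ / 2)) ≤ dist (γ w) (γ (a + ρ / 2)) := by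
    intro w hw
    rcases hw.2.eq_or_lt with h1 | h1
    · rw [h1]
    · exact (h.right w (a + ρ / 4) (a + ρ / 2) (by linarith [hw.1]) h1 (by linarith)
        (by linarith)).le
  -- the point at distance `s` to the right depends continuously on the left end
  have hζ : ∀ s, 0 < s → s ≤ ℓ → ∃ ζ : ℝ → ℝ, ContinuousOn ζ (Icc (a - ρ / 4) (a + ρ / 4)) ∧
      ∀ w ∈ Icc (a - ρ / 4) (a + ρ / 4), ζ w ∈ Ioo w (a + ρ / 2) ∧ dist (γ w) (γ (ζ w)) = s := by
    intro s hs hsℓ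
    have hex : ∀ w : ℝ, ∃ z, w ∈ Icc (a - ρ / 4) (a + ρ / 4) →
        z ∈ Ioo w (a + ρ / 2) ∧ dist (γ w) (γ z) = s := by
      intro w
      by_cases hw : w ∈ Icc (a - ρ / 4) (a + ρ / 4)
      · obtain ⟨z, hz⟩ := h.exists_dist_eq (u := w) (v := a + ρ / 2) (by linarith [hw.2]) hs
          ((hsℓ.trans_lt hℓm.2).trans_le (hJ w hw))
        exact ⟨z, fun _ => hz⟩
      · exact ⟨0, fun h0 => absurd h0 hw⟩
    choose ζ hζ using hex
    refine ⟨ζ, fun w hw => ?_, hζ⟩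
    obtain ⟨⟨z1, z2⟩, z3⟩ := hζ w hw
    have hcγ := h.cont
    rw [ContinuousWithinAt, tendsto_order]
    constructor
    · intro y hy
      obtain ⟨y', hy1, hy2⟩ := exists_between (max_lt hy z1)
      rw [max_lt_iff] at hy1
      have d1 := h.left w y' (ζ w) (by linarith [hw.1]) hy1.2 hy2 (by linarith)
      have e1 : ∀ᶠ w' in 𝓝 w, dist (γ w') (γ y') < s := by
        have : Continuous fun w' => dist (γ w') (γ y') := by fun_prop
        exact (this.tendsto w).eventually (gt_mem_nhds (by rw [← z3]; exact d1))
      filter_upwards [nhdsWithin_le_nhds e1, self_mem_nhdsWithin] with w' k1 k2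
      obtain ⟨⟨z1', z2'⟩, z3'⟩ := hζ w' k2
      exact hy1.1.trans (h.lt_of_dist_lt (by linarith [k2.1]) z1' (by linarith)
        (by rw [z3']; exact k1))
    · intro y hy
      obtain ⟨y', hy1, hy2⟩ := exists_between (lt_min hy z2)
      rw [lt_min_iff] at hy2
      have d1 := h.left w (ζ w) y' (by linarith [hw.1]) z1 hy1 (by linarith)
      have e1 : ∀ᶠ w' in 𝓝 w, s < dist (γ w') (γ y') := by
        have : Continuous fun w' => dist (γ w') (γ y') := by fun_prop
        exact (this.tendsto w).eventually (lt_mem_nhds (by rw [← z3]; exact d1))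
      filter_upwards [nhdsWithin_le_nhds e1, self_mem_nhdsWithin,
        nhdsWithin_le_nhds (gt_mem_nhds (z1.trans hy1))] with w' k1 k2 k3
      obtain ⟨⟨z1', z2'⟩, z3'⟩ := hζ w' k2
      exact (h.lt_of_dist_lt (by linarith [k2.1]) k3 (by linarith)
        (by rw [z3']; exact k1)).trans hy2.1
  obtain ⟨e, hec, he⟩ := hζ ℓ hℓ le_rfl
  have haI : a ∈ Icc (a - ρ / 4) (a + ρ / 4) := ⟨by linarith, by linarith⟩
  have hce : ∀ w ∈ Icc (a - ρ / 4) (a + ρ / 4), ∀ w' ∈ Icc (a - ρ / 4) (a + ρ / 4),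
      CongArc γ w (e w) γ w' (e w') := fun w hw w' hw' =>
    hcong w (e w) w' (e w') (by linarith [hw.1]) (he w hw).1.1 (by linarith [(he w hw).1.2])
      (he w hw).2 (by linarith [hw'.1]) (he w' hw').1.1 (by linarith [(he w' hw').1.2])
      (he w' hw').2
  obtain ⟨⟨ea1, ea2⟩, ea3⟩ := he a haI
  have hns' : ¬ SymArc γ a (e a) := fun hs => hns (hs.of_cong
    (hcong a (e a) u v (by linarith) ea1 (by linarith) ea3 hu huv hv huvℓ))
  -- a pair of points witnessing the asymmetry of the arc of chord `ℓ` that begins at `a`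
  obtain ⟨x, hx, y, hy, hxy, hne⟩ : ∃ x ∈ Ioo a (e a), ∃ y ∈ Ioo a (e a),
      dist (γ a) (γ x) = dist (γ y) (γ (e a)) ∧ dist (γ x) (γ (e a)) ≠ dist (γ a) (γ y) := by
    by_contra hcon
    push Not at hcon
    exact hns' (h.symArc_of_dist ea1 (by linarith) (by linarith) hcon)
  have hsℓ : dist (γ a) (γ x) < ℓ := by
    rw [← ea3]; exact h.left a x (e a) (by linarith) hx.1 hx.2 (by linarith)
  obtain ⟨ζ, hζc, hζ'⟩ := hζ _ (h.dist_pos hx.1) hsℓ.le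
  set Φ : ℝ → ℝ := fun w => dist (γ (ζ w)) (γ (e w)) with hΦ
  have hΦc : ContinuousOn Φ (Icc (a - ρ / 4) (a + ρ / 4)) :=
    continuous_dist.comp_continuousOn
      ((h.cont.comp_continuousOn hζc).prodMk (h.cont.comp_continuousOn hec))
  have hΦd : ∀ w ∈ Icc (a - ρ / 4) (a + ρ / 4), ∀ g : E3 ≃ₗᵢ[ℝ] E3, g (γ a) = γ w →
      g (γ (e a)) = γ (e w) → (∀ x ∈ Ioo a (e a), ∃ y ∈ Ioo w (e w), g (γ x) = γ y) →
      Φ w = dist (γ x) (γ (e a)) := by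
    intro w hw g g1 g2 g3
    obtain ⟨z, hz, gz⟩ := g3 x hx
    obtain ⟨⟨z1, z2⟩, z3⟩ := hζ' w hw
    have d1 := g.dist_map (γ a) (γ x)
    rw [g1, gz, ← z3] at d1
    have := h.eq_of_dist_right (by linarith [hw.1]) hz.1 z1 (by linarith [hz.2, (he w hw).1.2])
      (by linarith) d1
    rw [hΦ]
    simp only
    rw [← this, ← gz, ← g2, g.dist_map]
  have hΦr : ∀ w ∈ Icc (a - ρ / 4) (a + ρ / 4), ∀ g : E3 ≃ₗᵢ[ℝ] E3, g (γ a) = γ (e w) →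
      g (γ (e a)) = γ w → (∀ x ∈ Ioo a (e a), ∃ y ∈ Ioo w (e w), g (γ x) = γ y) →
      Φ w = dist (γ a) (γ y) := by
    intro w hw g g1 g2 g3
    obtain ⟨z, hz, gz⟩ := g3 y hy
    obtain ⟨⟨z1, z2⟩, z3⟩ := hζ' w hw
    have d1 := g.dist_map (γ y) (γ (e a))
    rw [g2, gz, ← hxy, ← z3, dist_comm] at d1
    have := h.eq_of_dist_right (by linarith [hw.1]) hz.1 z1 (by linarith [hz.2, (he w hw).1.2])
      (by linarith) d1
    rw [hΦ]
    simp only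
    rw [← this, ← gz, ← g1, g.dist_map, dist_comm]
  have hΦ2 : ∀ w ∈ Icc (a - ρ / 4) (a + ρ / 4),
      Φ w ∈ ({dist (γ x) (γ (e a)), dist (γ a) (γ y)} : Set ℝ) := by
    intro w hw
    obtain ⟨g, ⟨g1, g2⟩ | ⟨g1, g2⟩, g3, -⟩ := hce a haI w hw
    · exact Or.inl (hΦd w hw g g1 g2 g3)
    · exact Or.inr (hΦr w hw g g1 g2 g3)
  have hΦa : Φ a = dist (γ x) (γ (e a)) :=
    hΦd a haI (LinearIsometryEquiv.refl ℝ E3) rfl rfl fun x hx => ⟨x, hx, rfl⟩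
  have hconst : ∀ w ∈ Icc (a - ρ / 4) (a + ρ / 4), Φ w = dist (γ x) (γ (e a)) := by
    intro w hw
    rw [← hΦa]
    exact isPreconnected_Icc.constant_of_mapsTo (T := {dist (γ x) (γ (e a)), dist (γ a) (γ y)})
      (toFinite _).isDiscrete hΦc hΦ2 hw haI
  have hdir : ∀ w ∈ Icc (a - ρ / 4) (a + ρ / 4), ∃ g : E3 ≃ₗᵢ[ℝ] E3, g (γ a) = γ w ∧
      (∀ x ∈ Ioo a (e a), ∃ y ∈ Ioo w (e w), g (γ x) = γ y) ∧
      ∀ y ∈ Ioo w (e w), ∃ x ∈ Ioo a (e a), g (γ x) = γ y := by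
    intro w hw
    obtain ⟨g, ⟨g1, g2⟩ | ⟨g1, g2⟩, g3, g4⟩ := hce a haI w hw
    · exact ⟨g, g1, g3, g4⟩
    · exact absurd ((hconst w hw).symm.trans (hΦr w hw g g1 g2 g3)) hne
  obtain ⟨ρ', h0, h1, h2⟩ := (h.shrink (ρ' := ρ / 4) (by linarith) (by linarith)).exists_small hℓ
  refine ⟨ρ', h0, by linarith, h.rigid_of_direct (by linarith) fun w w' hw1 hw2 hw1' hw2' => ?_⟩
  have hwI : w ∈ Icc (a - ρ / 4) (a + ρ / 4) := ⟨by linarith, by linarith⟩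
  have hwI' : w' ∈ Icc (a - ρ / 4) (a + ρ / 4) := ⟨by linarith, by linarith⟩
  obtain ⟨g, g1, -, g4⟩ := hdir w hwI
  obtain ⟨g', g1', g3', -⟩ := hdir w' hwI'
  refine ⟨g.symm.trans g', ?_, fun x hwx hx => ?_⟩
  · rw [LinearIsometryEquiv.trans_apply, ← g1, g.symm_apply_apply, g1']
  · have hxe : x < e w := h.lt_of_dist_lt (by linarith) (he w hwI).1.1 (by linarith) (by
      rw [(he w hwI).2]; exact h2 w x hw1 hw2 (by linarith) hx)
    obtain ⟨z, hz, gz⟩ := g4 x ⟨hwx, hxe⟩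
    obtain ⟨z', hz', gz'⟩ := g3' z hz
    refine ⟨z', hz'.1, by linarith [hz'.2, (he w' hwI').1.2], ?_⟩
    rw [LinearIsometryEquiv.trans_apply, ← gz, g.symm_apply_apply, gz']

end MonoCurve
end SphericalPlane

namespace SphericalPlane

/-! ### Cones whose small intersections are symmetric -/

/-- Each small intersection with interior points of the cone `K` and a rotated copy of the cone `L`
is mapped onto itself by an isometry with the property `Q`. Smallness is expressed by the inner
products of unit vectors being close to `1`. -/
def SmallSym (Q : (E3 ≃ₗᵢ[ℝ] E3) → Prop) (K L : Set E3) : Prop :=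
  ∃ c < 1, ∀ φ : E3 ≃ₗᵢ[ℝ] E3, OrientationPreserving φ → (interior (K ∩ φ '' L)).Nonempty →
    (∀ z ∈ K ∩ φ '' L, ∀ z' ∈ K ∩ φ '' L, ‖z‖ = 1 → ‖z'‖ = 1 → c ≤ ⟪z, z'⟫) →
    ∃ g, Q g ∧ g '' (K ∩ φ '' L) = K ∩ φ '' L

lemma image_trans (g k : E3 ≃ₗᵢ[ℝ] E3) (S : Set E3) : g.trans k '' S = k '' (g '' S) := by
  rw [image_image]; rfl

lemma image_symm_image (g : E3 ≃ₗᵢ[ℝ] E3) (S : Set E3) : g.symm '' (g '' S) = S := by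
  rw [image_image]; simp

lemma image_image_symm (g : E3 ≃ₗᵢ[ℝ] E3) (S : Set E3) : g '' (g.symm '' S) = S := by
  rw [image_image]; simp

/-- The class `SmallSym` is stable under a rotation of the intersections. -/
lemma SmallSym.of_image {Q : (E3 ≃ₗᵢ[ℝ] E3) → Prop} {K L K' L' : Set E3}
    (hQ : ∀ g k : E3 ≃ₗᵢ[ℝ] E3, Q g → Q ((k.symm.trans g).trans k)) (h : SmallSym Q K L)
    (hi : ∀ φ : E3 ≃ₗᵢ[ℝ] E3, OrientationPreserving φ → ∃ ψ A : E3 ≃ₗᵢ[ℝ] E3,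
      OrientationPreserving ψ ∧ K' ∩ φ '' L' = A '' (K ∩ ψ '' L)) : SmallSym Q K' L' := by
  obtain ⟨c, hc, h⟩ := h
  refine ⟨c, hc, fun φ hφ h1 h2 => ?_⟩
  obtain ⟨ψ, A, hψ, e⟩ := hi φ hφ
  rw [e] at h1 h2 ⊢
  rw [Body.interior_image, image_nonempty] at h1
  obtain ⟨g, hg, hgK⟩ := h ψ hψ h1 fun z hz z' hz' n n' => by
    have := h2 _ ⟨z, hz, rfl⟩ _ ⟨z', hz', rfl⟩ (by rw [A.norm_map, n]) (by rw [A.norm_map, n'])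
    rwa [A.inner_map_map] at this
  refine ⟨_, hQ g A hg, ?_⟩
  rw [image_trans, image_trans, image_symm_image, hgK]

lemma SmallSym.swap {Q : (E3 ≃ₗᵢ[ℝ] E3) → Prop} {K L : Set E3}
    (hQ : ∀ g k : E3 ≃ₗᵢ[ℝ] E3, Q g → Q ((k.symm.trans g).trans k)) (h : SmallSym Q K L) :
    SmallSym Q L K := by
  refine h.of_image hQ fun φ hφ => ⟨φ.symm, φ, hφ.symm, ?_⟩
  rw [image_inter φ.injective, image_image_symm, inter_comm]

lemma SmallSym.image_left {Q : (E3 ≃ₗᵢ[ℝ] E3) → Prop} {K L : Set E3}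
    (hQ : ∀ g k : E3 ≃ₗᵢ[ℝ] E3, Q g → Q ((k.symm.trans g).trans k)) (h : SmallSym Q K L)
    {A : E3 ≃ₗᵢ[ℝ] E3} (hA : OrientationPreserving A) : SmallSym Q (A '' K) L := by
  refine h.of_image hQ fun φ hφ => ⟨φ.trans A.symm, A, hφ.trans hA.symm, ?_⟩
  rw [image_inter A.injective, image_trans, image_image_symm]

lemma SmallSym.image_right {Q : (E3 ≃ₗᵢ[ℝ] E3) → Prop} {K L : Set E3}
    (hQ : ∀ g k : E3 ≃ₗᵢ[ℝ] E3, Q g → Q ((k.symm.trans g).trans k)) (h : SmallSym Q K L)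
    {A : E3 ≃ₗᵢ[ℝ] E3} (hA : OrientationPreserving A) : SmallSym Q K (A '' L) :=
  ((h.swap hQ).image_left hQ hA).swap hQ

lemma ne_refl_conj (g k : E3 ≃ₗᵢ[ℝ] E3) (hg : g ≠ LinearIsometryEquiv.refl ℝ E3) :
    (k.symm.trans g).trans k ≠ LinearIsometryEquiv.refl ℝ E3 := by
  intro h
  refine hg (LinearIsometryEquiv.ext fun z => ?_)
  have : ((k.symm.trans g).trans k) (k z) = k z := by
    rw [h, LinearIsometryEquiv.coe_refl, id]
  rw [LinearIsometryEquiv.trans_apply, LinearIsometryEquiv.trans_apply, k.symm_apply_apply] at this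
  simpa using k.injective this

namespace FlatChart

variable {K L : Set E3} {f h : ℝ → ℝ} {a ρ b σ : ℝ}

/-- An arc beyond whose chord there are no points of `K` is a great circle arc, hence symmetric. -/
lemma symArc_of_straight (hK : FlatChart K f a ρ) {u v : ℝ}
    (hs : ∀ z ∈ K, 0 ≤ trip (pt f u) (pt f v) z) : SymArc (pt f) u v := by
  have s1 : refl (pt f u - pt f v) (pt f u) = pt f v := refl_sub (by simp)
  have s2 : refl (pt f u - pt f v) (pt f v) = pt f u := refl_sub' (by simp)
  refine ⟨refl (pt f u - pt f v), s1, s2, fun x hx => ?_⟩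
  have h0 := le_antisymm (trip_nonpos_of_mem_Ioo hK.convex hx) (hs _ (hK.mem x))
  obtain ⟨α, β, h1, h2, e⟩ := pt_of_straight hK.convex hx h0
  have e' : refl (pt f u - pt f v) (pt f x) = β • pt f u + α • pt f v := by
    rw [e, map_add, map_smul, map_smul, s1, s2, add_comm]
  rw [e']
  exact straight_to_pt hK.convex hx h0 h2 h1
    (by rw [← e', LinearIsometryEquiv.norm_map, norm_pt])

lemma inner_eq_of_chord {u v : ℝ} {s : ℝ} (hd : dist (pt f u) (pt f v) = s) :
    ⟪pt f u, pt f v⟫ = 1 - s ^ 2 / 2 := by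
  rw [← hd, dist_eq_norm, norm_sub_sq_real, norm_pt, norm_pt]; ring

/-- Two short arcs with equal chords bound a lens if `L` is placed suitably. The symmetry of the lens
shows that the arcs are congruent or both symmetric. -/
lemma exists_symmetry {Q : (E3 ≃ₗᵢ[ℝ] E3) → Prop}
    (hQ : ∀ g, Q g → g ≠ LinearIsometryEquiv.refl ℝ E3)
    (hK : FlatChart K f a ρ) (hL : FlatChart L h b σ) (hS : SmallSym Q K L) :
    ∃ ℓ₁ > 0, ∀ u v w x, |u - a| < ρ → |v - a| < ρ → u < v → |w - b| < σ → |x - b| < σ → w < x →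
      dist (pt f u) (pt f v) < ℓ₁ → dist (pt f u) (pt f v) = dist (pt h w) (pt h x) →
      (∃ z ∈ K, trip (pt f u) (pt f v) z < 0) →
      ∃ g, Q g ∧ (CongArc (pt f) u v (pt h) w x ∨ (SymArc (pt f) u v ∧ SymArc (pt h) w x ∧
        g (pt f u) = pt f v ∧ g (pt f v) = pt f u ∧
        g (cr (pt f u) (pt f v)) = cr (pt f u) (pt f v))) := by
  obtain ⟨c, hc, hS⟩ := hS
  refine ⟨Real.sqrt (2 * (1 - c)), Real.sqrt_pos.2 (by linarith), ?_⟩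
  intro u v w x hu hv huv hw hx hwx hlt heq hcurved
  have hne : cr (pt f v) (pt f u) ≠ 0 := by
    rw [cr_swap, neg_ne_zero]; exact hK.monoCurve.cr_ne u v huv
  obtain ⟨φ, hφ, φ1, φ2⟩ := exists_op_map (a := pt h w) (b := pt h x) (a' := pt f v) (b' := pt f u)
    (by simp) (by simp) (inner_eq_of_dist_eq (by simp) (by simp) (by simp) (by simp)
      (by rw [← heq, dist_comm])) hne
  have hl := hK.lens hL hu hv huv hw hx hwx hcurved hφ φ1 φ2
  obtain ⟨g, hg, hgK⟩ := hS φ hφ hl.interior_nonempty fun z hz z' hz' n n' => by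
    refine le_trans ?_ (hl.inner_ge n n' hz hz').1
    rw [inner_eq_of_chord rfl]
    have := (Real.lt_sqrt dist_nonneg).1 hlt
    linarith
  exact ⟨g, hg, hK.arcs_of_symmetry hL hu hv huv hw hx hwx hcurved hφ φ1 φ2 (hQ g hg) hgK⟩

/-- Small lenses force the boundary of `K` to be locally a circle. -/
lemma exists_plane (hK : FlatChart K f a ρ) (hL : FlatChart L h b σ)
    (hS : SmallSym (· ≠ LinearIsometryEquiv.refl ℝ E3) K L) :
    ∃ N : E3, ∃ c r : ℝ, N ≠ 0 ∧ 0 < r ∧ ∀ x, |x - a| < r → ⟪N, pt f x⟫ = c := by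
  obtain ⟨ℓ₂, hℓ₂, h2⟩ := hK.exists_symmetry (fun g hg => hg) hL hS
  obtain ⟨ℓ₃, hℓ₃, h3⟩ := hL.exists_symmetry (fun g hg => hg) hK (hS.swap ne_refl_conj)
  have hσ := hL.ρpos
  have hℓ₄ := hL.monoCurve.dist_pos (show b < b + σ / 2 by linarith)
  have hpair : ∀ u v w x, |u - a| < ρ → |v - a| < ρ → u < v → |w - b| < σ → |x - b| < σ → w < x →
      dist (pt f u) (pt f v) < min ℓ₂ ℓ₃ → dist (pt f u) (pt f v) = dist (pt h w) (pt h x) →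
      CongArc (pt f) u v (pt h) w x ∨ (SymArc (pt f) u v ∧ SymArc (pt h) w x) := by
    intro u v w x hu hv huv hw hx hwx hlt heq
    rw [lt_min_iff] at hlt
    by_cases c1 : ∃ z ∈ K, trip (pt f u) (pt f v) z < 0
    · obtain ⟨g, -, hg | hg⟩ := h2 u v w x hu hv huv hw hx hwx hlt.1 heq c1
      · exact Or.inl hg
      · exact Or.inr ⟨hg.1, hg.2.1⟩
    by_cases c2 : ∃ z ∈ L, trip (pt h w) (pt h x) z < 0
    · obtain ⟨g, -, hg | hg⟩ := h3 w x u v hw hx hwx hu hv huv (by rw [← heq]; exact hlt.2)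
        heq.symm c2
      · exact Or.inl hg.symm
      · exact Or.inr ⟨hg.2.1, hg.1⟩
    push Not at c1 c2
    exact Or.inr ⟨hK.symArc_of_straight c1, hL.symArc_of_straight c2⟩
  have habs : ∀ u v, a - ρ < u → u < v → v < a + ρ → |u - a| < ρ ∧ |v - a| < ρ := by
    intro u v h1 h2 h3
    simp only [abs_sub_lt_iff]
    exact ⟨⟨by linarith, by linarith⟩, by linarith, by linarith⟩
  obtain ⟨ρ', h0, h1, hr⟩ := hK.monoCurve.exists_rigid
    (ℓ₁ := min (min ℓ₂ ℓ₃) (dist (pt h b) (pt h (b + σ / 2)))) (by positivity) (by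
    intro ℓ hℓ hℓ1
    rw [lt_min_iff] at hℓ1
    obtain ⟨x, hx, hbx⟩ := hL.monoCurve.exists_dist_eq (show b < b + σ / 2 by linarith) hℓ hℓ1.2
    have hb' : |b - b| < σ := by simpa using hσ
    have hx' : |x - b| < σ := by
      rw [abs_sub_lt_iff]; constructor <;> linarith [hx.1, hx.2]
    have hp : ∀ u v, a - ρ < u → u < v → v < a + ρ → dist (pt f u) (pt f v) = ℓ →
        CongArc (pt f) u v (pt h) b x ∨ (SymArc (pt f) u v ∧ SymArc (pt h) b x) :=
      fun u v hu huv hv he => hpair u v b x (habs u v hu huv hv).1 (habs u v hu huv hv).2 huv hb'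
        hx' hx.1 (by rw [he]; exact hℓ1.1) (by rw [he, hbx])
    by_cases hs : SymArc (pt h) b x
    · left
      intro u v hu huv hv he
      rcases hp u v hu huv hv he with hc | hc
      · exact hs.of_cong hc.symm
      · exact hc.1
    · right
      intro u v u' v' hu huv hv he hu' huv' hv' he'
      exact ((hp u v hu huv hv he).resolve_right fun h => hs h.2).trans
        ((hp u' v' hu' huv' hv' he').resolve_right fun h => hs h.2).symm)
  exact (hK.monoCurve.shrink h0 h1).exists_plane hr

end FlatChart

end SphericalPlane

namespace SphericalPlane

/-! ### Sharp points -/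

/-- A ray of the cone `C` is sharp if `C` has two supporting planes there whose normals enclose an
angle with cosine less than `c`. -/
def Sharp (c : ℝ) (C : Set E3) (z : E3) : Prop :=
  ∃ n₁ n₂ : E3, (∀ y ∈ C, 0 ≤ ⟪n₁, y⟫ ∧ 0 ≤ ⟪n₂, y⟫) ∧ ⟪n₁, z⟫ = 0 ∧ ⟪n₂, z⟫ = 0 ∧
    ⟪n₁, n₂⟫ < c * (‖n₁‖ * ‖n₂‖)

lemma Sharp.map {c : ℝ} {C : Set E3} {z : E3} (h : Sharp c C z) {g : E3 ≃ₗᵢ[ℝ] E3}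
    (hg : g '' C = C) : Sharp c C (g z) := by
  obtain ⟨n₁, n₂, h1, h2, h3, h4⟩ := h
  refine ⟨g n₁, g n₂, ?_, ?_, ?_, ?_⟩
  · intro y hy
    rw [← hg] at hy
    obtain ⟨y, hy, rfl⟩ := hy
    rw [g.inner_map_map, g.inner_map_map]; exact h1 y hy
  · rw [g.inner_map_map, h2]
  · rw [g.inner_map_map, h3]
  · rwa [g.inner_map_map, g.norm_map, g.norm_map]

lemma Sharp.image {c : ℝ} {C : Set E3} {z : E3} {g : E3 ≃ₗᵢ[ℝ] E3} (h : Sharp c (g '' C) z) :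
    Sharp c C (g.symm z) := by
  obtain ⟨n₁, n₂, h1, h2, h3, h4⟩ := h
  have e : ∀ n y, ⟪g.symm n, y⟫ = ⟪n, g y⟫ := fun n y => by
    rw [← g.inner_map_map, g.apply_symm_apply]
  refine ⟨g.symm n₁, g.symm n₂, fun y hy => ?_, ?_, ?_, ?_⟩
  · rw [e, e]; exact h1 _ ⟨y, hy, rfl⟩
  · rw [g.symm.inner_map_map, h2]
  · rw [g.symm.inner_map_map, h3]
  · rwa [g.symm.inner_map_map, g.symm.norm_map, g.symm.norm_map]

/-- Supporting planes of an intersection at an interior point of one of the cones support the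
other cone. -/
lemma Sharp.of_inter {c : ℝ} {K M : Set E3} (hK : Body K) {z : E3} (h : Sharp c (K ∩ M) z)
    (hz : z ∈ K) (hM : z ∈ interior M) : Sharp c K z := by
  obtain ⟨n₁, n₂, h1, h2, h3, h4⟩ := h
  refine ⟨n₁, n₂, fun y hy => ?_, h2, h3, h4⟩
  obtain ⟨t, ht, hm⟩ := Body.exists_add_smul_mem hM y
  have := h1 _ ⟨hK.add z hz _ (hK.smul t ht.le y hy), hm⟩
  rw [inner_add_right, inner_add_right, h2, h3, inner_smul_right, inner_smul_right, zero_add,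
    zero_add] at this
  exact ⟨nonneg_of_mul_nonneg_right this.1 ht, nonneg_of_mul_nonneg_right this.2 ht⟩

lemma not_sharp_of_mem_interior {c : ℝ} {C : Set E3} {z : E3} (hz : z ∈ interior C) :
    ¬ Sharp c C z := by
  rintro ⟨n₁, n₂, h1, h2, h3, h4⟩
  have e : n₁ = 0 := by
    obtain ⟨t, ht, hm⟩ := Body.exists_add_smul_mem hz (-n₁)
    have := (h1 _ hm).1
    rw [inner_add_right, h2, inner_smul_right, inner_neg_right, zero_add] at this
    have h5 : 0 ≤ ⟪n₁, n₁⟫ := real_inner_self_nonneg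
    exact inner_self_eq_zero.1 (le_antisymm (by nlinarith) h5)
  rw [e] at h4
  simp at h4

lemma Chart.eq_smul_nrm {K : Set E3} {f : ℝ → ℝ} (hf : Chart K f) {u : ℝ} {n : E3} (hn : n ≠ 0)
    (h : ∀ y ∈ K, 0 ≤ ⟪n, y⟫) (h0 : ⟪n, pt f u⟫ = 0) :
    ∃ r t : ℝ, 0 < r ∧ SubG f u t ∧ n = r • nrm f u t := by
  have hv : ∀ v s : ℝ, 0 ≤ s → 0 ≤ n 0 * v + n 1 * (f v + s) + n 2 := by
    intro v s hs
    have := h !₂[v, f v + s, 1] (by rw [hf.mem_iff _ (by simp)]; simpa using hs)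
    simpa [inner_coord] using this
  have hu : n 0 * u + n 1 * f u + n 2 = 0 := by
    have h1 : ⟪n, vec f u⟫ = 0 := by rw [vec_eq_smul_pt, inner_smul_right, h0, mul_zero]
    simpa [inner_coord] using h1
  have h1 : 0 ≤ n 1 := by have := hv u 1 zero_le_one; nlinarith
  rcases h1.eq_or_lt with h1 | h1
  · exfalso
    have k1 := hv (u + 1) 0 le_rfl
    have k2 := hv (u - 1) 0 le_rfl
    rw [← h1] at k1 k2 hu
    have e0 : n 0 = 0 := by linarith
    have e2 : n 2 = 0 := by rw [e0] at hu; linarith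
    exact hn (ext_coord (by simp [e0]) (by simp [← h1]) (by simp [e2]))
  · refine ⟨n 1, -n 0 / n 1, h1, fun v => ?_, ?_⟩
    · have := hv v 0 le_rfl
      rw [div_mul_eq_mul_div, ← le_sub_iff_add_le', div_le_iff₀ h1]
      nlinarith
    · apply ext_coord <;> simp [nrm] <;> field_simp
      linarith

lemma Chart.not_sharp {K : Set E3} {f : ℝ → ℝ} (hf : Chart K f) {u c : ℝ}
    (h : ∀ t s, SubG f u t → SubG f u s →
      c * (‖nrm f u t‖ * ‖nrm f u s‖) ≤ ⟪nrm f u t, nrm f u s⟫) : ¬ Sharp c K (pt f u) := by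
  rintro ⟨n₁, n₂, h1, h2, h3, h4⟩
  have e1 : n₁ ≠ 0 := by rintro rfl; simp at h4
  have e2 : n₂ ≠ 0 := by rintro rfl; simp at h4
  obtain ⟨r, t, hr, ht, rfl⟩ := hf.eq_smul_nrm e1 (fun y hy => (h1 y hy).1) h2
  obtain ⟨r', s, hr', hs, rfl⟩ := hf.eq_smul_nrm e2 (fun y hy => (h1 y hy).2) h3
  rw [inner_smul_left, inner_smul_right, norm_smul, norm_smul, Real.norm_of_nonneg hr.le,
    Real.norm_of_nonneg hr'.le] at h4
  simp only [conj_trivial] at h4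
  have := mul_le_mul_of_nonneg_left (h t s ht hs) (mul_pos hr hr').le
  linarith

lemma one_le_norm_nrm (f : ℝ → ℝ) (u t : ℝ) : 1 ≤ ‖nrm f u t‖ := by
  have : ‖nrm f u t‖ ^ 2 = t ^ 2 + 1 + (t * u - f u) ^ 2 := by
    rw [← real_inner_self_eq_norm_sq, inner_nrm_nrm]; ring
  nlinarith [norm_nonneg (nrm f u t), sq_nonneg t, sq_nonneg (t * u - f u)]

lemma continuous_nrm {f : ℝ → ℝ} (hf : Continuous f) :
    Continuous fun w : ℝ × ℝ => nrm f w.1 w.2 := by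
  unfold nrm; fun_prop

lemma eventually_inner_nrm {f : ℝ → ℝ} (hf : Continuous f) (a S : ℝ) {c : ℝ} (hc : c < 1) :
    ∃ ε > 0, ∀ u t s, |u - a| < ε → |t - S| < ε → |s - S| < ε →
      c * (‖nrm f u t‖ * ‖nrm f u s‖) ≤ ⟪nrm f u t, nrm f u s⟫ := by
  have hn := continuous_nrm hf
  have h1 : Continuous fun p : ℝ × ℝ × ℝ => nrm f p.1 p.2.1 :=
    hn.comp (by fun_prop : Continuous fun p : ℝ × ℝ × ℝ => (p.1, p.2.1))
  have h2 : Continuous fun p : ℝ × ℝ × ℝ => nrm f p.1 p.2.2 :=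
    hn.comp (by fun_prop : Continuous fun p : ℝ × ℝ × ℝ => (p.1, p.2.2))
  have h3 : Continuous fun p : ℝ × ℝ × ℝ => ⟪nrm f p.1 p.2.1, nrm f p.1 p.2.2⟫ -
      c * (‖nrm f p.1 p.2.1‖ * ‖nrm f p.1 p.2.2‖) := by fun_prop
  have h4 : 0 < ⟪nrm f a S, nrm f a S⟫ - c * (‖nrm f a S‖ * ‖nrm f a S‖) := by
    rw [real_inner_self_eq_norm_sq]
    have := one_le_norm_nrm f a S
    nlinarith [mul_pos (sub_pos.2 hc) (show 0 < ‖nrm f a S‖ ^ 2 by positivity)]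
  obtain ⟨ε, hε, h5⟩ := Metric.eventually_nhds_iff.1 ((h3.tendsto (a, S, S)).eventually
    (lt_mem_nhds h4))
  refine ⟨ε, hε, fun u t s hu ht hs => ?_⟩
  have := h5 (y := (u, t, s)) (by
    simp only [Prod.dist_eq, Real.dist_eq]; exact max_lt hu (max_lt ht hs))
  exact (sub_pos.1 this).le

lemma eventually_abs_sub_lt (a : ℝ) {ε : ℝ} (hε : 0 < ε) : ∀ᶠ u in 𝓝 a, |u - a| < ε :=
  Metric.eventually_nhds_iff.2 ⟨ε, hε, fun _ hy => hy⟩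

lemma Chart.eventually_not_sharp_right {K : Set E3} {f : ℝ → ℝ} (hf : Chart K f) (a : ℝ) {c : ℝ}
    (hc : c < 1) : ∀ᶠ u in 𝓝[>] a, ¬ Sharp c K (pt f u) := by
  obtain ⟨ε, hε, h⟩ := eventually_inner_nrm (continuous_of_convex hf.convex) a (dR f a) hc
  filter_upwards [eventually_subG_right hf.convex a hε,
    nhdsWithin_le_nhds (eventually_abs_sub_lt a hε)] with u h1 h2
  have h3 : ∀ t, SubG f u t → |t - dR f a| < ε := fun t ht => by
    have := h1 t ht
    rw [abs_sub_lt_iff]; constructor <;> linarith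
  exact hf.not_sharp fun t s ht hs => h u t s h2 (h3 t ht) (h3 s hs)

lemma Chart.eventually_not_sharp_left {K : Set E3} {f : ℝ → ℝ} (hf : Chart K f) (a : ℝ) {c : ℝ}
    (hc : c < 1) : ∀ᶠ u in 𝓝[<] a, ¬ Sharp c K (pt f u) := by
  obtain ⟨ε, hε, h⟩ := eventually_inner_nrm (continuous_of_convex hf.convex) a (dL f a) hc
  filter_upwards [eventually_subG_left hf.convex a hε,
    nhdsWithin_le_nhds (eventually_abs_sub_lt a hε)] with u h1 h2
  have h3 : ∀ t, SubG f u t → |t - dL f a| < ε := fun t ht => by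
    have := h1 t ht
    rw [abs_sub_lt_iff]; constructor <;> linarith
  exact hf.not_sharp fun t s ht hs => h u t s h2 (h3 t ht) (h3 s hs)

lemma Chart.eventually_not_sharp {K : Set E3} {f : ℝ → ℝ} (hf : Chart K f) {a : ℝ}
    (ha : dL f a = dR f a) {c : ℝ} (hc : c < 1) : ∀ᶠ u in 𝓝 a, ¬ Sharp c K (pt f u) := by
  obtain ⟨ε, hε, h⟩ := eventually_inner_nrm (continuous_of_convex hf.convex) a (dR f a) hc
  filter_upwards [eventually_subG hf.convex ha hε, eventually_abs_sub_lt a hε] with u h1 h2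
  exact hf.not_sharp fun t s ht hs => h u t s h2 (h1 t ht) (h1 s hs)

/-- A property of the points of the graph near `pt f a` holds for the nearby boundary points. -/
lemma Chart.frontier_near {K : Set E3} {f : ℝ → ℝ} (hK : Body K) (hf : Chart K f) {a : ℝ}
    {P : E3 → Prop} (h : ∀ᶠ u in 𝓝 a, P (pt f u)) :
    ∃ r > 0, ∀ z ∈ frontier K, ‖z‖ = 1 → ‖z - pt f a‖ < r → P z := by
  have h2 := pt_two_pos f a
  have c1 : ContinuousAt (fun z : E3 => z 0 / z 2) (pt f a) :=
    ContinuousAt.div (by fun_prop) (by fun_prop) h2.ne'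
  have c2 : ContinuousAt (fun z : E3 => z 2) (pt f a) := by fun_prop
  have t1 := c1.tendsto
  rw [pt_zero_div] at t1
  obtain ⟨r, hr, h3⟩ := Metric.eventually_nhds_iff.1
    ((t1.eventually h).and (c2.eventually (lt_mem_nhds h2)))
  refine ⟨r, hr, fun z hz hn hd => ?_⟩
  obtain ⟨h4, h5⟩ := h3 (y := z) (by rwa [dist_eq_norm])
  rw [(hf.eq_pt_of_mem_frontier hK hn h5 hz).2]
  exact h4

lemma nrm_sub (f : ℝ → ℝ) (u t s : ℝ) : nrm f u t - nrm f u s = (t - s) • (!₂[-1, 0, u] : E3) := by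
  apply ext_coord <;> simp [nrm] <;> ring

/-- At a smooth boundary point the interior contains the beginnings of all rays that point inwards
from the tangent plane under a given angle. -/
lemma Chart.add_mem_interior_of_cone {L : Set E3} {h : ℝ → ℝ} (hh : Chart L h) {b : ℝ}
    (hb : dL h b = dR h b) {m : ℝ} (hm : 0 < m) :
    ∃ r > 0, ∀ w : E3, ‖w‖ < r → m * ‖w‖ < ⟪nrm h b (dR h b), w⟫ → pt h b + w ∈ interior L := by
  set D := ‖(!₂[-1, 0, b] : E3)‖
  have hD : 0 ≤ D := norm_nonneg _
  have h2 := pt_two_pos h b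
  have c1 : ContinuousAt (fun z : E3 => z 0 / z 2) (pt h b) :=
    ContinuousAt.div (by fun_prop) (by fun_prop) h2.ne'
  have c2 : ContinuousAt (fun z : E3 => z 2) (pt h b) := by fun_prop
  have t1 := c1.tendsto
  rw [pt_zero_div] at t1
  obtain ⟨r, hr, h3⟩ := Metric.eventually_nhds_iff.1
    ((t1.eventually (eventually_subG hh.convex hb (show 0 < m / (D + 1) by positivity))).and
      (c2.eventually (lt_mem_nhds h2)))
  refine ⟨r, hr, fun w hw hlt => ?_⟩
  obtain ⟨h4, h5⟩ := h3 (y := pt h b + w) (by rwa [dist_eq_norm, add_sub_cancel_left])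
  set z := pt h b + w with hz
  rw [hh.mem_interior_iff h5]
  set y := z 0 / z 2 with hy
  have hs := subG_dR hh.convex y
  have ht := h4 _ hs
  have hbelow := hs b
  have hpos : 0 < ⟪nrm h b (dR h y), z⟫ := by
    have e : nrm h b (dR h y) = nrm h b (dR h b) + (dR h y - dR h b) • (!₂[-1, 0, b] : E3) := by
      rw [← nrm_sub]; abel
    have e2 : ⟪nrm h b (dR h y), z⟫ = ⟪nrm h b (dR h y), w⟫ := by
      rw [hz, inner_add_right, inner_nrm_pt, zero_add]
    rw [e2, e, inner_add_left, inner_smul_left]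
    have k1 := abs_real_inner_le_norm (!₂[-1, 0, b] : E3) w
    have k2 : |(dR h y - dR h b) * ⟪(!₂[-1, 0, b] : E3), w⟫| ≤ m * ‖w‖ := by
      rw [abs_mul]
      calc _ ≤ m / (D + 1) * (D * ‖w‖) := by gcongr
        _ = m * ‖w‖ * (D / (D + 1)) := by field_simp
        _ ≤ m * ‖w‖ * 1 := by
          gcongr
          rw [div_le_one (by positivity)]; linarith
        _ = _ := mul_one _
    have k3 := neg_le_of_abs_le k2
    simp only [conj_trivial]
    linarith
  rw [inner_nrm] at hpos
  rw [lt_div_iff₀ h5]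
  have e2 : y * z 2 = z 0 := div_mul_cancel₀ _ h5.ne'
  have h6 : (h y + dR h y * (b - y)) * z 2 ≤ h b * z 2 :=
    mul_le_mul_of_nonneg_right hbelow h5.le
  have h7 : (h y + dR h y * (b - y)) * z 2 =
      h y * z 2 + dR h y * b * z 2 - dR h y * (y * z 2) := by ring
  rw [h7, e2] at h6
  linarith

end SphericalPlane

namespace SphericalPlane

/-! ### Lenses with a corner -/

/-- The configuration in which a flat arc of the boundary of `M`, with ends `p` and `q`, cuts a
small piece with the corner `x` off the cone `K`. -/
structure CornerLens (K M : Set E3) (x p q : E3) (c r ε : ℝ) : Prop where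
  hK : Body K
  hM : Body M
  nx : ‖x‖ = 1
  np : ‖p‖ = 1
  nq : ‖q‖ = 1
  xK : x ∈ K
  pK : p ∈ K
  qK : q ∈ K
  pM : p ∈ M
  qM : q ∈ M
  neg : trip q p x < 0
  hullK : ∃ X ∈ interior M, trip q p X < 0 ∧ (1 - ε) * ‖X‖ ≤ ⟪x, X⟫ ∧
    ∀ z ∈ K, trip q p z ≤ 0 → z ∈ hull q p X
  hullM : ∃ W ∈ interior K, (1 - ε) * ‖W‖ ≤ ⟪x, W⟫ ∧ ∀ z ∈ M, 0 < trip q p z → z ∈ hull q p W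
  chord : ∀ α β : ℝ, 0 < α → 0 < β → α • q + β • p ∈ interior K
  near_p : 1 - ε ≤ ⟪x, p⟫
  near_q : 1 - ε ≤ ⟪x, q⟫
  r_pos : 0 < r
  ε_pos : 0 < ε
  ε_lt : 8 * ε < r ^ 2
  ε_one : ε < 1
  xp_ne_xq : dist x p ≠ dist x q
  pq_ne_xp : dist p q ≠ dist x p
  pq_ne_xq : dist p q ≠ dist x q
  sharp_x : Sharp c K x
  sharp_p : Sharp c (K ∩ M) p
  sharp_q : Sharp c (K ∩ M) q
  not_sharp_K : ∀ z ∈ frontier K, ‖z‖ = 1 → ‖z - x‖ < r → z ≠ x → ¬ Sharp c K z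
  not_sharp_M : ∀ z ∈ frontier M, ‖z‖ = 1 → ‖z - p‖ < r → ¬ Sharp c M z

lemma inner_ge_of_mem_hull_near {x a b X z : E3} {t : ℝ} (ht : 0 ≤ t) (ha : t * ‖a‖ ≤ ⟪x, a⟫)
    (hb : t * ‖b‖ ≤ ⟪x, b⟫) (hX : t * ‖X‖ ≤ ⟪x, X⟫) (hz : z ∈ hull a b X) :
    t * ‖z‖ ≤ ⟪x, z⟫ := by
  obtain ⟨α, β, γ, h1, h2, h3, rfl⟩ := hz
  have hn : ‖α • a + β • b + γ • X‖ ≤ α * ‖a‖ + β * ‖b‖ + γ * ‖X‖ := by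
    refine (norm_add₃_le).trans ?_
    rw [norm_smul, norm_smul, norm_smul, Real.norm_of_nonneg h1, Real.norm_of_nonneg h2,
      Real.norm_of_nonneg h3]
  rw [inner_add_right, inner_add_right, inner_smul_right, inner_smul_right, inner_smul_right]
  have := mul_le_mul_of_nonneg_left hn ht
  nlinarith [mul_le_mul_of_nonneg_left ha h1, mul_le_mul_of_nonneg_left hb h2,
    mul_le_mul_of_nonneg_left hX h3]

namespace CornerLens

variable {K M : Set E3} {x p q : E3} {c r ε : ℝ}

lemma inner_ge (h : CornerLens K M x p q c r ε) {z : E3} (hzK : z ∈ K) (hzM : z ∈ M)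
    (hz : ‖z‖ = 1) : 1 - ε ≤ ⟪x, z⟫ := by
  obtain ⟨X, -, -, hX, hX'⟩ := h.hullK
  obtain ⟨W, -, hW, hW'⟩ := h.hullM
  have h0 : 0 ≤ 1 - ε := by linarith [h.ε_one]
  have hp : (1 - ε) * ‖p‖ ≤ ⟪x, p⟫ := by rw [h.np, mul_one]; exact h.near_p
  have hq : (1 - ε) * ‖q‖ ≤ ⟪x, q⟫ := by rw [h.nq, mul_one]; exact h.near_q
  have : (1 - ε) * ‖z‖ ≤ ⟪x, z⟫ := by
    rcases le_or_gt (trip q p z) 0 with h1 | h1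
    · exact inner_ge_of_mem_hull_near h0 hq hp hX (hX' z hzK h1)
    · exact inner_ge_of_mem_hull_near h0 hq hp hW (hW' z hzM h1)
  rwa [hz, mul_one] at this

lemma norm_sub_sq_le (h : CornerLens K M x p q c r ε) {z : E3} (hzK : z ∈ K) (hzM : z ∈ M)
    (hz : ‖z‖ = 1) : ‖z - x‖ ^ 2 ≤ 2 * ε := by
  have := h.inner_ge hzK hzM hz
  rw [norm_sub_sq_real, hz, h.nx, real_inner_comm]
  linarith

lemma norm_sub_sq_le' (h : CornerLens K M x p q c r ε) {z w : E3} (hzK : z ∈ K) (hzM : z ∈ M)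
    (hz : ‖z‖ = 1) (hwK : w ∈ K) (hwM : w ∈ M) (hw : ‖w‖ = 1) : ‖z - w‖ ^ 2 ≤ 8 * ε := by
  have h1 := h.norm_sub_sq_le hzK hzM hz
  have h2 := h.norm_sub_sq_le hwK hwM hw
  have h3 := norm_sub_le (z - x) (w - x)
  rw [sub_sub_sub_cancel_right] at h3
  nlinarith [norm_nonneg (z - w), norm_nonneg (z - x), norm_nonneg (w - x),
    sq_nonneg (‖z - x‖ - ‖w - x‖)]

lemma mem_interior_M (h : CornerLens K M x p q c r ε) {z : E3} (hz : z ∈ K)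
    (hneg : trip q p z < 0) : z ∈ interior M := by
  obtain ⟨X, hXM, -, -, hX⟩ := h.hullK
  exact Lens.mem_interior_of_hull h.hM h.qM h.pM hXM (hX z hz hneg.le) hneg.ne

/-- The sharp points are the three vertices. -/
lemma eq_vertex (h : CornerLens K M x p q c r ε) {z : E3} (hzK : z ∈ K) (hzM : z ∈ M)
    (hz : ‖z‖ = 1) (hs : Sharp c (K ∩ M) z) : z = x ∨ z = p ∨ z = q := by
  have hr := h.r_pos
  by_cases h1 : z ∈ interior K
  · exfalso
    by_cases h2 : z ∈ interior M
    · refine not_sharp_of_mem_interior ?_ hs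
      rw [interior_inter]
      exact ⟨h1, h2⟩
    · refine h.not_sharp_M z (h.hM.mem_frontier_iff.2 ⟨hzM, h2⟩) hz ?_ ?_
      · refine lt_of_pow_lt_pow_left₀ 2 hr.le ?_
        exact (h.norm_sub_sq_le' hzK hzM hz h.pK h.pM h.np).trans_lt h.ε_lt
      · rw [inter_comm] at hs
        exact hs.of_inter h.hM hzM h1
  by_cases h2 : z ∈ interior M
  · left
    by_contra hne
    refine h.not_sharp_K z (h.hK.mem_frontier_iff.2 ⟨hzK, h1⟩) hz ?_ hne
      (hs.of_inter h.hK hzK h2)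
    refine lt_of_pow_lt_pow_left₀ 2 hr.le ?_
    have := h.norm_sub_sq_le hzK hzM hz
    linarith [h.ε_lt, h.ε_pos]
  right
  have h3 : trip q p z = 0 := by
    rcases lt_trichotomy (trip q p z) 0 with h3 | h3 | h3
    · exact absurd (h.mem_interior_M hzK h3) h2
    · exact h3
    · obtain ⟨W, hWK, -, hW⟩ := h.hullM
      exact absurd (Lens.mem_interior_of_hull h.hK h.qK h.pK hWK (hW z hzM h3) h3.ne') h1
  obtain ⟨X, -, hX0, -, hX⟩ := h.hullK
  obtain ⟨α, β, γ, k1, k2, k3, e⟩ := hX z hzK h3.le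
  have hγ : γ = 0 := by
    rw [e, trip_add, trip_add, trip_smul, trip_smul, trip_smul, trip_self_left,
      trip_self_right, mul_zero, mul_zero, zero_add, zero_add] at h3
    exact (mul_eq_zero.1 h3).resolve_right hX0.ne
  rw [hγ, zero_smul, add_zero] at e
  rcases k1.eq_or_lt with k1 | k1
  · left
    rw [← k1, zero_smul, zero_add] at e
    have := congrArg (fun y => ‖y‖) e
    simp only [norm_smul, hz, h.np, mul_one, Real.norm_of_nonneg k2] at this
    rw [e, ← this, one_smul]
  rcases k2.eq_or_lt with k2 | k2
  · right
    rw [← k2, zero_smul, add_zero] at e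
    have := congrArg (fun y => ‖y‖) e
    simp only [norm_smul, hz, h.nq, mul_one, Real.norm_of_nonneg k1.le] at this
    rw [e, ← this, one_smul]
  · exact absurd (e ▸ h.chord α β k1 k2) h1

/-- A symmetry permutes the vertices. They form a scalene triangle, so it fixes them. -/
lemma eq_refl (h : CornerLens K M x p q c r ε) {g : E3 ≃ₗᵢ[ℝ] E3} (hg : g '' (K ∩ M) = K ∩ M) :
    g = LinearIsometryEquiv.refl ℝ E3 := by
  have xM : x ∈ M := interior_subset (h.mem_interior_M h.xK h.neg)
  have key : ∀ z ∈ K ∩ M, ‖z‖ = 1 → Sharp c (K ∩ M) z → g z = x ∨ g z = p ∨ g z = q := by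
    intro z hz hn hs
    have hgz : g z ∈ K ∩ M := hg ▸ ⟨z, hz, rfl⟩
    exact h.eq_vertex hgz.1 hgz.2 (by rw [g.norm_map, hn]) (hs.map hg)
  have sx : Sharp c (K ∩ M) x := by
    obtain ⟨n₁, n₂, h1, h2⟩ := h.sharp_x
    exact ⟨n₁, n₂, fun y hy => h1 y hy.1, h2⟩
  have kx := key x ⟨h.xK, xM⟩ h.nx sx
  have kp := key p ⟨h.pK, h.pM⟩ h.np h.sharp_p
  have kq := key q ⟨h.qK, h.qM⟩ h.nq h.sharp_q
  have d1 := g.dist_map x p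
  have d2 := g.dist_map x q
  have n1 := h.xp_ne_xq
  have n2 := h.pq_ne_xp
  have n3 := h.pq_ne_xq
  have hx0 : p ≠ x := by rintro rfl; simpa using h.neg
  have hx1 : q ≠ x := by rintro rfl; simpa using h.neg
  have e1 : dist p x = dist x p := dist_comm _ _
  have e2 : dist q x = dist x q := dist_comm _ _
  have e3 : dist q p = dist p q := dist_comm _ _
  have p1 : dist x p ≠ 0 := (dist_pos.2 hx0.symm).ne'
  have p2 : dist x q ≠ 0 := (dist_pos.2 hx1.symm).ne'
  have all : g x = x ∧ g p = p ∧ g q = q := by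
    rcases kx with kx | kx | kx <;> rcases kp with kp | kp | kp <;>
      rcases kq with kq | kq | kq <;> rw [kx, kp] at d1 <;> rw [kx, kq] at d2 <;>
      (try simp only [dist_self, e1, e2, e3] at d1 d2) <;>
      first
        | exact ⟨kx, kp, kq⟩
        | exact absurd d1 (by first | assumption | exact Ne.symm (by assumption))
        | exact absurd d2 (by first | assumption | exact Ne.symm (by assumption))
  obtain ⟨gx, gp, gq⟩ := all
  ext1 z
  have e : ∀ y, g y = y → ⟪y, g z⟫ = ⟪y, z⟫ := fun y hy => by
    conv_lhs => rw [← hy]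
    rw [g.inner_map_map]
  exact eq_of_inner_eq h.neg.ne (e q gq) (e p gp) (e x gx)

lemma interior_nonempty (h : CornerLens K M x p q c r ε) : (interior (K ∩ M)).Nonempty := by
  obtain ⟨X, hXM, -⟩ := h.hullK
  have hc := h.chord 1 1 one_pos one_pos
  rw [← interior_interior] at hc
  obtain ⟨t, ht, hm⟩ := Body.exists_add_smul_mem hc X
  rw [interior_inter]
  refine ⟨_, hm, ?_⟩
  rw [add_comm, one_smul, one_smul]
  exact h.hM.add_mem_interior (h.hM.smul_mem_interior hXM ht) (h.hM.add q h.qM p h.pM)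

/-- The corner lens contradicts the symmetry of all small intersections. -/
lemma not_smallSym {L : Set E3} {φ : E3 ≃ₗᵢ[ℝ] E3} (h : CornerLens K (φ '' L) x p q c r ε)
    (hφ : OrientationPreserving φ) {c' : ℝ} (hc' : c' ≤ 1 - 4 * ε)
    (hS : ∀ φ : E3 ≃ₗᵢ[ℝ] E3, OrientationPreserving φ → (interior (K ∩ φ '' L)).Nonempty →
      (∀ z ∈ K ∩ φ '' L, ∀ z' ∈ K ∩ φ '' L, ‖z‖ = 1 → ‖z'‖ = 1 → c' ≤ ⟪z, z'⟫) →
      ∃ g : E3 ≃ₗᵢ[ℝ] E3, g ≠ LinearIsometryEquiv.refl ℝ E3 ∧ g '' (K ∩ φ '' L) = K ∩ φ '' L) :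
    False := by
  obtain ⟨g, hg, hgK⟩ := hS φ hφ h.interior_nonempty fun z hz z' hz' n n' => by
    have := h.norm_sub_sq_le' hz.1 hz.2 n hz'.1 hz'.2 n'
    rw [norm_sub_sq_real, n, n'] at this
    linarith
  exact hg (h.eq_refl hgK)

end CornerLens

end SphericalPlane

namespace SphericalPlane

/-! ### Cutting off a corner -/

/-- The pairs `(u, v)` approach the corner `a` from its two sides in such a way that the chords of
the graph of `f` over `[u, v]` tend to a line that lies strictly between the one-sided tangents. -/
structure CornerFilter (f : ℝ → ℝ) (a s₀ : ℝ) (l : Filter (ℝ × ℝ)) : Prop where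
  convex : ConvexOn ℝ univ f
  left : Tendsto Prod.fst l (𝓝[<] a)
  right : Tendsto Prod.snd l (𝓝[>] a)
  slope : Tendsto (fun w => slp f w.1 w.2) l (𝓝 s₀)
  lt_left : dL f a < s₀
  lt_right : s₀ < dR f a

/-- The factor between the cross product of the ends of a chord and the normal `nrm` of the chord.
It is of the order of the length of the chord. -/
noncomputable def coef (f : ℝ → ℝ) (u v : ℝ) : ℝ := (v - u) / (‖vec f u‖ * ‖vec f v‖)

/-- The second basis vector, along which charts point into the cone. -/
noncomputable def up : E3 := !₂[0, 1, 0]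

@[simp] lemma inner_nrm_up (f : ℝ → ℝ) (u t : ℝ) : ⟪nrm f u t, up⟫ = 1 := by
  rw [inner_nrm]; simp [up]

lemma norm_up : ‖up‖ = 1 := by
  have : ‖up‖ ^ 2 = 1 := by
    rw [← real_inner_self_eq_norm_sq, inner_coord]; simp [up]
  nlinarith [norm_nonneg up]

section chord

variable {K : Set E3} {f : ℝ → ℝ} {a u v : ℝ}

/-- The graph stays strictly below a chord that passes over a corner. -/
lemma lt_chord_of_corner (hf : ConvexOn ℝ univ f) (ha : dL f a < dR f a) (hu : u < a) (hv : a < v)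
    {y : ℝ} (hy : y ∈ Ioo u v) : f y < f u + slp f u v * (y - u) := by
  have huv := hu.trans hv
  have hneg : ∀ z ∈ Ioo u v, f z = f u + slp f u v * (z - u) → False := by
    intro z hz he
    have h0 : trip (pt f u) (pt f v) (pt f z) = 0 := by
      rw [trip_pt huv, inner_nrm_pt_eq, he]; ring
    have h1 := eq_chord_of_touch hf hz h0 ⟨hu, hv⟩
    have h2 : dR f a ≤ slp f a v := (subG_dR hf a).le_slope hv
    have h3 : slp f u a ≤ dL f a := (subG_dL hf a).slope_le hu
    have h4 := slp_mul (f := f) hu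
    have h5 := slp_mul (f := f) hv
    have h6 := slp_mul (f := f) huv
    have e1 : slp f u a = slp f u v := by
      have : (slp f u a - slp f u v) * (a - u) = 0 := by linarith
      exact sub_eq_zero.1 ((mul_eq_zero.1 this).resolve_right (by linarith))
    have e2 : slp f a v = slp f u v := by
      have : (slp f a v - slp f u v) * (v - a) = 0 := by linarith
      exact sub_eq_zero.1 ((mul_eq_zero.1 this).resolve_right (by linarith))
    linarith
  refine lt_of_le_of_ne ?_ fun he => hneg y hy he
  have := trip_nonpos_of_mem_Ioo hf hy
  rw [trip_pt huv, inner_nrm_pt_eq] at this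
  by_contra hcon
  push Not at hcon
  have := mul_pos (chord_coeff_pos (f := f) huv)
    (mul_pos (inv_pos.2 (norm_vec_pos f y)) (sub_pos.2 hcon))
  linarith

/-- Vectors over a chord that passes over a corner are interior. -/
lemma Chart.mem_interior_of_chord (hf : Chart K f) (ha : dL f a < dR f a) (hu : u < a) (hv : a < v)
    {z : E3} (h2 : 0 < z 2) (h0 : u * z 2 < z 0) (h0' : z 0 < v * z 2)
    (hz : 0 ≤ ⟪nrm f u (slp f u v), z⟫) : z ∈ interior K := by
  rw [hf.mem_interior_iff h2]
  have h1 := lt_chord_of_corner hf.convex ha hu hv (y := z 0 / z 2)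
    ⟨by rwa [lt_div_iff₀ h2], by rwa [div_lt_iff₀ h2]⟩
  refine h1.trans_le ?_
  rw [inner_nrm] at hz
  rw [le_div_iff₀ h2]
  have e2 : z 0 / z 2 * z 2 = z 0 := div_mul_cancel₀ _ h2.ne'
  have : (f u + slp f u v * (z 0 / z 2 - u)) * z 2 =
      f u * z 2 + slp f u v * (z 0 / z 2 * z 2) - slp f u v * u * z 2 := by ring
  rw [this, e2]
  linarith

lemma Chart.chord_mem_interior (hf : Chart K f) (ha : dL f a < dR f a) (hu : u < a) (hv : a < v)
    {α β : ℝ} (hα : 0 < α) (hβ : 0 < β) : α • pt f u + β • pt f v ∈ interior K := by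
  have huv := hu.trans hv
  have hP := norm_vec_pos f u
  have hQ := norm_vec_pos f v
  refine hf.mem_interior_of_chord ha hu hv ?_ ?_ ?_ ?_
  · have h1 := pt_two_pos f u
    have h2 := pt_two_pos f v
    simp only [PiLp.add_apply, PiLp.smul_apply, smul_eq_mul]
    positivity
  · simp [pt]
    have : 0 < β * (‖vec f v‖⁻¹ * (v - u)) := by
      have := sub_pos.2 huv
      positivity
    linarith
  · simp [pt]
    have : 0 < α * (‖vec f u‖⁻¹ * (v - u)) := by
      have := sub_pos.2 huv
      positivity
    linarith
  · rw [inner_add_right, inner_smul_right, inner_smul_right, inner_nrm_pt, ← nrm_slp huv,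
      inner_nrm_pt]
    simp

end chord

lemma eventually_near {ι : Type*} {l : Filter ι} {F : ι → E3} {x y : E3} {k : ℝ} (hk : 0 < k)
    (hx : ‖x‖ = 1) (hF : Tendsto F l (𝓝 y)) (hy : y = k • x) {ε : ℝ} (hε : 0 < ε) :
    ∀ᶠ i in l, (1 - ε) * ‖F i‖ ≤ ⟪x, F i⟫ := by
  have h1 : Tendsto (fun i => ⟪x, F i⟫ - (1 - ε) * ‖F i‖) l (𝓝 (⟪x, y⟫ - (1 - ε) * ‖y‖)) :=
    (tendsto_const_nhds.inner hF).sub (hF.norm.const_mul _)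
  have h2 : 0 < ⟪x, y⟫ - (1 - ε) * ‖y‖ := by
    rw [hy, inner_smul_right, real_inner_self_eq_norm_sq, norm_smul, hx,
      Real.norm_of_nonneg hk.le]
    nlinarith [mul_pos hk hε]
  filter_upwards [h1.eventually (lt_mem_nhds h2)] with i hi
  linarith

namespace CornerFilter

variable {K : Set E3} {f : ℝ → ℝ} {a s₀ : ℝ} {l : Filter (ℝ × ℝ)}

lemma corner (hl : CornerFilter f a s₀ l) : dL f a < dR f a := hl.lt_left.trans hl.lt_right

lemma fst (hl : CornerFilter f a s₀ l) : Tendsto Prod.fst l (𝓝 a) :=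
  hl.left.mono_right nhdsWithin_le_nhds

lemma snd (hl : CornerFilter f a s₀ l) : Tendsto Prod.snd l (𝓝 a) :=
  hl.right.mono_right nhdsWithin_le_nhds

lemma eventually_lt (hl : CornerFilter f a s₀ l) : ∀ᶠ w in l, w.1 < a ∧ a < w.2 :=
  (hl.left.eventually self_mem_nhdsWithin).and (hl.right.eventually self_mem_nhdsWithin)

lemma vec_fst (hl : CornerFilter f a s₀ l) : Tendsto (fun w => vec f w.1) l (𝓝 (vec f a)) :=
  ((continuous_vec (continuous_of_convex hl.convex)).tendsto a).comp hl.fst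

lemma vec_snd (hl : CornerFilter f a s₀ l) : Tendsto (fun w => vec f w.2) l (𝓝 (vec f a)) :=
  ((continuous_vec (continuous_of_convex hl.convex)).tendsto a).comp hl.snd

lemma pt_fst (hl : CornerFilter f a s₀ l) : Tendsto (fun w => pt f w.1) l (𝓝 (pt f a)) :=
  ((continuous_pt (continuous_of_convex hl.convex)).tendsto a).comp hl.fst

lemma pt_snd (hl : CornerFilter f a s₀ l) : Tendsto (fun w => pt f w.2) l (𝓝 (pt f a)) :=
  ((continuous_pt (continuous_of_convex hl.convex)).tendsto a).comp hl.snd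

lemma nrm_slp (hl : CornerFilter f a s₀ l) :
    Tendsto (fun w => nrm f w.1 (slp f w.1 w.2)) l (𝓝 (nrm f a s₀)) :=
  ((continuous_nrm (continuous_of_convex hl.convex)).tendsto (a, s₀)).comp
    (hl.fst.prodMk_nhds hl.slope)

lemma coef_tendsto (hl : CornerFilter f a s₀ l) : Tendsto (fun w => coef f w.1 w.2) l (𝓝 0) := by
  have h0 := (norm_vec_pos f a).ne'
  have := (hl.snd.sub hl.fst).div (hl.vec_fst.norm.mul hl.vec_snd.norm) (mul_ne_zero h0 h0)
  simp only [sub_self, zero_div] at this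
  exact this

lemma low_tendsto (hl : CornerFilter f a s₀ l) (A : ℝ) :
    Tendsto (fun w => pt f w.1 + pt f w.2 - (A * coef f w.1 w.2) • up) l
      (𝓝 ((2 : ℝ) • pt f a)) := by
  have := (hl.pt_fst.add hl.pt_snd).sub ((hl.coef_tendsto.const_mul A).smul_const up)
  simpa [two_smul] using this

lemma apex_tendsto (hl : CornerFilter f a s₀ l) (η : ℝ) :
    Tendsto (fun w => apex η (pt f w.2) (pt f w.1)) l (𝓝 ((2 : ℝ) • pt f a)) := by
  have h1 := (continuous_cr.tendsto (pt f a, pt f a)).comp (hl.pt_snd.prodMk_nhds hl.pt_fst)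
  have h2 : cr (pt f a) (pt f a) = 0 := by apply ext_coord <;> simp <;> ring
  rw [h2] at h1
  have := (hl.pt_snd.add hl.pt_fst).sub (h1.const_smul η)
  simpa [two_smul, apex] using this

lemma eventually_norm_le (hl : CornerFilter f a s₀ l) :
    ∀ᶠ w in l, ‖nrm f w.1 (slp f w.1 w.2)‖ ≤ ‖nrm f a s₀‖ + 1 := by
  filter_upwards [hl.nrm_slp.norm.eventually (gt_mem_nhds (lt_add_one _))] with w hw using hw.le

/-- The piece of `K` that a short chord cuts off at a corner lies in a triangle of proportional
height. -/
lemma eventually_mem_hull (hl : CornerFilter f a s₀ l) (hK : Body K) (hf : Chart K f) {A : ℝ}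
    (hA : (dR f a - dL f a + 1) * (‖vec f a‖ + 1) ≤ A) :
    ∀ᶠ w in l, ∀ z ∈ K, trip (pt f w.1) (pt f w.2) z ≤ 0 →
      z ∈ hull (pt f w.1) (pt f w.2) (pt f w.1 + pt f w.2 - (A * coef f w.1 w.2) • up) := by
  have hc := hl.corner
  have hA0 : 0 < A := lt_of_lt_of_le (by have := norm_nonneg (vec f a); nlinarith) hA
  filter_upwards [hl.eventually_lt, hl.left.eventually (eventually_subG_left hl.convex a one_pos),
    hl.right.eventually (eventually_subG_right hl.convex a one_pos),
    hl.slope.eventually (lt_mem_nhds hl.lt_left), hl.slope.eventually (gt_mem_nhds hl.lt_right),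
    hl.vec_fst.norm.eventually (gt_mem_nhds (lt_add_one _)),
    hl.vec_snd.norm.eventually (gt_mem_nhds (lt_add_one _))] with w hw h1 h2 h3 h4 h5 h6 z hz hneg
  obtain ⟨u, v⟩ := w
  simp only at *
  have huv := hw.1.trans hw.2
  have hP := norm_vec_pos f u
  have hQ := norm_vec_pos f v
  have hs := subG_dL hf.convex u
  have ht := subG_dR hf.convex v
  have h1' := h1 _ hs
  have h2' := h2 _ ht
  have hvu : 0 < v - u := by linarith
  have hco : 0 < coef f u v := chord_coeff_pos huv
  have hve := norm_nonneg (vec f a)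
  refine mem_hull_of_supports (Na := nrm f u (dL f u)) (Nb := nrm f v (dR f v)) ?_
    (inner_nrm_pt _ _ _)
    ?_ ?_ (inner_nrm_pt _ _ _) ?_ ?_ hneg (hf.nrm_nonneg hK hs hz) (hf.nrm_nonneg hK ht hz)
  · rw [trip_pt huv, inner_sub_right, inner_add_right, inner_nrm_pt, ← SphericalPlane.nrm_slp huv,
      inner_nrm_pt, inner_smul_right, inner_nrm_up]
    have := mul_pos (chord_coeff_pos (f := f) huv) (mul_pos hA0 hco)
    linarith
  · rw [inner_nrm_slp_pt huv]
    exact mul_pos (by positivity) (by linarith)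
  · rw [inner_sub_right, inner_add_right, inner_nrm_pt, inner_nrm_slp_pt huv, inner_smul_right,
      inner_nrm_up]
    have e : A * coef f u v = (v - u) / ‖vec f v‖ * (A / ‖vec f u‖) := by
      rw [coef]; field_simp
    have : slp f u v - dL f u ≤ A / ‖vec f u‖ := by
      rw [le_div_iff₀ hP]
      refine le_trans ?_ hA
      exact mul_le_mul (by linarith) h5.le hP.le (by linarith)
    have := mul_le_mul_of_nonneg_left this (by positivity : 0 ≤ (v - u) / ‖vec f v‖)
    linarith
  · rw [inner_nrm_slp_pt' huv]
    exact mul_pos (by positivity) (by linarith)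
  · rw [inner_sub_right, inner_add_right, inner_nrm_pt, inner_nrm_slp_pt' huv, inner_smul_right,
      inner_nrm_up]
    have e : A * coef f u v = (v - u) / ‖vec f u‖ * (A / ‖vec f v‖) := by
      rw [coef]; field_simp
    have : dR f v - slp f u v ≤ A / ‖vec f v‖ := by
      rw [le_div_iff₀ hQ]
      refine le_trans ?_ hA
      exact mul_le_mul (by linarith) h6.le hQ.le (by linarith)
    have := mul_le_mul_of_nonneg_left this (by positivity : 0 ≤ (v - u) / ‖vec f u‖)
    linarith

/-- A flat triangle over a short chord at a corner lies in `K`. -/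
lemma eventually_apex_mem (hl : CornerFilter f a s₀ l) (hf : Chart K f) {η : ℝ} (hη : 0 < η)
    (hη' : η * ((|a| + 2) * (‖nrm f a s₀‖ + 1)) < 1) :
    ∀ᶠ w in l, apex η (pt f w.2) (pt f w.1) ∈ interior K := by
  have hap2 : ∀ᶠ w in l, 0 < apex η (pt f w.2) (pt f w.1) 2 := by
    have h1 : Continuous fun z : E3 => z 2 := by fun_prop
    refine ((h1.tendsto _).comp (hl.apex_tendsto η)).eventually (lt_mem_nhds ?_)
    have := pt_two_pos f a
    simpa using this
  have habs : ∀ y, Tendsto y l (𝓝 a) → ∀ᶠ w in l, |y w| < |a| + 1 := fun y hy =>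
    hy.abs.eventually (gt_mem_nhds (lt_add_one _))
  filter_upwards [hl.eventually_lt, hap2, hl.eventually_norm_le, habs _ hl.fst, habs _ hl.snd]
    with w hw h2 hY h3 h4
  obtain ⟨u, v⟩ := w
  simp only at *
  have huv := hw.1.trans hw.2
  have hP := norm_vec_pos f u
  have hQ := norm_vec_pos f v
  have hvu : 0 < v - u := by linarith
  have hco : 0 < coef f u v := chord_coeff_pos huv
  set y := nrm f u (slp f u v) with hy
  have hap : apex η (pt f v) (pt f u) = pt f v + pt f u + (η * coef f u v) • y := by
    rw [apex, cr_swap, cr_pt huv, ← hy, coef]; module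
  have ycoord : ∀ t, |t| < |a| + 1 → |y 0 - t * y 2| ≤ (|a| + 2) * ‖y‖ := by
    intro t ht
    have k0 := PiLp.norm_apply_le y 0
    have k2 := PiLp.norm_apply_le y 2
    rw [Real.norm_eq_abs] at k0 k2
    calc |y 0 - t * y 2| ≤ |y 0| + |t * y 2| := abs_sub _ _
      _ = |y 0| + |t| * |y 2| := by rw [abs_mul]
      _ ≤ ‖y‖ + (|a| + 1) * ‖y‖ := by gcongr
      _ = _ := by ring
  have ybound : ∀ t, |t| < |a| + 1 → η * |y 0 - t * y 2| < 1 := fun t ht =>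
    lt_of_le_of_lt (mul_le_mul_of_nonneg_left ((ycoord t ht).trans (by gcongr)) hη.le) hη'
  have hn1 : ∀ t, 1 ≤ ‖vec f t‖ := fun t => by
    have := norm_vec_sq f t
    nlinarith [norm_nonneg (vec f t), sq_nonneg t, sq_nonneg (f t)]
  refine hf.mem_interior_of_chord hl.corner hw.1 hw.2 h2 ?_ ?_ ?_
  · have k := neg_abs_le (y 0 - u * y 2)
    have e : apex η (pt f v) (pt f u) 0 - u * apex η (pt f v) (pt f u) 2 =
        coef f u v * (‖vec f u‖ + η * (y 0 - u * y 2)) := by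
      rw [hap]; simp [pt, coef]; field_simp; ring
    have := mul_pos hco (show 0 < ‖vec f u‖ + η * (y 0 - u * y 2) by
      nlinarith [ybound u h3, hn1 u])
    linarith
  · have k := le_abs_self (y 0 - v * y 2)
    have e : v * apex η (pt f v) (pt f u) 2 - apex η (pt f v) (pt f u) 0 =
        coef f u v * (‖vec f v‖ - η * (y 0 - v * y 2)) := by
      rw [hap]; simp [pt, coef]; field_simp; ring
    have := mul_pos hco (show 0 < ‖vec f v‖ - η * (y 0 - v * y 2) by
      nlinarith [ybound v h4, hn1 v])
    linarith
  · rw [hap, inner_add_right, inner_add_right, inner_smul_right, inner_nrm_pt, hy,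
      ← SphericalPlane.nrm_slp huv, inner_nrm_pt]
    have := @real_inner_self_nonneg _ _ _ (nrm f v (slp f u v))
    positivity

end CornerFilter

end SphericalPlane

namespace SphericalPlane

/-- The one-sided tangent vectors of the curve `pt f` exist and do not vanish. -/
lemma exists_hasDerivWithinAt_pt {f : ℝ → ℝ} {a d : ℝ} {S : Set ℝ} (hf : HasDerivWithinAt f d S a)
    (hS : UniqueDiffWithinAt ℝ S a) : ∃ T : E3, T ≠ 0 ∧ HasDerivWithinAt (pt f) T S a := by
  have hv : HasDerivWithinAt (vec f) ((1 : ℝ) • (!₂[1, 0, 0] : E3) + d • up) S a := by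
    have h1 := (((hasDerivWithinAt_id a S).smul_const (!₂[1, 0, 0] : E3)).add
      (hf.smul_const up)).add_const (!₂[0, 0, 1] : E3)
    refine h1.congr (fun u _ => ?_) ?_ <;> apply ext_coord <;> simp [up]
  have h0 : vec f a ≠ 0 := norm_pos_iff.1 (norm_vec_pos f a)
  have hG : DifferentiableAt ℝ (fun z : E3 => ‖z‖⁻¹ • z) (vec f a) :=
    ((differentiableAt_id.norm ℝ h0).inv (norm_vec_pos f a).ne').smul differentiableAt_id
  have hT := hG.hasFDerivAt.comp_hasDerivWithinAt a hv
  set T := fderiv ℝ (fun z : E3 => ‖z‖⁻¹ • z) (vec f a) ((1 : ℝ) • (!₂[1, 0, 0] : E3) + d • up)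
  have hT' : HasDerivWithinAt (pt f) T S a := hT
  refine ⟨T, fun hT0 => ?_, hT'⟩
  -- the first coordinate of `pt f u` is `u` times the last one
  rw [hT0] at hT'
  have hc : ∀ i : Fin 3, HasDerivWithinAt (fun u => pt f u i) 0 S a := fun i => by
    have := (EuclideanSpace.proj i : E3 →L[ℝ] ℝ).hasFDerivAt.comp_hasDerivWithinAt a hT'
    rw [map_zero] at this
    exact this
  have h2 := (hasDerivWithinAt_id a S).mul (hc 2)
  have h3 : (fun u => pt f u 0) = fun u => id u * pt f u 2 := by
    funext u; simp [pt]; ring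
  have h4 := hc 0
  rw [h3] at h4
  have := hS.eq_deriv S h4 h2
  simp at this
  exact (pt_two_pos f a).ne this

/-- At a corner there are approaching pairs such that the corner and the two boundary points
form a scalene triangle. -/
lemma exists_cornerFilter {f : ℝ → ℝ} (hf : ConvexOn ℝ univ f) {a : ℝ} (ha : dL f a < dR f a) :
    ∃ (s₀ : ℝ) (l : Filter (ℝ × ℝ)), l.NeBot ∧ CornerFilter f a s₀ l ∧ ∀ᶠ w in l,
      dist (pt f a) (pt f w.2) ≠ dist (pt f a) (pt f w.1) ∧
      dist (pt f w.2) (pt f w.1) ≠ dist (pt f a) (pt f w.2) ∧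
      dist (pt f w.2) (pt f w.1) ≠ dist (pt f a) (pt f w.1) := by
  obtain ⟨T, hT0, hT⟩ := exists_hasDerivWithinAt_pt (hasDerivWithinAt_dR hf a)
    (uniqueDiffWithinAt_Ioi a)
  obtain ⟨S, hS0, hS⟩ := exists_hasDerivWithinAt_pt (hasDerivWithinAt_dL hf a)
    (uniqueDiffWithinAt_Iio a)
  have nT : 0 < ‖T‖ := norm_pos_iff.2 hT0
  have nS : 0 < ‖S‖ := norm_pos_iff.2 hS0
  -- each coincidence of two sides excludes at most one ratio `κ`
  obtain ⟨κ, hκ, hκ'⟩ : ∃ κ ∈ Ioi (0 : ℝ), κ ∉ ({‖T‖ / ‖S‖, -2 * ⟪T, S⟫ / ‖S‖ ^ 2,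
      -‖T‖ ^ 2 / (2 * ⟪T, S⟫)} : Set ℝ) :=
    ((Ioi_infinite (0 : ℝ)).sdiff (toFinite _)).nonempty
  rw [mem_Ioi] at hκ
  simp only [mem_insert_iff, mem_singleton_iff, not_or] at hκ'
  have hu : Tendsto (fun δ : ℝ => a - κ * δ) (𝓝[>] 0) (𝓝[<] a) := by
    refine tendsto_nhdsWithin_iff.2 ⟨?_, ?_⟩
    · have : Continuous fun δ : ℝ => a - κ * δ := by fun_prop
      have := this.tendsto 0
      simp only [mul_zero, sub_zero] at this
      exact this.mono_left nhdsWithin_le_nhds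
    · filter_upwards [self_mem_nhdsWithin] with δ hδ
      have := mul_pos hκ hδ
      simp only [mem_Iio]; linarith
  have hv : Tendsto (fun δ : ℝ => a + δ) (𝓝[>] 0) (𝓝[>] a) := by
    refine tendsto_nhdsWithin_iff.2 ⟨?_, ?_⟩
    · have : Continuous fun δ : ℝ => a + δ := by fun_prop
      have := this.tendsto 0
      simp only [add_zero] at this
      exact this.mono_left nhdsWithin_le_nhds
    · filter_upwards [self_mem_nhdsWithin] with δ hδ
      simpa using hδ
  have slopeR := (hasDerivWithinAt_iff_tendsto_slope.1 (hasDerivWithinAt_dR hf a))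
  have slopeL := (hasDerivWithinAt_iff_tendsto_slope.1 (hasDerivWithinAt_dL hf a))
  have slopeT := (hasDerivWithinAt_iff_tendsto_slope.1 hT)
  have slopeS := (hasDerivWithinAt_iff_tendsto_slope.1 hS)
  rw [sdiff_singleton_eq_self (by simp)] at slopeR slopeL slopeT slopeS
  replace slopeR := slopeR.comp hv
  replace slopeL := slopeL.comp hu
  replace slopeT := slopeT.comp hv
  replace slopeS := (slopeS.comp hu).const_smul (-κ)
  have h1κ : 0 < 1 + κ := by linarith
  have hpos : ∀ᶠ δ : ℝ in 𝓝[>] 0, 0 < δ := self_mem_nhdsWithin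
  have dT : Tendsto (fun δ : ℝ => δ⁻¹ • (pt f (a + δ) - pt f a)) (𝓝[>] 0) (𝓝 T) := by
    refine slopeT.congr' ?_
    filter_upwards with δ
    simp [slope]
  have dS : Tendsto (fun δ : ℝ => δ⁻¹ • (pt f (a - κ * δ) - pt f a)) (𝓝[>] 0) (𝓝 (-κ • S)) := by
    refine slopeS.congr' ?_
    filter_upwards [hpos] with δ hδ
    simp only [slope, Function.comp_apply, vsub_eq_sub, smul_smul]
    congr 1
    rw [sub_sub_cancel_left]
    field_simp
  have dd : ∀ F G : ℝ → E3, ∀ V : E3, Tendsto (fun δ : ℝ => δ⁻¹ • (F δ - G δ)) (𝓝[>] 0) (𝓝 V) →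
      Tendsto (fun δ : ℝ => δ⁻¹ * dist (F δ) (G δ)) (𝓝[>] 0) (𝓝 ‖V‖) := by
    intro F G V h
    refine h.norm.congr' ?_
    filter_upwards [hpos] with δ hδ
    rw [norm_smul, dist_eq_norm, norm_inv, Real.norm_of_nonneg hδ.le]
  have e1 := dd _ _ _ dT
  have e2 := dd _ _ _ dS
  have e3 := dd (fun δ => pt f (a + δ)) (fun δ => pt f (a - κ * δ)) (T - -κ • S)
    ((dT.sub dS).congr fun δ => by module)
  have nsq : ‖T - -κ • S‖ ^ 2 = ‖T‖ ^ 2 + 2 * κ * ⟪T, S⟫ + κ ^ 2 * ‖S‖ ^ 2 := by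
    rw [norm_sub_sq_real, inner_smul_right, norm_smul, Real.norm_eq_abs, mul_pow, sq_abs]; ring
  have n2 : ‖-κ • S‖ = κ * ‖S‖ := by
    rw [norm_smul, norm_neg, Real.norm_of_nonneg hκ.le]
  have ne : ∀ {F G : ℝ → ℝ} {x y : ℝ}, Tendsto (fun δ => δ⁻¹ * F δ) (𝓝[>] 0) (𝓝 x) →
      Tendsto (fun δ => δ⁻¹ * G δ) (𝓝[>] 0) (𝓝 y) → x ≠ y → ∀ᶠ δ in 𝓝[>] (0 : ℝ), F δ ≠ G δ := by
    intro F G x y hF hG hxy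
    have := (hF.sub hG).eventually (isOpen_ne.mem_nhds (sub_ne_zero.2 hxy))
    filter_upwards [this] with δ h0 he
    exact h0 (by simp [he])
  refine ⟨(dR f a + κ * dL f a) / (1 + κ), (𝓝[>] (0 : ℝ)).map fun δ => (a - κ * δ, a + δ),
    inferInstance, ⟨hf, ?_, ?_, ?_, ?_, ?_⟩, ?_⟩
  · rw [tendsto_map'_iff]; exact hu
  · rw [tendsto_map'_iff]; exact hv
  · rw [tendsto_map'_iff]
    have := (slopeR.add (slopeL.const_mul κ)).div_const (1 + κ)
    refine this.congr' ?_
    filter_upwards [hpos] with δ hδ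
    simp only [Function.comp_apply, slope_def_field, slp]
    rw [add_sub_cancel_left, sub_sub_cancel_left, show a + δ - (a - κ * δ) = (1 + κ) * δ by ring]
    field_simp
    ring
  · rw [lt_div_iff₀ h1κ]; nlinarith
  · rw [div_lt_iff₀ h1κ]; nlinarith
  · rw [eventually_map]
    simp only [dist_comm (pt f a)]
    refine (ne e1 e2 ?_).and ((ne e3 e1 ?_).and (ne e3 e2 ?_))
    · rw [n2]
      intro h
      exact hκ'.1 (by rw [h]; field_simp)
    · intro h
      rw [h] at nsq
      refine hκ'.2.1 ?_
      rw [eq_div_iff (by positivity)]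
      have : κ * (κ * ‖S‖ ^ 2 + 2 * ⟪T, S⟫) = 0 := by linarith
      have := (mul_eq_zero.1 this).resolve_left hκ.ne'
      linarith
    · intro h
      rw [h, n2] at nsq
      have h0 : ‖T‖ ^ 2 + 2 * κ * ⟪T, S⟫ = 0 := by linarith
      have h1 : ⟪T, S⟫ ≠ 0 := by
        intro h1
        rw [h1] at h0
        have := pow_pos nT 2
        linarith
      refine hκ'.2.2 ?_
      rw [eq_div_iff (by simpa using h1)]
      linarith

lemma inner_lt_of_not_parallel {n m : E3} (h : ‖m‖ • n ≠ ‖n‖ • m) : ⟪n, m⟫ < ‖n‖ * ‖m‖ :=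
  lt_of_le_of_ne (real_inner_le_norm n m) fun he => h (inner_eq_norm_mul_iff_real.1 he)

lemma inner_nrm_lt {f : ℝ → ℝ} {u t s : ℝ} (h : t ≠ s) :
    ⟪nrm f u t, nrm f u s⟫ < ‖nrm f u t‖ * ‖nrm f u s‖ := by
  refine inner_lt_of_not_parallel fun he => h ?_
  have h1 := congrArg (fun z : E3 => z 1) he
  have h0 := congrArg (fun z : E3 => z 0) he
  simp only [PiLp.smul_apply, smul_eq_mul] at h1 h0
  simp [nrm] at h1 h0
  rw [show ‖(!₂[-s, 1, s * u - f u] : E3)‖ = ‖nrm f u s‖ from rfl,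
    show ‖(!₂[-t, 1, t * u - f u] : E3)‖ = ‖nrm f u t‖ from rfl] at h1 h0
  rw [h1] at h0
  have := one_le_norm_nrm f u t
  exact mul_left_cancel₀ (by linarith) h0

lemma inner_nrm_neg_lt (f : ℝ → ℝ) (u t s : ℝ) :
    ⟪nrm f u t, -nrm f u s⟫ < ‖nrm f u t‖ * ‖nrm f u s‖ := by
  rw [← norm_neg (nrm f u s)]
  refine inner_lt_of_not_parallel fun he => ?_
  have h1 := congrArg (fun z : E3 => z 1) he
  rw [norm_neg] at h1
  simp only [PiLp.smul_apply, smul_eq_mul, PiLp.neg_apply] at h1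
  have e : ∀ s, nrm f u s 1 = 1 := fun s => by simp [nrm]
  rw [e, e] at h1
  have := one_le_norm_nrm f u t
  have := one_le_norm_nrm f u s
  linarith

/-- The secants of a smooth boundary arc and its tangents at both ends become parallel. -/
lemma eventually_nrm_near {h : ℝ → ℝ} (hh : ConvexOn ℝ univ h) {b : ℝ} (hb : dL h b = dR h b)
    {ε : ℝ} (hε : 0 < ε) : ∀ᶠ x in 𝓝[>] b,
      ‖nrm h b (dR h b) - nrm h b (slp h b x)‖ < ε ∧
      ‖nrm h x (dR h x) - nrm h b (slp h b x)‖ < ε := by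
  have hn := continuous_nrm (continuous_of_convex hh)
  have t1 : Tendsto (fun x => dR h x) (𝓝[>] b) (𝓝 (dR h b)) := by
    refine Metric.tendsto_nhds.2 fun ε hε => nhdsWithin_le_nhds ?_
    filter_upwards [eventually_subG hh hb hε] with x hx using hx _ (subG_dR hh x)
  have t2 : Tendsto (fun x => slp h b x) (𝓝[>] b) (𝓝 (dR h b)) := by
    refine tendsto_of_tendsto_of_tendsto_of_le_of_le' tendsto_const_nhds t1 ?_ ?_
    · filter_upwards [self_mem_nhdsWithin] with x hx using (subG_dR hh b).le_slope hx
    · filter_upwards [self_mem_nhdsWithin] with x hx using (subG_dR hh x).slope_le hx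
  have t3 : Tendsto (fun x : ℝ => x) (𝓝[>] b) (𝓝 b) := nhdsWithin_le_nhds
  have n1 := (hn.tendsto (b, dR h b)).comp (tendsto_const_nhds.prodMk_nhds t2)
  have n2 := (hn.tendsto (b, dR h b)).comp (t3.prodMk_nhds t1)
  have d1 := (tendsto_const_nhds.sub n1 : Tendsto (fun x => nrm h b (dR h b) - _) _ _).norm
  have d2 := (n2.sub n1).norm
  rw [sub_self, norm_zero] at d1 d2
  exact (d1.eventually (gt_mem_nhds hε)).and (d2.eventually (gt_mem_nhds hε))

/-- A perturbation of a supporting normal that encloses a definite angle with another one. -/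
lemma inner_lt_of_perturb {n y e : E3} {k c₁ c ε : ℝ} (hk : 0 < k) (hn : n ≠ 0) (h1 : 1 ≤ k * ‖y‖)
    (he : ‖e‖ ≤ ε) (hny : ⟪n, -y⟫ ≤ c₁ * (‖n‖ * ‖y‖)) (hc : c₁ < c) (hc0 : 0 < c)
    (hε : ε * (1 + c) < c - c₁) : ⟪n, e - k • y⟫ < c * (‖n‖ * ‖e - k • y‖) := by
  have hn' := norm_pos_iff.2 hn
  have h2 : ⟪n, e - k • y⟫ = ⟪n, e⟫ + k * ⟪n, -y⟫ := by
    rw [inner_sub_right, inner_smul_right, inner_neg_right]; ring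
  have h3 : ⟪n, e⟫ ≤ ‖n‖ * ε :=
    (real_inner_le_norm n e).trans (mul_le_mul_of_nonneg_left he hn'.le)
  have h4 : k * ‖y‖ - ε ≤ ‖e - k • y‖ := by
    have := norm_sub_norm_le (k • y) e
    rw [norm_smul, Real.norm_of_nonneg hk.le, norm_sub_rev] at this
    linarith
  have h5 : k * ⟪n, -y⟫ ≤ k * (c₁ * (‖n‖ * ‖y‖)) := mul_le_mul_of_nonneg_left hny hk.le
  have h6 : ε + c₁ * (k * ‖y‖) < c * (k * ‖y‖ - ε) := by nlinarith
  have h7 : c * (k * ‖y‖ - ε) ≤ c * ‖e - k • y‖ := mul_le_mul_of_nonneg_left h4 hc0.le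
  rw [h2]
  nlinarith [mul_lt_mul_of_pos_left (h6.trans_le h7) hn']

end SphericalPlane

namespace SphericalPlane

lemma eventually_lt_mul {i k : ℝ} (h : i < k) : ∀ᶠ c in 𝓝[<] (1 : ℝ), i < c * k := by
  have hc : Continuous fun c : ℝ => c * k := by fun_prop
  exact nhdsWithin_le_nhds ((hc.tendsto 1).eventually (lt_mem_nhds (by rwa [one_mul])))

/-- Near a corner, the angles between the supporting planes at the ends of a short chord and the
plane of the chord stay away from `π`. -/
lemma CornerFilter.eventually_angle {f : ℝ → ℝ} {a s₀ : ℝ} {l : Filter (ℝ × ℝ)}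
    (hl : CornerFilter f a s₀ l) {c : ℝ}
    (h1 : ⟪nrm f a (dR f a), -nrm f a s₀⟫ < c * (‖nrm f a (dR f a)‖ * ‖nrm f a s₀‖))
    (h2 : ⟪nrm f a (dL f a), -nrm f a s₀⟫ < c * (‖nrm f a (dL f a)‖ * ‖nrm f a s₀‖)) :
    ∀ᶠ w in l, ⟪nrm f w.2 (dR f w.2), -nrm f w.1 (slp f w.1 w.2)⟫ ≤
        c * (‖nrm f w.2 (dR f w.2)‖ * ‖nrm f w.1 (slp f w.1 w.2)‖) ∧
      ⟪nrm f w.1 (dL f w.1), -nrm f w.1 (slp f w.1 w.2)⟫ ≤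
        c * (‖nrm f w.1 (dL f w.1)‖ * ‖nrm f w.1 (slp f w.1 w.2)‖) := by
  have hn := continuous_nrm (continuous_of_convex hl.convex)
  have tR : Tendsto (fun v => dR f v) (𝓝[>] a) (𝓝 (dR f a)) := by
    refine Metric.tendsto_nhds.2 fun ε hε => ?_
    filter_upwards [eventually_subG_right hl.convex a hε] with x hx
    have := hx _ (subG_dR hl.convex x)
    rw [Real.dist_eq, abs_sub_lt_iff]; constructor <;> linarith
  have tL : Tendsto (fun v => dL f v) (𝓝[<] a) (𝓝 (dL f a)) := by
    refine Metric.tendsto_nhds.2 fun ε hε => ?_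
    filter_upwards [eventually_subG_left hl.convex a hε] with x hx
    have := hx _ (subG_dL hl.convex x)
    rw [Real.dist_eq, abs_sub_lt_iff]; constructor <;> linarith
  have nR := (hn.tendsto (a, dR f a)).comp (hl.snd.prodMk_nhds (tR.comp hl.right))
  have nL := (hn.tendsto (a, dL f a)).comp (hl.fst.prodMk_nhds (tL.comp hl.left))
  have ny := hl.nrm_slp
  have eR := (((nR.norm.mul ny.norm).const_mul c).sub (nR.inner ny.neg)).eventually
    (lt_mem_nhds (sub_pos.2 h1))
  have eL := (((nL.norm.mul ny.norm).const_mul c).sub (nL.inner ny.neg)).eventually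
    (lt_mem_nhds (sub_pos.2 h2))
  filter_upwards [eR, eL] with w h1 h2
  exact ⟨(sub_pos.1 h1).le, (sub_pos.1 h2).le⟩

/-- A corner is isolated among the boundary points with a given bound for the sharpness. -/
lemma Chart.exists_not_sharp_near_corner {K : Set E3} {f : ℝ → ℝ} (hK : Body K) (hf : Chart K f)
    (a : ℝ) {c : ℝ} (hc : c < 1) : ∃ r > 0, ∀ z ∈ frontier K, ‖z‖ = 1 → ‖z - pt f a‖ < r →
      z ≠ pt f a → ¬ Sharp c K z := by
  refine hf.frontier_near hK (P := fun z => z ≠ pt f a → ¬ Sharp c K z) ?_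
  have h1 := eventually_nhdsWithin_iff.1 (hf.eventually_not_sharp_right a hc)
  have h2 := eventually_nhdsWithin_iff.1 (hf.eventually_not_sharp_left a hc)
  filter_upwards [h1, h2] with u k1 k2 hne
  rcases lt_trichotomy u a with h | h | h
  · exact k2 h
  · exact absurd (by rw [h]) hne
  · exact k1 h

lemma norm_sub_le_of_inner_pos {p q : E3} (hp : ‖p‖ = 1) (hq : ‖q‖ = 1) (hpq : 0 < ⟪q, p⟫) :
    ‖q - p‖ ≤ 2 * ‖cr q p‖ := by
  have h1 := norm_cr_sq q p
  have h2 : ‖q - p‖ ^ 2 = 2 - 2 * ⟪q, p⟫ := by rw [norm_sub_sq_real, hp, hq]; ring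
  rw [hq, hp] at h1
  have h5 : ⟪q, p⟫ ≤ 1 := by
    have := real_inner_le_norm q p
    rwa [hq, hp, one_mul] at this
  have h4 : ‖q - p‖ ^ 2 ≤ (2 * ‖cr q p‖) ^ 2 := by rw [mul_pow, h1, h2]; nlinarith
  exact (pow_le_pow_iff_left₀ (norm_nonneg _)
    (mul_nonneg zero_le_two (norm_nonneg (cr q p))) two_ne_zero).1 h4

/-- The vector from the end `p` of a chord to a point below the chord, at a depth proportional to
the length of the chord, makes a definite angle with the chord. -/
lemma lt_inner_of_below {p q y e : E3} {A t Y k ε : ℝ} (hA : 0 < A) (hε0 : 0 ≤ ε)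
    (hε : 2 * ε * (Y + A / 2) < A / (2 * Y)) (hY : 0 < Y) (hp : ‖p‖ = 1) (hq : ‖q‖ = 1)
    (hpq : 0 < ⟪q, p⟫) (ht : 0 < t) (hcr : cr q p = t • y) (hyY : ‖y‖ ≤ Y) (hyup : ⟪y, up⟫ = 1)
    (hyp : ⟪y, p⟫ = 0) (hyq : ⟪y, q⟫ = 0) (hk : 0 < k) (hky : 1 ≤ k * ‖y‖) (he : ‖e‖ ≤ ε) :
    ε * ‖(1 / 2 : ℝ) • (q - p) - (A * t / 2) • up‖ <
      ⟪e - k • y, (1 / 2 : ℝ) • (q - p) - (A * t / 2) • up⟫ := by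
  set ω := (1 / 2 : ℝ) • (q - p) - (A * t / 2) • up with hω
  have hyω : ⟪y, ω⟫ = -(A * t / 2) := by
    rw [hω, inner_sub_right, inner_smul_right, inner_smul_right, inner_sub_right, hyp, hyq, hyup]
    ring
  have hdist : ‖q - p‖ ≤ 2 * (t * Y) := by
    refine (norm_sub_le_of_inner_pos hp hq hpq).trans ?_
    rw [hcr, norm_smul, Real.norm_of_nonneg ht.le]
    exact mul_le_mul_of_nonneg_left (mul_le_mul_of_nonneg_left hyY ht.le) zero_le_two
  have hωn : ‖ω‖ ≤ t * (Y + A / 2) := by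
    refine (norm_sub_le _ _).trans ?_
    rw [norm_smul, norm_smul, norm_up, Real.norm_of_nonneg (by norm_num : (0 : ℝ) ≤ 1 / 2),
      Real.norm_of_nonneg (by positivity)]
    linarith
  have h1 : -(ε * ‖ω‖) ≤ ⟪e, ω⟫ := by
    have h := neg_le_of_abs_le (abs_real_inner_le_norm e ω)
    have := mul_le_mul_of_nonneg_right he (norm_nonneg ω)
    linarith
  have hkY : 1 / Y ≤ k := by
    rw [div_le_iff₀ hY]
    exact hky.trans (mul_le_mul_of_nonneg_left hyY hk.le)
  have h2 : 2 * ε * ‖ω‖ < k * (A * t / 2) := by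
    calc 2 * ε * ‖ω‖ ≤ 2 * ε * (t * (Y + A / 2)) := by gcongr
      _ = t * (2 * ε * (Y + A / 2)) := by ring
      _ < t * (A / (2 * Y)) := by gcongr
      _ = 1 / Y * (A * t / 2) := by field_simp
      _ ≤ k * (A * t / 2) := by gcongr
  rw [inner_sub_left, inner_smul_left, hyω]
  simp only [conj_trivial]
  linarith

set_option maxHeartbeats 1000000 in
/-- A flat arc of the boundary of `L` can be placed so that it cuts a small asymmetric piece off a
corner of `K`. Hence a cone all of whose small intersections with copies of `L` are symmetric has
no corners. -/
lemma Chart.dL_eq_dR_of_smallSym {K L : Set E3} {f h : ℝ → ℝ} {a b : ℝ} (hK : Body K)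
    (hf : Chart K f) (hL : Body L) (hh : Chart L h) (hb : dL h b = dR h b)
    (hS : SmallSym (· ≠ LinearIsometryEquiv.refl ℝ E3) K L) : dL f a = dR f a := by
  by_contra hne
  have ha : dL f a < dR f a := lt_of_le_of_ne (dL_le_dR hf.convex a) hne
  obtain ⟨c', hc', hS⟩ := hS
  obtain ⟨s₀, l, hlb, hl, hscal⟩ := exists_cornerFilter hf.convex ha
  -- the constants that depend on the corner only
  set Y := ‖nrm f a s₀‖ + 1 with hY
  have hY0 : 0 < Y := by positivity
  set A := (dR f a - dL f a + 1) * (‖vec f a‖ + 1) with hA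
  have hA0 : 0 < A := by
    have := norm_nonneg (vec f a)
    exact mul_pos (by linarith) (by linarith)
  set η := 1 / (2 * ((|a| + 2) * Y)) with hη
  have ha2 : 0 < (|a| + 2) * Y := by positivity
  have hη0 : 0 < η := by positivity
  have hη1 : η * ((|a| + 2) * Y) < 1 := by
    rw [hη, div_mul_eq_mul_div, div_lt_one (by positivity)]; linarith
  obtain ⟨c₁, ⟨hi1, hi2, hi3, hc₁⟩, hc₁1⟩ :=
    ((eventually_lt_mul (inner_nrm_neg_lt f a (dR f a) s₀)).and
      ((eventually_lt_mul (inner_nrm_neg_lt f a (dL f a) s₀)).and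
        ((eventually_lt_mul (inner_nrm_lt (f := f) (u := a) hne)).and
          (nhdsWithin_le_nhds (lt_mem_nhds (show (0 : ℝ) < 1 from one_pos)))))
      |>.and self_mem_nhdsWithin).exists
  set c := (c₁ + 1) / 2 with hc
  have hcc : c₁ < c := by linarith
  have hc1 : c < 1 := by linarith
  have hc0 : 0 < c := hc₁.trans hcc
  obtain ⟨ε₀, hε₀, hε₁, hε₂⟩ : ∃ ε₀ : ℝ, 0 < ε₀ ∧ ε₀ * (1 + c) < c - c₁ ∧
      2 * ε₀ * (Y + A / 2) < A / (2 * Y) := by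
    have h1 : ∀ᶠ e in 𝓝[>] (0 : ℝ), e * (1 + c) < c - c₁ := by
      have hct : Continuous fun e : ℝ => e * (1 + c) := by fun_prop
      exact nhdsWithin_le_nhds ((hct.tendsto 0).eventually (gt_mem_nhds (by linarith)))
    have h2 : ∀ᶠ e in 𝓝[>] (0 : ℝ), 2 * e * (Y + A / 2) < A / (2 * Y) := by
      have hct : Continuous fun e : ℝ => 2 * e * (Y + A / 2) := by fun_prop
      refine nhdsWithin_le_nhds ((hct.tendsto 0).eventually (gt_mem_nhds ?_))
      rw [mul_zero, zero_mul]; positivity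
    obtain ⟨e, ⟨h1, h2⟩, h3⟩ := ((h1.and h2).and self_mem_nhdsWithin).exists
    exact ⟨e, h3, h1, h2⟩
  obtain ⟨r₁, hr₁, hcone⟩ := hh.add_mem_interior_of_cone hb hε₀
  obtain ⟨rM, hrM, hsM⟩ := hh.frontier_near hL (P := fun z => ¬ Sharp c L z)
    (hh.eventually_not_sharp hb hc1)
  obtain ⟨rK, hrK, hsK⟩ := hf.exists_not_sharp_near_corner hK a hc1
  set r := min rK rM with hr
  have hr0 : 0 < r := lt_min hrK hrM
  set ε := min (1 / 2) (min (r ^ 2 / 16) ((1 - c') / 4)) with hε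
  have hε0 : 0 < ε := by
    have : 0 < 1 - c' := by linarith
    positivity
  have hεa : ε ≤ 1 / 2 := min_le_left _ _
  have hεb : ε ≤ r ^ 2 / 16 := (min_le_right _ _).trans (min_le_left _ _)
  have hεc : ε ≤ (1 - c') / 4 := (min_le_right _ _).trans (min_le_right _ _)
  obtain ⟨ρ, hρ, hflat⟩ := hh.eventually_flat hL hb hη0
  have hLx : ∀ᶠ x in 𝓝[>] b, |x - b| < ρ ∧
      ‖nrm h b (dR h b) - nrm h b (slp h b x)‖ < ε₀ ∧
      ‖nrm h x (dR h x) - nrm h b (slp h b x)‖ < ε₀ :=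
    Eventually.and (nhdsWithin_le_nhds (eventually_abs_sub_lt b hρ))
      (eventually_nrm_near hh.convex hb hε₀)
  obtain ⟨x₁, hx₁, hLx⟩ := mem_nhdsGT_iff_exists_Ioo_subset.1 hLx
  rw [mem_Ioi] at hx₁
  have hD : 0 < dist (pt h b) (pt h x₁) := dist_pos.2 fun he => hx₁.ne (pt_injective h he)
  -- the vector from `p` to the point below the chord
  set ω : ℝ × ℝ → E3 := fun w => (1 / 2 : ℝ) • (pt f w.1 - pt f w.2) -
    (A * coef f w.1 w.2 / 2) • up with hω
  have hωt : Tendsto ω l (𝓝 0) := by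
    have := ((hl.pt_fst.sub hl.pt_snd).const_smul (1 / 2 : ℝ)).sub
      (((hl.coef_tendsto.const_mul A).div_const 2).smul_const up)
    simp only [sub_self, smul_zero, mul_zero, zero_div, zero_smul] at this
    exact this
  have hω1 : ∀ᶠ w in l, ‖ω w‖ < r₁ := by
    have := hωt.norm
    rw [norm_zero] at this
    exact this.eventually (gt_mem_nhds hr₁)
  have hd1 : ∀ᶠ w in l, dist (pt f w.2) (pt f w.1) < dist (pt h b) (pt h x₁) := by
    have := hl.pt_snd.dist hl.pt_fst
    rw [dist_self] at this
    exact this.eventually (gt_mem_nhds hD)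
  have hpq : ∀ᶠ w in l, 0 < ⟪pt f w.1, pt f w.2⟫ := by
    refine (hl.pt_fst.inner hl.pt_snd).eventually (lt_mem_nhds ?_)
    rw [real_inner_self_eq_norm_sq, norm_pt]; norm_num
  have nearp := eventually_near one_pos (norm_pt f a) hl.pt_snd (one_smul _ _).symm hε0
  have nearq := eventually_near one_pos (norm_pt f a) hl.pt_fst (one_smul _ _).symm hε0
  have nearX := eventually_near two_pos (norm_pt f a) (hl.low_tendsto A) rfl hε0
  have nearW := eventually_near two_pos (norm_pt f a) (hl.apex_tendsto η) rfl hε0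
  obtain ⟨⟨u, v⟩, hlt, hsc, hwY, hhull, hapex, hang, hω1, hd1, hpq, nearp, nearq, nearX, nearW⟩ :=
    (hl.eventually_lt.and (hscal.and (hl.eventually_norm_le.and ((hl.eventually_mem_hull hK hf
      le_rfl).and ((hl.eventually_apex_mem hf hη0 hη1).and ((hl.eventually_angle hi1 hi2).and
      (hω1.and (hd1.and (hpq.and (nearp.and (nearq.and (nearX.and nearW)))))))))))).exists
  simp only at hlt hsc hwY hhull hapex hang hω1 hd1 hpq nearp nearq nearX nearW
  have huv := hlt.1.trans hlt.2
  rw [norm_pt, mul_one] at nearp nearq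
  set p := pt f v with hp
  set q := pt f u with hq
  set y := nrm f u (slp f u v) with hy
  have hco : 0 < coef f u v := chord_coeff_pos huv
  have hy1 := one_le_norm_nrm f u (slp f u v)
  have hcrqp : cr q p = coef f u v • y := cr_pt huv
  have hyp : ⟪y, p⟫ = 0 := by rw [hy, ← nrm_slp huv]; exact inner_nrm_pt _ _ _
  have hyq : ⟪y, q⟫ = 0 := inner_nrm_pt _ _ _
  -- the arc of `L` with the same chord
  obtain ⟨x', hx', hdx⟩ : ∃ x' ∈ Ioo b x₁, dist (pt h b) (pt h x') = dist p q := by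
    have hpc := continuous_pt (continuous_of_convex hh.convex)
    have hcont : ContinuousOn (fun w => dist (pt h b) (pt h w)) (Icc b x₁) := by fun_prop
    have := intermediate_value_Ioo hx₁.le hcont
    simp only [dist_self] at this
    exact this ⟨dist_pos.2 fun he => huv.ne' (pt_injective f he), hd1⟩
  obtain ⟨hxρ, hn1, hn2⟩ := hLx hx'
  have hbx := hx'.1
  have hcrpq : cr p q = -(coef f u v • y) := by rw [cr_swap, hcrqp]
  have hcr0 : cr p q ≠ 0 := by
    rw [hcrpq, neg_ne_zero]
    refine smul_ne_zero hco.ne' (norm_pos_iff.1 (by linarith))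
  obtain ⟨φ, hφ, φ1, φ2⟩ := exists_op_map (a := pt h b) (b := pt h x') (a' := p) (b' := q)
    (by simp [hp]) (by simp [hq]) (inner_eq_of_dist_eq (by simp) (by simp) (by simp [hp])
      (by simp [hq]) hdx) hcr0
  have hco' : 0 < coef h b x' := chord_coeff_pos hbx
  set k := coef f u v / coef h b x' with hk
  have hk0 : 0 < k := div_pos hco hco'
  have hφn : φ (nrm h b (slp h b x')) = -(k • y) := by
    have h1 : φ (cr (pt h b) (pt h x')) = cr p q := by rw [← cr_map_of_op hφ, φ1, φ2]
    have h2 : cr (pt h b) (pt h x') = coef h b x' • nrm h b (slp h b x') := cr_pt hbx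
    rw [h2, hcrpq, map_smul] at h1
    have h3 := congrArg (fun z => (coef h b x')⁻¹ • z) h1
    simp only [smul_smul, inv_mul_cancel₀ hco'.ne', one_smul, smul_neg] at h3
    rw [h3, hk, div_eq_inv_mul]
  have hky : 1 ≤ k * ‖y‖ := by
    have := one_le_norm_nrm h b (slp h b x')
    rwa [← φ.norm_map, hφn, norm_neg, norm_smul, Real.norm_of_nonneg hk0.le] at this
  have hφt : ∀ n : E3, φ n = φ (n - nrm h b (slp h b x')) - k • y := fun n => by
    rw [map_sub, hφn]; module
  have hφe : ∀ n : E3, ‖n - nrm h b (slp h b x')‖ < ε₀ →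
      ‖φ (n - nrm h b (slp h b x'))‖ ≤ ε₀ := fun n hn => by rw [φ.norm_map]; exact hn.le
  have hne0 : ∀ w t, nrm f w t ≠ 0 := fun w t =>
    norm_pos_iff.1 (by linarith [one_le_norm_nrm f w t])
  have hMn : ∀ w t, SubG h w t → ∀ z ∈ K ∩ φ '' L, 0 ≤ ⟪φ (nrm h w t), z⟫ := by
    rintro w t ht z ⟨-, z, hz, rfl⟩
    rw [φ.inner_map_map]; exact hh.nrm_nonneg hL ht hz
  have hbd := subG_dR hh.convex b
  have hxd := subG_dR hh.convex x'
  have hM := hL.image φ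
  have htrip : ∀ z, trip q p z = coef f u v * ⟪y, z⟫ := fun z => trip_pt huv z
  have hlens : CornerLens K (φ '' L) (pt f a) p q c r ε := by
    refine ⟨hK, hM, norm_pt f a, norm_pt f v, norm_pt f u, hf.pt_mem hK a, hf.pt_mem hK v,
      hf.pt_mem hK u, ⟨_, hh.pt_mem hL b, φ1⟩, ⟨_, hh.pt_mem hL x', φ2⟩, ?_, ?_, ?_, ?_, ?_, ?_,
      hr0, hε0, ?_, by linarith, hsc.1, hsc.2.1, hsc.2.2, ?_, ?_, ?_, ?_, ?_⟩
    · rw [htrip, inner_nrm_pt_eq]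
      have := lt_chord_of_corner hf.convex ha hlt.1 hlt.2 hlt
      exact mul_neg_of_pos_of_neg hco (mul_neg_of_pos_of_neg (inv_pos.2 (norm_vec_pos f a))
        (by linarith))
    · refine ⟨q + p - (A * coef f u v) • up, ?_, ?_, nearX, hhull⟩
      · -- the point `p + ω` is seen from `p` inside the cone of interior directions of `L`
        have e2 : q + p - (A * coef f u v) • up = (2 : ℝ) • (p + ω (u, v)) := by
          simp only [hω]; rw [← hp, ← hq]; module
        rw [e2]
        refine hM.smul_mem_interior ?_ two_pos
        rw [Body.interior_image]
        refine ⟨pt h b + φ.symm (ω (u, v)), hcone _ (by rwa [φ.symm.norm_map]) ?_, by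
          rw [map_add, φ1, φ.apply_symm_apply]⟩
        rw [φ.symm.norm_map, ← φ.inner_map_map, φ.apply_symm_apply, hφt]
        exact lt_inner_of_below hA0 hε₀.le hε₂ hY0 (norm_pt f v) (norm_pt f u) hpq hco hcrqp hwY
          (inner_nrm_up _ _ _) hyp hyq hk0 hky (hφe _ hn1)
      · rw [htrip, inner_sub_right, inner_add_right, hyp, hyq, inner_smul_right, hy, inner_nrm_up]
        nlinarith [mul_pos hco (mul_pos hA0 hco)]
    · refine ⟨apex η p q, hapex, nearW, ?_⟩
      rintro _ ⟨z, hz, rfl⟩ hpos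
      refine hull_swap _ _ _ ?_
      rw [trip_swap, ← φ1, ← φ2, trip_map_of_op hφ, neg_pos] at hpos
      obtain ⟨α, β, γ, k1, k2, k3, e⟩ := hflat b x' (by simpa using hρ) hxρ hbx z hz hpos
      refine ⟨α, β, γ, k1, k2, k3, ?_⟩
      rw [e, ← φ1, ← φ2, apex, cr_map_of_op hφ]
      simp only [map_add, map_smul, map_sub]
    · exact fun α β h1 h2 => hf.chord_mem_interior ha hlt.1 hlt.2 h1 h2
    · exact nearp
    · exact nearq
    · have := pow_pos hr0 2
      linarith
    · refine ⟨nrm f a (dL f a), nrm f a (dR f a), fun z hz =>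
        ⟨hf.nrm_nonneg hK (subG_dL hf.convex a) hz, hf.nrm_nonneg hK (subG_dR hf.convex a) hz⟩,
        inner_nrm_pt _ _ _, inner_nrm_pt _ _ _, hi3.trans_le ?_⟩
      exact mul_le_mul_of_nonneg_right hcc.le (by positivity)
    · refine ⟨nrm f v (dR f v), φ (nrm h b (dR h b)), fun z hz =>
        ⟨hf.nrm_nonneg hK (subG_dR hf.convex v) hz.1, hMn b _ hbd z hz⟩, inner_nrm_pt _ _ _, ?_, ?_⟩
      · rw [← φ1, φ.inner_map_map]; exact inner_nrm_pt _ _ _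
      · rw [hφt]
        exact inner_lt_of_perturb hk0 (hne0 _ _) hky (hφe _ hn1) hang.1 hcc hc0 hε₁
    · refine ⟨nrm f u (dL f u), φ (nrm h x' (dR h x')), fun z hz =>
        ⟨hf.nrm_nonneg hK (subG_dL hf.convex u) hz.1, hMn x' _ hxd z hz⟩, inner_nrm_pt _ _ _, ?_,
        ?_⟩
      · rw [← φ2, φ.inner_map_map]; exact inner_nrm_pt _ _ _
      · rw [hφt]
        exact inner_lt_of_perturb hk0 (hne0 _ _) hky (hφe _ hn2) hang.2 hcc hc0 hε₁
    · exact fun z hz hn hd => hsK z hz hn (hd.trans_le (min_le_left _ _))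
    · intro z hz hn hd hs
      rw [Body.frontier_image] at hz
      obtain ⟨z, hz, rfl⟩ := hz
      have := hs.image
      rw [φ.symm_apply_apply] at this
      refine hsM z hz (by rwa [φ.norm_map] at hn) ?_ this
      rw [← φ1, ← map_sub, φ.norm_map] at hd
      exact hd.trans_le (min_le_right _ _)
  exact hlens.not_smallSym hφ (by linarith) hS

end SphericalPlane

namespace SphericalPlane

/-! ### From local planes to one plane -/

lemma eq_smul_cr {a b N : E3} (h : cr a b ≠ 0) (ha : ⟪N, a⟫ = 0) (hb : ⟪N, b⟫ = 0) :
    N = (trip a b N / ‖cr a b‖ ^ 2) • cr a b := by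
  have h2 : ‖cr a b‖ ^ 2 ≠ 0 := pow_ne_zero 2 (norm_ne_zero_iff.2 h)
  refine eq_of_inner_eq (a := a) (b := b) (c := cr a b) (by rwa [trip_cr]) ?_ ?_ ?_
  · rw [real_inner_comm, ha, inner_smul_right, real_inner_comm, inner_cr_left, mul_zero]
  · rw [real_inner_comm, hb, inner_smul_right, real_inner_comm, inner_cr_right, mul_zero]
  · rw [inner_smul_right, real_inner_self_eq_norm_sq, div_mul_cancel₀ _ h2]; rfl

/-- Three different points of the sphere lie in one plane only. -/
lemma plane_unique {x y z N M : E3} {c d : ℝ} (hx : ‖x‖ = 1) (hy : ‖y‖ = 1) (hz : ‖z‖ = 1)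
    (hxy : x ≠ y) (hxz : x ≠ z) (hyz : y ≠ z) (hN : N ≠ 0)
    (hNx : ⟪N, x⟫ = c) (hNy : ⟪N, y⟫ = c) (hNz : ⟪N, z⟫ = c)
    (hMx : ⟪M, x⟫ = d) (hMy : ⟪M, y⟫ = d) (hMz : ⟪M, z⟫ = d) :
    ∃ l : ℝ, M = l • N ∧ d = l * c := by
  have hk : cr (y - x) (z - x) ≠ 0 := cr_sub_ne_zero hx hy hz hxy hxz hyz
  obtain ⟨α, hα⟩ : ∃ α : ℝ, N = α • cr (y - x) (z - x) :=
    ⟨_, eq_smul_cr hk (by rw [inner_sub_right, hNx, hNy, sub_self])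
      (by rw [inner_sub_right, hNx, hNz, sub_self])⟩
  obtain ⟨β, hβ⟩ : ∃ β : ℝ, M = β • cr (y - x) (z - x) :=
    ⟨_, eq_smul_cr hk (by rw [inner_sub_right, hMx, hMy, sub_self])
      (by rw [inner_sub_right, hMx, hMz, sub_self])⟩
  have hα0 : α ≠ 0 := by rintro rfl; exact hN (by rw [hα, zero_smul])
  have hM : M = (β / α) • N := by rw [hα, smul_smul, div_mul_cancel₀ _ hα0, hβ]
  refine ⟨β / α, hM, ?_⟩
  rw [← hMx, hM, inner_smul_left, hNx]; rfl

/-- A simple curve on the sphere that is locally planar is planar. -/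
lemma exists_plane_of_local {γ : ℝ → E3} (hn : ∀ u, ‖γ u‖ = 1) (hi : Function.Injective γ)
    (h : ∀ a : ℝ, ∃ N : E3, ∃ c r : ℝ, N ≠ 0 ∧ 0 < r ∧ ∀ x, |x - a| < r → ⟪N, γ x⟫ = c) :
    ∃ N : E3, ∃ c : ℝ, N ≠ 0 ∧ ∀ x, ⟪N, γ x⟫ = c := by
  obtain ⟨N, c, r, hN, hr, hp⟩ := h 0
  set S : Set ℝ := {u | ∀ᶠ w in 𝓝 u, ⟪N, γ w⟫ = c}
  have h0 : (0 : ℝ) ∈ S := Metric.eventually_nhds_iff.2 ⟨r, hr, fun y hy => hp y hy⟩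
  have hcl : IsClosed S := by
    refine isClosed_of_closure_subset fun u hu => ?_
    obtain ⟨M, d, s, hM, hs, hq⟩ := h u
    obtain ⟨v, hv, huv⟩ := Metric.mem_closure_iff.1 hu s hs
    obtain ⟨δ, hδ, hball⟩ := Metric.eventually_nhds_iff.1 hv
    rw [dist_comm, Real.dist_eq, abs_lt] at huv
    obtain ⟨η, hη, hηδ, hηs⟩ : ∃ η > 0, η < δ ∧ η < s - (v - u) :=
      ⟨min δ (s - (v - u)) / 2, by
        have : 0 < min δ (s - (v - u)) := lt_min hδ (by linarith)
        exact ⟨by linarith, by linarith [min_le_left δ (s - (v - u))],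
          by linarith [min_le_right δ (s - (v - u))]⟩⟩
    have hN' : ∀ t, 0 ≤ t → t ≤ η → ⟪N, γ (v + t)⟫ = c := fun t h1 h2 =>
      hball (by rw [Real.dist_eq, add_sub_cancel_left, abs_of_nonneg h1]; linarith)
    have hM' : ∀ t, 0 ≤ t → t ≤ η → ⟪M, γ (v + t)⟫ = d := fun t h1 h2 =>
      hq _ (by rw [abs_lt]; constructor <;> linarith)
    have hne : ∀ t t', t ≠ t' → γ (v + t) ≠ γ (v + t') := fun t t' h1 h2 =>
      h1 (by have := hi h2; linarith)
    obtain ⟨l, hl, hlc⟩ := plane_unique (hn (v + 0)) (hn (v + η / 2)) (hn (v + η))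
      (hne _ _ (by linarith)) (hne _ _ hη.ne) (hne _ _ (by linarith)) hM
      (hM' _ le_rfl hη.le) (hM' _ (by linarith) (by linarith)) (hM' _ hη.le le_rfl)
      (hN' _ le_rfl hη.le) (hN' _ (by linarith) (by linarith)) (hN' _ hη.le le_rfl)
    refine Metric.eventually_nhds_iff.2 ⟨s, hs, fun y hy => ?_⟩
    rw [hl, inner_smul_left, hq y hy, hlc]; rfl
  have huniv := IsClopen.eq_univ ⟨hcl, isOpen_setOfPred_eventually_nhds⟩ ⟨0, h0⟩
  refine ⟨N, c, hN, fun x => ?_⟩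
  have hx : x ∈ S := by rw [huniv]; trivial
  exact hx.self_of_nhds

/-- The part of the boundary of `K` over the half-plane `0 < z 2` is planar. -/
lemma exists_plane_of_smallSym {K L : Set E3} (hK : Body K) (hL : Body L) {h : ℝ → ℝ} {b : ℝ}
    (h1 : up ∈ interior K) (hh : Chart L h) (hb : dL h b = dR h b)
    (hS : SmallSym (· ≠ LinearIsometryEquiv.refl ℝ E3) K L) :
    ∃ N : E3, ∃ c : ℝ, N ≠ 0 ∧ ∀ z ∈ frontier K, ‖z‖ = 1 → 0 < z 2 → ⟪N, z⟫ = c := by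
  obtain ⟨f, hf⟩ := hK.exists_chart h1
  obtain ⟨σ, hσ⟩ := hh.exists_flatChart hL hb
  obtain ⟨N, c, hN, hp⟩ := exists_plane_of_local (γ := pt f) (norm_pt f) (pt_injective f)
    fun a => by
      obtain ⟨ρ, hρ⟩ := hf.exists_flatChart hK (hf.dL_eq_dR_of_smallSym hK hL hh hb hS (a := a))
      exact hρ.exists_plane hσ hS
  refine ⟨N, c, hN, fun z hz hn h2 => ?_⟩
  rw [(hf.eq_pt_of_mem_frontier hK hn h2 hz).2]
  exact hp _

/-- The rotation through a right angle about the axis `up`. -/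
noncomputable def quarterTurn : E3 ≃ₗᵢ[ℝ] E3 :=
  (refl !₂[1, 0, -1]).trans (refl !₂[1, 0, 0])

lemma op_refl_trans {u v : E3} (hu : u ≠ 0) (hv : v ≠ 0) :
    OrientationPreserving ((refl u).trans (refl v)) := by
  rw [OrientationPreserving, det_trans, det_refl hu, det_refl hv]
  norm_num

lemma op_quarterTurn : OrientationPreserving quarterTurn := by
  refine op_refl_trans ?_ ?_ <;>
  · intro h
    have := congrArg (fun z : E3 => z 0) h
    simp at this

lemma quarterTurn_apply (z : E3) : quarterTurn z = !₂[-z 2, z 1, z 0] := by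
  have e1 : ‖(!₂[1, 0, -1] : E3)‖ ^ 2 = 2 := by
    rw [← real_inner_self_eq_norm_sq, inner_coord]; simp; norm_num
  have e2 : ‖(!₂[1, 0, 0] : E3)‖ ^ 2 = 1 := by
    rw [← real_inner_self_eq_norm_sq, inner_coord]; simp
  rw [quarterTurn, LinearIsometryEquiv.trans_apply, refl_apply, refl_apply, e1, e2]
  apply ext_coord <;> (simp [inner_coord]; try ring)

lemma quarterTurn_up : quarterTurn up = up := by
  rw [quarterTurn_apply]; apply ext_coord <;> simp [up]

/-- The plane found over `0 < z 2` also contains the boundary over the next half-plane, which has a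
whole quadrant in common with the former. -/
lemma plane_quarterTurn {K L : Set E3} (hK : Body K) (hL : Body L) {h : ℝ → ℝ} {b : ℝ}
    (h1 : up ∈ interior K) (hh : Chart L h) (hb : dL h b = dR h b)
    (hS : SmallSym (· ≠ LinearIsometryEquiv.refl ℝ E3) K L) {N : E3} {c : ℝ}
    (hp : ∀ z ∈ frontier K, ‖z‖ = 1 → 0 < z 2 → ⟪N, z⟫ = c) :
    ∀ z ∈ frontier (quarterTurn '' K), ‖z‖ = 1 → 0 < z 2 → ⟪quarterTurn N, z⟫ = c := by
  obtain ⟨f, hf⟩ := hK.exists_chart h1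
  obtain ⟨M, d, hM, hq⟩ := exists_plane_of_smallSym (hK.image quarterTurn) hL (by
    rw [Body.interior_image]; exact ⟨up, h1, quarterTurn_up⟩) hh hb
    (hS.image_left ne_refl_conj op_quarterTurn)
  have hN' : ∀ u, ⟪quarterTurn N, quarterTurn (pt f u)⟫ = c := fun u => by
    rw [LinearIsometryEquiv.inner_map_map]
    exact hp _ (hf.pt_mem_frontier hK u) (norm_pt f u) (pt_two_pos f u)
  have hM' : ∀ u, 0 < u → ⟪M, quarterTurn (pt f u)⟫ = d := fun u hu => by
    refine hq _ ?_ (by rw [LinearIsometryEquiv.norm_map, norm_pt]) ?_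
    · rw [Body.frontier_image]; exact mem_image_of_mem _ (hf.pt_mem_frontier hK u)
    · have h2 := pt_two_pos f u
      rw [quarterTurn_apply]
      rw [← pt_zero_div f u, lt_div_iff₀ h2, zero_mul] at hu
      simpa using hu
  have hn : ∀ u, ‖quarterTurn (pt f u)‖ = 1 := fun u => by
    rw [LinearIsometryEquiv.norm_map, norm_pt]
  have hi := quarterTurn.injective.comp (pt_injective f)
  obtain ⟨l, hl, hlc⟩ := plane_unique (hn 1) (hn 2) (hn 3) (hi.ne (by norm_num))
    (hi.ne (by norm_num)) (hi.ne (by norm_num)) hM (hM' _ (by norm_num)) (hM' _ (by norm_num))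
    (hM' _ (by norm_num)) (hN' _) (hN' _) (hN' _)
  intro z hz hzn hz2
  rw [hl, inner_smul_left, hq z hz hzn hz2, hlc]; rfl

/-- The whole boundary of `K` is planar. -/
lemma frontier_planar {K L : Set E3} (hK : Body K) (hL : Body L) {h : ℝ → ℝ} {b : ℝ}
    (h1 : up ∈ interior K) (hh : Chart L h) (hb : dL h b = dR h b)
    (hS : SmallSym (· ≠ LinearIsometryEquiv.refl ℝ E3) K L) :
    ∃ N : E3, ∃ c : ℝ, N ≠ 0 ∧ ∀ z ∈ frontier K, ‖z‖ = 1 → ⟪N, z⟫ = c := by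
  obtain ⟨N, c, hN, p0⟩ := exists_plane_of_smallSym hK hL h1 hh hb hS
  have turn : ∀ {K' : Set E3}, up ∈ interior K' → up ∈ interior (quarterTurn '' K') := fun h' => by
    rw [Body.interior_image]; exact ⟨up, h', quarterTurn_up⟩
  have hS1 := hS.image_left ne_refl_conj op_quarterTurn
  have hS2 := hS1.image_left ne_refl_conj op_quarterTurn
  have p1 := plane_quarterTurn hK hL h1 hh hb hS p0
  have p2 := plane_quarterTurn (hK.image _) hL (turn h1) hh hb hS1 p1
  have p3 := plane_quarterTurn ((hK.image _).image _) hL (turn (turn h1)) hh hb hS2 p2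
  have mem : ∀ {K' : Set E3} {z : E3}, z ∈ frontier K' →
      quarterTurn z ∈ frontier (quarterTurn '' K') := fun h' => by
    rw [Body.frontier_image]; exact mem_image_of_mem _ h'
  refine ⟨N, c, hN, fun z hz hn => ?_⟩
  rcases lt_trichotomy (z 2) 0 with h2 | h2 | h2
  · have := p2 _ (mem (mem hz)) (by simpa using hn) (by simpa [quarterTurn_apply] using h2)
    simpa only [LinearIsometryEquiv.inner_map_map] using this
  · rcases lt_trichotomy (z 0) 0 with h0 | h0 | h0
    · have := p3 _ (mem (mem (mem hz))) (by simpa using hn)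
        (by simpa [quarterTurn_apply] using h0)
      simpa only [LinearIsometryEquiv.inner_map_map] using this
    · -- only the two points `up` and `-up` remain, and they are not on the boundary
      exfalso
      have e : z = z 1 • up := by apply ext_coord <;> simp [up, h0, h2]
      rw [hK.mem_frontier_iff] at hz
      rcases lt_trichotomy (z 1) 0 with h3 | h3 | h3
      · refine hK.neg_notMem h1 ((hK.smul_mem_iff (neg_pos.2 h3)).1 ?_)
        rw [smul_neg, neg_smul, neg_neg, ← e]; exact hz.1
      · rw [e, h3, zero_smul, norm_zero] at hn; exact zero_ne_one hn
      · exact hz.2 (e ▸ hK.smul_mem_interior h1 h3)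
    · have := p1 _ (mem hz) (by simpa using hn) (by simpa [quarterTurn_apply] using h0)
      simpa only [LinearIsometryEquiv.inner_map_map] using this
  · exact p0 z hz hn h2

/-! ### Cones with planar boundary -/

/-- Moving towards the centre `N` leads strictly into the cone over the circle. -/
lemma cap_step {N : E3} (hN : ‖N‖ = 1) {c : ℝ} (hc : |c| < 1) (z : E3) {t : ℝ} (ht : 0 < t)
    (hz : c * ‖z‖ ≤ ⟪N, z⟫) : c * ‖z + t • N‖ < ⟪N, z + t • N⟫ := by
  have h1 : |‖z + t • N‖ - ‖z‖| ≤ t := by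
    refine (abs_norm_sub_norm_le _ _).trans ?_
    rw [add_sub_cancel_left, norm_smul, hN, mul_one, Real.norm_of_nonneg ht.le]
  have h2 : c * (‖z + t • N‖ - ‖z‖) ≤ |c| * t := by
    refine (le_abs_self _).trans ?_
    rw [abs_mul]
    exact mul_le_mul_of_nonneg_left h1 (abs_nonneg c)
  rw [inner_add_right, inner_smul_right, real_inner_self_eq_norm_sq, hN]
  nlinarith

/-- On either side of the cone over a circle that contains the boundary of `K`, membership in `K`
does not change. -/
lemma Body.mem_iff_of_side {K : Set E3} (hK : Body K) {N : E3} (hN : ‖N‖ = 1) {c : ℝ}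
    (hc : |c| < 1) (hp : ∀ z ∈ frontier K, ‖z‖ = 1 → ⟪N, z⟫ = c) {z : E3}
    (hz : c * ‖z‖ < ⟪N, z⟫) : (z ∈ K ↔ N ∈ K) ∧ (z ∈ interior K ↔ z ∈ K) := by
  have hfr : ∀ w : E3, c * ‖w‖ < ⟪N, w⟫ → w ∉ frontier K := by
    intro w hw hwf
    have h0 : 0 < ‖w‖ := norm_pos_iff.2 fun h => by simp [h] at hw
    have := hp (‖w‖⁻¹ • w) ((hK.smul_mem_frontier_iff (inv_pos.2 h0)).2 hwf)
      (by rw [norm_smul, norm_inv, norm_norm, inv_mul_cancel₀ h0.ne'])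
    rw [inner_smul_right, inv_mul_eq_iff_eq_mul₀ h0.ne'] at this
    linarith
  have hseg : ∀ w ∈ segment ℝ z N, w ∉ frontier K := by
    rintro w ⟨s, t, hs, ht, hst, rfl⟩
    refine hfr _ ?_
    rcases ht.eq_or_lt with rfl | ht
    · rw [add_zero] at hst; simpa [hst] using hz
    · refine cap_step hN hc _ ht ?_
      rw [norm_smul, Real.norm_of_nonneg hs, inner_smul_right]
      nlinarith
  have hint : ∀ w, w ∉ frontier K → (w ∈ interior K ↔ w ∈ K) := fun w hw =>
    ⟨fun h => interior_subset h, fun h => by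
      by_contra h'; exact hw ((hK.mem_frontier_iff).2 ⟨h, h'⟩)⟩
  have hcov : segment ℝ z N ⊆ interior K ∪ Kᶜ := fun w hw => by
    by_cases hwK : w ∈ K
    · exact Or.inl ((hint w (hseg w hw)).2 hwK)
    · exact Or.inr hwK
  have hconn : IsPreconnected (segment ℝ z N) := (convex_segment z N).isPreconnected
  have hd : Disjoint (interior K) Kᶜ := disjoint_compl_right_iff_subset.2 interior_subset
  have hzs := left_mem_segment ℝ z N
  have hNs := right_mem_segment ℝ z N
  have key : ∀ w ∈ segment ℝ z N, ∀ w' ∈ segment ℝ z N, w ∈ K → w' ∈ K := fun w hw w' hw' h =>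
    interior_subset (hconn.subset_left_of_subset_union isOpen_interior hK.closed.isOpen_compl hd
      hcov ⟨w, hw, (hint w (hseg w hw)).2 h⟩ hw')
  exact ⟨⟨key z hzs N hNs, key N hNs z hzs⟩, hint z (hseg z hzs)⟩

/-- For a unit vector `N`, the cone over the circle with centre `N` and spherical radius
`arccos c`. -/
def cap (N : E3) (c : ℝ) : Set E3 := {z | c * ‖z‖ ≤ ⟪N, z⟫}

/-- If `K` contains the centre `N`, it is the whole cap. The offset `c` is not negative, since a cap
of radius greater than `π / 2` contains antipodal points in its interior. -/
lemma Body.eq_cap {K : Set E3} (hK : Body K) {N : E3} (hN : ‖N‖ = 1) {c : ℝ}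
    (hc : |c| < 1) (hp : ∀ z ∈ frontier K, ‖z‖ = 1 → ⟪N, z⟫ = c) {e : E3} (he : e ≠ 0)
    (hNe : ⟪N, e⟫ = 0) (hNK : N ∈ K) : 0 ≤ c ∧ K = cap N c := by
  have side := fun z hz => hK.mem_iff_of_side hN hc hp (z := z) hz
  have hNself : ⟪N, N⟫ = 1 := by rw [real_inner_self_eq_norm_sq, hN, one_pow]
  have hNi : N ∈ interior K := (side N (by
    rw [hN, hNself, mul_one]; exact (abs_lt.1 hc).2)).2.2 hNK
  have hnN := hK.neg_notMem hNi
  have hp' : ∀ z ∈ frontier K, ‖z‖ = 1 → ⟪-N, z⟫ = -c := fun z hz hn => by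
    rw [inner_neg_left, hp z hz hn]
  have hsub : cap N c ⊆ K := fun z hz => by
    have ht : Tendsto (fun t : ℝ => z + t • N) (𝓝[>] 0) (𝓝 (z + (0 : ℝ) • N)) :=
      ((by fun_prop : Continuous fun t : ℝ => z + t • N).tendsto 0).mono_left nhdsWithin_le_nhds
    rw [zero_smul, add_zero] at ht
    refine hK.closed.mem_of_tendsto ht ?_
    filter_upwards [self_mem_nhdsWithin] with t ht
    exact (side _ (cap_step hN hc z ht hz)).1.2 hNK
  refine ⟨?_, subset_antisymm (fun z hz => ?_) hsub⟩
  · by_contra hneg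
    have hpos : c * ‖e‖ < 0 := mul_neg_of_neg_of_pos (not_le.1 hneg) (norm_pos_iff.2 he)
    have h1 : e ∈ interior K := (side e (by rw [hNe]; exact hpos)).2.2
      (hsub (by rw [cap, mem_ofPred, hNe]; exact hpos.le))
    refine hK.neg_notMem h1 (hsub ?_)
    rw [cap, mem_ofPred, norm_neg, inner_neg_right, hNe, neg_zero]; exact hpos.le
  · by_contra hlt
    rw [cap, mem_ofPred, not_le] at hlt
    exact hnN ((hK.mem_iff_of_side (N := -N) (c := -c) (by rwa [norm_neg]) (by rwa [abs_neg]) hp'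
      (z := z) (by rw [inner_neg_left]; linarith)).1.1 hz)

/-- A cone with planar boundary on the sphere is the cone over a circle of radius at most
`π / 2`. -/
lemma Body.exists_cap {K : Set E3} (hK : Body K) {N : E3} (hN0 : N ≠ 0) {c : ℝ}
    (hp : ∀ z ∈ frontier K, ‖z‖ = 1 → ⟪N, z⟫ = c) {x y : E3} (hx : x ∈ frontier K)
    (hy : y ∈ frontier K) (hx1 : ‖x‖ = 1) (hy1 : ‖y‖ = 1) (hxy : x ≠ y) :
    ∃ N : E3, ∃ c : ℝ, ‖N‖ = 1 ∧ 0 ≤ c ∧ c < 1 ∧ K = cap N c := by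
  wlog hN : ‖N‖ = 1 generalizing N c
  · have hpos := norm_pos_iff.2 hN0
    refine this (N := ‖N‖⁻¹ • N) (c := ‖N‖⁻¹ * c) ?_ (fun z hz hn => ?_) ?_
    · exact smul_ne_zero (inv_ne_zero hpos.ne') hN0
    · rw [inner_smul_left, hp z hz hn]; rfl
    · rw [norm_smul, norm_inv, norm_norm, inv_mul_cancel₀ hpos.ne']
  have hcx := hp x hx hx1
  have hcy := hp y hy hy1
  have hc1 : c < 1 := by
    refine lt_of_le_of_ne ?_ fun h => hxy ?_
    · rw [← hcx]; simpa [hN, hx1] using real_inner_le_norm N x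
    · rw [h] at hcx hcy
      rw [← (inner_eq_one_iff_of_norm_eq_one hN hx1).1 hcx,
        ← (inner_eq_one_iff_of_norm_eq_one hN hy1).1 hcy]
  have hc2 : -1 < c := by
    refine lt_of_le_of_ne ?_ fun h => hxy ?_
    · rw [← hcx]
      have := neg_le_of_abs_le (abs_real_inner_le_norm N x)
      simpa [hN, hx1] using this
    · have hn : ‖-N‖ = 1 := by rwa [norm_neg]
      have e : ∀ w, ⟪N, w⟫ = c → ⟪-N, w⟫ = 1 := fun w hw => by
        rw [inner_neg_left, hw, ← h, neg_neg]
      rw [← (inner_eq_one_iff_of_norm_eq_one hn hx1).1 (e x hcx),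
        ← (inner_eq_one_iff_of_norm_eq_one hn hy1).1 (e y hcy)]
  have hc : |c| < 1 := abs_lt.2 ⟨hc2, hc1⟩
  have he : y - x ≠ 0 := sub_ne_zero.2 hxy.symm
  have hNe : ⟪N, y - x⟫ = 0 := by rw [inner_sub_right, hcx, hcy, sub_self]
  by_cases hNK : N ∈ K
  · obtain ⟨h1, h2⟩ := hK.eq_cap hN hc hp he hNe hNK
    exact ⟨N, c, hN, h1, hc1, h2⟩
  by_cases hNK' : -N ∈ K
  · obtain ⟨h1, h2⟩ := hK.eq_cap (N := -N) (c := -c) (by rwa [norm_neg]) (by rwa [abs_neg])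
      (fun z hz hn => by rw [inner_neg_left, hp z hz hn]) he
      (by rw [inner_neg_left, hNe, neg_zero]) hNK'
    exact ⟨-N, -c, by rwa [norm_neg], h1, by linarith, h2⟩
  -- with neither pole in `K` there would be no interior points
  exfalso
  obtain ⟨z, hz⟩ := hK.int
  obtain ⟨t, ht, hzt⟩ := Body.exists_add_smul_mem hz N
  by_cases hside : c * ‖z‖ ≤ ⟪N, z⟫
  · exact hNK ((hK.mem_iff_of_side hN hc hp (cap_step hN hc z ht hside)).1.1 hzt)
  · exact hNK' ((hK.mem_iff_of_side (N := -N) (c := -c) (by rwa [norm_neg]) (by rwa [abs_neg])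
      (fun z hz hn => by rw [inner_neg_left, hp z hz hn]) (z := z)
      (by rw [inner_neg_left]; linarith)).1.1 (interior_subset hz))

lemma Body.exists_up_mem {K : Set E3} (hK : Body K) : ∃ A : E3 ≃ₗᵢ[ℝ] E3,
    OrientationPreserving A ∧ up ∈ interior (A '' K) := by
  obtain ⟨o, ho⟩ := hK.int
  have ho' : 0 < ‖o‖ := norm_pos_iff.2 (hK.ne_zero_of_mem_interior ho)
  set a := ‖o‖⁻¹ • o
  have ha : a ∈ interior K := hK.smul_mem_interior ho (inv_pos.2 ho')
  have ha1 : ‖a‖ = ‖up‖ := by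
    rw [norm_up, norm_smul, norm_inv, norm_norm, inv_mul_cancel₀ ho'.ne']
  by_cases h : a = up
  · exact ⟨LinearIsometryEquiv.refl ℝ E3, op_refl, by
      rw [Body.interior_image]; exact ⟨a, ha, by simpa using h⟩⟩
  · refine ⟨(refl (a - up)).trans (refl !₂[1, 0, 0]), op_refl_trans (sub_ne_zero.2 h) ?_, ?_⟩
    · intro h
      have := congrArg (fun z : E3 => z 0) h
      simp at this
    · rw [Body.interior_image]
      refine ⟨a, ha, ?_⟩
      rw [LinearIsometryEquiv.trans_apply, refl_sub ha1]
      exact refl_of_inner_eq_zero (by simp [inner_coord, up])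

lemma image_cap (A : E3 ≃ₗᵢ[ℝ] E3) (N : E3) (c : ℝ) : A '' cap N c = cap (A N) c := by
  ext z
  constructor
  · rintro ⟨w, hw, rfl⟩
    rw [cap, mem_ofPred, A.inner_map_map, A.norm_map]; exact hw
  · intro hz
    refine ⟨A.symm z, ?_, A.apply_symm_apply z⟩
    rw [cap, mem_ofPred, ← A.inner_map_map, ← A.norm_map, A.apply_symm_apply]; exact hz

/-- If all small intersections have a non-trivial symmetry, `K` is the cone over a circle. -/
lemma SmallSym.exists_cap {K L : Set E3} (hK : Body K) (hL : Body L)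
    (hS : SmallSym (· ≠ LinearIsometryEquiv.refl ℝ E3) K L) :
    ∃ N : E3, ∃ c : ℝ, ‖N‖ = 1 ∧ 0 ≤ c ∧ c < 1 ∧ K = cap N c := by
  obtain ⟨A, hA, hA'⟩ := hK.exists_up_mem
  obtain ⟨B, hB, hB'⟩ := hL.exists_up_mem
  obtain ⟨f, hf⟩ := (hK.image A).exists_chart hA'
  obtain ⟨h, hh⟩ := (hL.image B).exists_chart hB'
  obtain ⟨b, hb⟩ := exists_dL_eq_dR hh.convex
  obtain ⟨N, c, hN, hp⟩ := frontier_planar (hK.image A) (hL.image B) hA' hh hb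
    ((hS.image_left ne_refl_conj hA).image_right ne_refl_conj hB)
  obtain ⟨N, c, hN, h0, h1, e⟩ := (hK.image A).exists_cap hN hp
    (hf.pt_mem_frontier (hK.image A) 0) (hf.pt_mem_frontier (hK.image A) 1) (norm_pt f 0)
    (norm_pt f 1) ((pt_injective f).ne zero_ne_one)
  refine ⟨A.symm N, c, by rwa [A.symm.norm_map], h0, h1, ?_⟩
  rw [← image_cap, ← e, image_symm_image]

end SphericalPlane

namespace SphericalPlane

/-! ### Circles with centrally symmetric small intersections -/

lemma SmallSym.mono {Q Q' : (E3 ≃ₗᵢ[ℝ] E3) → Prop} (hQ : ∀ g, Q g → Q' g) {K L : Set E3}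
    (h : SmallSym Q K L) : SmallSym Q' K L := by
  obtain ⟨c, hc, h⟩ := h
  refine ⟨c, hc, fun φ hφ h1 h2 => ?_⟩
  obtain ⟨g, hg, e⟩ := h φ hφ h1 h2
  exact ⟨g, hQ g hg, e⟩

/-- The rotation through the angle `π` about some unit vector. -/
def IsHalfTurn (g : E3 ≃ₗᵢ[ℝ] E3) : Prop :=
  ∃ x : E3, ‖x‖ = 1 ∧ ∀ z, g z = (2 * ⟪x, z⟫) • x - z

lemma IsHalfTurn.conj (g k : E3 ≃ₗᵢ[ℝ] E3) (hg : IsHalfTurn g) :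
    IsHalfTurn ((k.symm.trans g).trans k) := by
  obtain ⟨x, hx, h⟩ := hg
  refine ⟨k x, by rwa [k.norm_map], fun z => ?_⟩
  rw [LinearIsometryEquiv.trans_apply, LinearIsometryEquiv.trans_apply, h, map_sub, map_smul,
    k.apply_symm_apply, ← k.inner_map_map x, k.apply_symm_apply]

lemma IsHalfTurn.ne_refl {g : E3 ≃ₗᵢ[ℝ] E3} (hg : IsHalfTurn g) :
    g ≠ LinearIsometryEquiv.refl ℝ E3 := by
  rintro rfl
  obtain ⟨x, hx, h⟩ := hg
  have hz : ∀ z : E3, z = ⟪x, z⟫ • x := fun z => by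
    have h' : z = (2 * ⟪x, z⟫) • x - z := h z
    have e : (2 : ℝ) • z = (2 : ℝ) • (⟪x, z⟫ • x) := by
      rw [two_smul, smul_smul]; nth_rewrite 1 [h']; abel
    exact smul_right_injective E3 two_ne_zero e
  have h0 := hz !₂[1, 0, 0]
  have h1 := hz !₂[0, 1, 0]
  have hi : ⟪(!₂[1, 0, 0] : E3), (!₂[0, 1, 0] : E3)⟫ = 0 := by simp [inner_coord]
  rw [h0, h1, inner_smul_left, inner_smul_right, real_inner_self_eq_norm_sq, hx] at hi
  rcases mul_eq_zero.1 hi with h' | h'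
  · have h' : ⟪x, (!₂[1, 0, 0] : E3)⟫ = 0 := h'
    rw [h', zero_smul] at h0
    have := congrArg (fun z : E3 => z 0) h0
    simp at this
  · rw [one_pow, mul_one] at h'
    rw [h', zero_smul] at h1
    have := congrArg (fun z : E3 => z 1) h1
    simp at this

lemma inner_eq_of_mem_frontier_cap {N : E3} {c : ℝ} {z : E3} (hz : z ∈ frontier (cap N c))
    (hn : ‖z‖ = 1) : ⟪N, z⟫ = c := by
  have := frontier_le_subset_eq (by fun_prop : Continuous fun z : E3 => c * ‖z‖)
    (by fun_prop : Continuous fun z : E3 => ⟪N, z⟫) hz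
  have h : c * ‖z‖ = ⟪N, z⟫ := this
  rw [← h, hn, mul_one]

/-- A half-turn does not both interchange two different and not antipodal points and fix the normal
of the plane that they span. -/
lemma IsHalfTurn.not_swap {g : E3 ≃ₗᵢ[ℝ] E3} (hg : IsHalfTurn g) {p q : E3} (hpq : 0 < ⟪p, q⟫)
    (hcr : cr p q ≠ 0) (h1 : g p = q) (h2 : g (cr p q) = cr p q) : False := by
  obtain ⟨x, hx, h⟩ := hg
  have e1 : p + q = (2 * ⟪x, p⟫) • x := by rw [← h1, h]; abel
  have e2 : cr p q + cr p q = (2 * ⟪x, cr p q⟫) • x := by nth_rewrite 2 [← h2]; rw [h]; abel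
  have h0 : ⟪cr p q, p + q⟫ = 0 := by
    rw [inner_add_right, inner_cr_left, inner_cr_right, add_zero]
  rw [e1, inner_smul_right, real_inner_comm x] at h0
  rcases mul_eq_zero.1 h0 with h' | h'
  · rw [h', zero_smul] at e1
    have : ⟪p, p + q⟫ = 0 := by rw [e1, inner_zero_right]
    rw [inner_add_right] at this
    linarith [real_inner_self_nonneg (x := p)]
  · rw [h', mul_zero, zero_smul, ← two_smul ℝ] at e2
    exact hcr ((smul_eq_zero.1 e2).resolve_left two_ne_zero)

/-- If the small intersections of two circles, the first of which is no great circle, are centrally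
symmetric, then the circles have the same radius. -/
lemma cap_radius_eq {K L : Set E3} (hK : Body K) (hL : Body L) {N M : E3} {c d : ℝ}
    (hN : ‖N‖ = 1) (hM : ‖M‖ = 1) (hc : 0 < c) (hd : 0 ≤ d) (eK : K = cap N c) (eL : L = cap M d)
    (hS : SmallSym IsHalfTurn K L) : c = d := by
  wlog hup : up ∈ interior K ∧ up ∈ interior L generalizing K L N M
  · obtain ⟨A, hA, hA'⟩ := hK.exists_up_mem
    obtain ⟨B, hB, hB'⟩ := hL.exists_up_mem
    exact this (hK.image A) (hL.image B) (N := A N) (M := B M) (by rwa [A.norm_map])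
      (by rwa [B.norm_map]) (by rw [eK, image_cap]) (by rw [eL, image_cap])
      ((hS.image_left IsHalfTurn.conj hA).image_right IsHalfTurn.conj hB) ⟨hA', hB'⟩
  obtain ⟨f, hf⟩ := hK.exists_chart hup.1
  obtain ⟨h, hh⟩ := hL.exists_chart hup.2
  obtain ⟨a, ha⟩ := exists_dL_eq_dR hf.convex
  obtain ⟨b, hb⟩ := exists_dL_eq_dR hh.convex
  obtain ⟨ρ, hρ⟩ := hf.exists_flatChart hK ha
  obtain ⟨σ, hσ⟩ := hh.exists_flatChart hL hb
  obtain ⟨ℓ₁, hℓ₁, hsym⟩ := hρ.exists_symmetry (fun g hg => hg.ne_refl) hσ hS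
  have hNf : ∀ u, ⟪N, pt f u⟫ = c := fun u =>
    inner_eq_of_mem_frontier_cap (eK ▸ hf.pt_mem_frontier hK u) (norm_pt f u)
  have hMh : ∀ u, ⟪M, pt h u⟫ = d := fun u =>
    inner_eq_of_mem_frontier_cap (eL ▸ hh.pt_mem_frontier hL u) (norm_pt h u)
  have hρ0 := hρ.ρpos
  have hσ0 := hσ.ρpos
  have d1 := hρ.monoCurve.dist_pos (show a < a + ρ / 2 by linarith)
  have d2 := hσ.monoCurve.dist_pos (show b < b + σ / 2 by linarith)
  obtain ⟨ℓ, hℓ, hℓ1, hℓ2, hℓ3⟩ : ∃ ℓ > 0, ℓ < ℓ₁ ∧ ℓ < dist (pt f a) (pt f (a + ρ / 2)) ∧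
      ℓ < dist (pt h b) (pt h (b + σ / 2)) := by
    obtain ⟨ℓ, h0, h1⟩ := exists_between (lt_min hℓ₁ (lt_min d1 d2))
    rw [lt_min_iff, lt_min_iff] at h1
    exact ⟨ℓ, h0, h1⟩
  obtain ⟨v, hv, hdv⟩ := hρ.monoCurve.exists_dist_eq (show a < a + ρ / 2 by linarith) hℓ hℓ2
  obtain ⟨x, hx, hdx⟩ := hσ.monoCurve.exists_dist_eq (show b < b + σ / 2 by linarith) hℓ hℓ3
  have ha' : |a - a| < ρ := by simpa using hρ0
  have hb' : |b - b| < σ := by simpa using hσ0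
  have hv' : |v - a| < ρ := by rw [abs_lt]; constructor <;> linarith [hv.1, hv.2]
  have hx' : |x - b| < σ := by rw [abs_lt]; constructor <;> linarith [hx.1, hx.2]
  have hcr := hρ.monoCurve.cr_ne a v hv.1
  -- a cone over a circle that is no great circle is strictly convex
  have hcurved : ∃ z ∈ K, trip (pt f a) (pt f v) z < 0 := by
    have hlt : ‖pt f a + pt f v‖ < 2 := by
      have h1 := norm_add_sq_real (pt f a) (pt f v)
      rw [norm_pt, norm_pt] at h1
      nlinarith [FlatChart.inner_lt_one (f := f) hv.1.ne, norm_nonneg (pt f a + pt f v)]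
    have hint : pt f a + pt f v ∈ interior K := by
      rw [eK]
      refine interior_maximal (t := {z : E3 | c * ‖z‖ < ⟪N, z⟫})
        (fun z (hz : c * ‖z‖ < ⟪N, z⟫) => hz.le)
        (isOpen_lt (f := fun z : E3 => c * ‖z‖) (g := fun z : E3 => ⟪N, z⟫) (by fun_prop)
          (by fun_prop)) ?_
      rw [mem_ofPred, inner_add_right, hNf, hNf]
      nlinarith
    obtain ⟨t, ht, hm⟩ := Body.exists_add_smul_mem hint (-cr (pt f a) (pt f v))
    refine ⟨_, hm, ?_⟩
    rw [smul_neg, ← sub_eq_add_neg, trip_sub, trip_add, trip_smul, trip_cr, trip_self_left,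
      trip_self_right]
    have := norm_pos_iff.2 hcr
    have : 0 < t * ‖cr (pt f a) (pt f v)‖ ^ 2 := by positivity
    linarith
  obtain ⟨g, hg, hcase | ⟨-, -, g1, -, g3⟩⟩ := hsym a v b x ha' hv' hv.1 hb' hx' hx.1
    (by rw [hdv]; exact hℓ1) (by rw [hdv, hdx]) hcurved
  · obtain ⟨k, hends, hmid, -⟩ := hcase
    obtain ⟨y, -, hy⟩ := hmid ((a + v) / 2) ⟨by linarith [hv.1], by linarith [hv.1]⟩
    obtain ⟨y₁, hy₁⟩ : ∃ y, k (pt f a) = pt h y := by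
      rcases hends with h' | h'
      exacts [⟨_, h'.1⟩, ⟨_, h'.1⟩]
    obtain ⟨y₂, hy₂⟩ : ∃ y, k (pt f v) = pt h y := by
      rcases hends with h' | h'
      exacts [⟨_, h'.2⟩, ⟨_, h'.2⟩]
    have hi := k.injective.comp (pt_injective f)
    have hn : ∀ u, ‖k (pt f u)‖ = 1 := fun u => by rw [k.norm_map, norm_pt]
    have hkN : ∀ u, ⟪k N, k (pt f u)⟫ = c := fun u => by rw [k.inner_map_map, hNf]
    have hkN1 : ‖k N‖ = 1 := by rwa [k.norm_map]
    obtain ⟨l, hl, hlc⟩ := plane_unique (M := M) (d := d) (hn a) (hn v) (hn ((a + v) / 2))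
      (hi.ne hv.1.ne)
      (hi.ne (by linarith [hv.1])) (hi.ne (by linarith [hv.1]))
      (norm_ne_zero_iff.1 (hkN1.trans_ne one_ne_zero)) (hkN _) (hkN _) (hkN _)
      (by rw [hy₁]; exact hMh _) (by rw [hy₂]; exact hMh _) (by rw [hy]; exact hMh _)
    rw [hl, norm_smul, hkN1, mul_one, Real.norm_eq_abs] at hM
    rcases abs_eq (zero_le_one' ℝ) |>.1 hM with rfl | rfl <;> linarith
  · exact (hg.not_swap (hρ.pos a v ha' hv') hcr g1 g3).elim

/-! ### The cone over a set on the sphere -/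

/-- The cone with apex at the origin over a subset of the sphere. -/
def cone (A : Set S2) : Set E3 := {z | z = 0 ∨ ∃ x ∈ A, z = ‖z‖ • (x : E3)}

lemma norm_coe (x : S2) : ‖(x : E3)‖ = 1 := by simp

lemma smul_mem_cone {A : Set S2} {x : S2} (hx : x ∈ A) {t : ℝ} (ht : 0 ≤ t) :
    t • (x : E3) ∈ cone A :=
  Or.inr ⟨x, hx, by rw [norm_smul, norm_coe, mul_one, Real.norm_of_nonneg ht]⟩

lemma smul_mem_cone_iff {A : Set S2} {x : S2} {t : ℝ} (ht : 0 < t) :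
    t • (x : E3) ∈ cone A ↔ x ∈ A := by
  refine ⟨?_, fun h => smul_mem_cone h ht.le⟩
  rintro (h | ⟨y, hy, h⟩)
  · rw [smul_eq_zero] at h
    rcases h with h | h
    · exact absurd h ht.ne'
    · exact absurd (norm_coe x) (by rw [h, norm_zero]; exact zero_ne_one)
  · rw [norm_smul, norm_coe, mul_one, Real.norm_of_nonneg ht.le] at h
    rwa [Subtype.ext (smul_right_injective E3 ht.ne' h)]

lemma coe_mem_cone {A : Set S2} {x : S2} : (x : E3) ∈ cone A ↔ x ∈ A := by
  simpa using smul_mem_cone_iff (A := A) (x := x) one_pos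

/-- Every non-zero vector is a positive multiple of a point of the sphere. -/
lemma exists_eq_smul_coe {z : E3} (hz : z ≠ 0) : ∃ x : S2, z = ‖z‖ • (x : E3) := by
  have h := norm_ne_zero_iff.2 hz
  exact ⟨⟨‖z‖⁻¹ • z, by simp [norm_smul, h]⟩, by rw [smul_smul, mul_inv_cancel₀ h, one_smul]⟩

lemma eq_cone {A : Set S2} {S : Set E3} (h0 : (0 : E3) ∈ S)
    (h : ∀ x : S2, ∀ t : ℝ, 0 < t → (t • (x : E3) ∈ S ↔ x ∈ A)) : S = cone A := by
  ext z
  by_cases hz : z = 0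
  · subst hz; exact ⟨fun _ => Or.inl rfl, fun _ => h0⟩
  · obtain ⟨x, hx⟩ := exists_eq_smul_coe hz
    rw [hx, h x _ (norm_pos_iff.2 hz), smul_mem_cone_iff (norm_pos_iff.2 hz)]

lemma cone_inter (A B : Set S2) : cone A ∩ cone B = cone (A ∩ B) :=
  eq_cone ⟨Or.inl rfl, Or.inl rfl⟩ fun _ _ ht =>
    and_congr (smul_mem_cone_iff ht) (smul_mem_cone_iff ht)

lemma act_symm_act (g : E3 ≃ₗᵢ[ℝ] E3) (x : S2) : act g.symm (act g x) = x :=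
  Subtype.ext (g.symm_apply_apply _)

lemma act_act_symm (g : E3 ≃ₗᵢ[ℝ] E3) (x : S2) : act g (act g.symm x) = x :=
  Subtype.ext (g.apply_symm_apply _)

lemma mem_act_image {g : E3 ≃ₗᵢ[ℝ] E3} {A : Set S2} {x : S2} :
    x ∈ act g '' A ↔ act g.symm x ∈ A := by
  constructor
  · rintro ⟨y, hy, rfl⟩; rwa [act_symm_act]
  · exact fun h => ⟨_, h, act_act_symm g x⟩

lemma cone_act (g : E3 ≃ₗᵢ[ℝ] E3) (A : Set S2) : g '' cone A = cone (act g '' A) := by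
  refine eq_cone ⟨0, Or.inl rfl, map_zero g⟩ fun x t ht => ?_
  rw [mem_act_image, ← smul_mem_cone_iff (A := A) (x := act g.symm x) ht]
  constructor
  · rintro ⟨z, hz, e⟩
    have : z = t • (act g.symm x : E3) := by
      rw [← g.symm_apply_apply z, e, map_smul]; rfl
    rwa [← this]
  · intro h
    exact ⟨_, h, by rw [map_smul]; exact congrArg (t • ·) (g.apply_symm_apply _)⟩

lemma interior_cone_nonempty {A : Set S2} (h : (interior A).Nonempty) :
    (interior (cone A)).Nonempty := by
  obtain ⟨x, hx⟩ := h
  obtain ⟨U, hU, hUA⟩ := isOpen_induced_iff.1 (isOpen_interior (s := A))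
  have hxU : (x : E3) ∈ U := by
    have : x ∈ Subtype.val ⁻¹' U := by rw [hUA]; exact hx
    exact this
  have hx0 : (x : E3) ≠ 0 := norm_ne_zero_iff.1 (by rw [norm_coe]; exact one_ne_zero)
  have hcont : ContinuousAt (fun z : E3 => ‖z‖⁻¹ • z) (x : E3) :=
    (continuousAt_id.norm.inv₀ (norm_ne_zero_iff.2 hx0)).smul continuousAt_id
  refine ⟨x, mem_interior_iff_mem_nhds.2 ?_⟩
  have h1 : ∀ᶠ z in 𝓝 (x : E3), ‖z‖⁻¹ • z ∈ U :=
    hcont.eventually_mem (hU.mem_nhds (by simpa [norm_coe] using hxU))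
  filter_upwards [h1, isOpen_ne.mem_nhds hx0] with z hz hz0
  obtain ⟨y, hy⟩ := exists_eq_smul_coe hz0
  have hpos := norm_pos_iff.2 hz0
  rw [hy, norm_smul, norm_norm, norm_coe, mul_one, smul_smul, inv_mul_cancel₀ hpos.ne',
    one_smul] at hz
  have hyA : y ∈ interior A := by rw [← hUA]; exact hz
  exact Or.inr ⟨y, interior_subset hyA, hy⟩

lemma interior_nonempty_of_cone {A : Set S2} (h : (interior (cone A)).Nonempty) :
    (interior A).Nonempty := by
  obtain ⟨z, hz, hz0⟩ : ∃ z ∈ interior (cone A), z ≠ 0 := by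
    by_contra! hall
    obtain ⟨z, hz⟩ := h
    have hz0 := hall z hz
    subst hz0
    obtain ⟨t, ht, hm⟩ := Body.exists_add_smul_mem (K := interior (cone A))
      (by rwa [interior_interior]) up
    have := hall _ hm
    rw [zero_add, smul_eq_zero] at this
    rcases this with h' | h'
    · exact ht.ne' h'
    · exact absurd norm_up (by rw [h', norm_zero]; exact zero_ne_one)
  obtain ⟨x, hx⟩ := exists_eq_smul_coe hz0
  have hpos := norm_pos_iff.2 hz0
  refine ⟨x, interior_maximal (t := {y : S2 | ‖z‖ • (y : E3) ∈ interior (cone A)})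
    (fun y hy => (smul_mem_cone_iff hpos).1 (interior_subset hy))
    (isOpen_interior.preimage (by fun_prop)) (?_ : ‖z‖ • (x : E3) ∈ interior (cone A))⟩
  rw [← hx]; exact hz

lemma isClosed_cone {A : Set S2} (hA : IsClosed A) : IsClosed (cone A) := by
  have h1 : IsClosed {p : E3 × S2 | p.2 ∈ A ∧ p.1 = ‖p.1‖ • (p.2 : E3)} :=
    (hA.preimage continuous_snd).inter (isClosed_eq (by fun_prop) (by fun_prop))
  have h2 := isClosedMap_fst_of_compactSpace _ h1
  have e : cone A = {0} ∪ Prod.fst '' {p : E3 × S2 | p.2 ∈ A ∧ p.1 = ‖p.1‖ • (p.2 : E3)} := by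
    ext z
    constructor
    · rintro (h | ⟨x, hx, h⟩)
      · exact Or.inl h
      · exact Or.inr ⟨(z, x), ⟨hx, h⟩, rfl⟩
    · rintro (h | ⟨⟨w, x⟩, ⟨hx, h⟩, rfl⟩)
      · exact Or.inl h
      · exact Or.inr ⟨x, hx, h⟩
  rw [e]
  exact isClosed_singleton.union h2

lemma IsClosedConvexWithInterior.body {A : Set S2} (hA : IsClosedConvexWithInterior A)
    (hA' : A ≠ univ) : Body (cone A) where
  closed := isClosed_cone hA.isClosed
  add := by
    rintro z (rfl | ⟨x, hx, hz⟩) w (rfl | ⟨y, hy, hw⟩)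
    · exact Or.inl (add_zero _)
    · rw [zero_add]; exact Or.inr ⟨y, hy, hw⟩
    · rw [add_zero]; exact Or.inr ⟨x, hx, hz⟩
    by_cases h : x = -y
    · have e : z + w = (‖w‖ - ‖z‖) • (y : E3) := by
        nth_rewrite 1 [hz]; nth_rewrite 1 [hw]
        rw [h]
        simp only [coe_neg_sphere, smul_neg]
        module
      rcases le_total ‖z‖ ‖w‖ with h' | h'
      · rw [e]; exact smul_mem_cone hy (by linarith)
      · have e' : z + w = (‖z‖ - ‖w‖) • (x : E3) := by
          rw [e, h]; simp only [coe_neg_sphere, smul_neg]; module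
        rw [e']; exact smul_mem_cone hx (by linarith)
    · by_cases h0 : z + w = 0
      · exact Or.inl h0
      obtain ⟨v, hv⟩ := exists_eq_smul_coe h0
      refine Or.inr ⟨v, hA.shorterArc_subset x hx y hy h ⟨‖z + w‖⁻¹ * ‖z‖, ‖z + w‖⁻¹ * ‖w‖,
        by positivity, by positivity, ?_⟩, hv⟩
      rw [mul_smul, mul_smul, ← smul_add, ← hz, ← hw]
      nth_rewrite 2 [hv]
      rw [smul_smul, inv_mul_cancel₀ (norm_ne_zero_iff.2 h0), one_smul]
  smul := by
    rintro t ht z (rfl | ⟨x, hx, hz⟩)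
    · exact Or.inl (smul_zero t)
    · rw [hz, smul_smul]; exact smul_mem_cone hx (mul_nonneg ht (norm_nonneg _))
  int := interior_cone_nonempty hA.nonempty_interior
  ne := by
    intro h
    apply hA'
    ext x
    rw [← coe_mem_cone, h]
    simp

/-- Symmetric small intersections on the sphere in terms of cones. -/
lemma SmallIntersectionsSatisfy.smallSym {P : Set S2 → Prop} {Q : (E3 ≃ₗᵢ[ℝ] E3) → Prop}
    (hPQ : ∀ A, P A → ∃ g, Q g ∧ act g '' A = A) {K L : Set S2}
    (h : SmallIntersectionsSatisfy P K L) : SmallSym Q (cone K) (cone L) := by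
  obtain ⟨ε, hε, h⟩ := h
  have hπ := Real.pi_pos
  have hm : 0 < min ε Real.pi := lt_min hε hπ
  refine ⟨Real.cos (min ε Real.pi), ?_, fun φ hφ h1 h2 => ?_⟩
  · rw [← Real.cos_zero]
    exact Real.cos_lt_cos_of_nonneg_of_le_pi le_rfl (min_le_right _ _) hm
  have hid : act (LinearIsometryEquiv.refl ℝ E3) '' K = K := by
    have : act (LinearIsometryEquiv.refl ℝ E3) = id := by ext x; rfl
    rw [this, image_id]
  rw [cone_act, cone_inter] at h1 h2 ⊢
  have h' := h (LinearIsometryEquiv.refl ℝ E3) φ op_refl hφ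
  rw [hid] at h'
  obtain ⟨g, hg, e⟩ := hPQ _ (h' (interior_nonempty_of_cone h1) (by
    refine Real.sSup_le ?_ hε.le
    rintro _ ⟨x, hx, y, hy, rfl⟩
    have hc := h2 x (coe_mem_cone.2 hx) y (coe_mem_cone.2 hy) (norm_coe x) (norm_coe y)
    rw [sdist, InnerProductGeometry.angle, norm_coe, norm_coe, mul_one, div_one]
    refine (Real.arccos_le_arccos hc).trans ?_
    rw [Real.arccos_cos hm.le (min_le_right _ _)]
    exact min_le_left _ _))
  exact ⟨g, hg, by rw [cone_act, e]⟩

/-! ### Circles -/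

lemma mem_circle_iff {c x : S2} {r : ℝ} : x ∈ circle c r ↔ sdist c x ≤ r := Iff.rfl

lemma eq_circle_of_cone {A : Set S2} {N : E3} {c : ℝ} (hN : ‖N‖ = 1) (h0 : 0 ≤ c) (h1 : c < 1)
    (h : cone A = cap N c) : A = circle ⟨N, by simpa using hN⟩ (Real.arccos c) := by
  ext x
  have hcos : sdist ⟨N, by simpa using hN⟩ x = Real.arccos ⟪N, (x : E3)⟫ := by
    simp [sdist, InnerProductGeometry.angle, hN]
  rw [← coe_mem_cone, h, mem_circle_iff, hcos, cap, mem_ofPred, norm_coe, mul_one]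
  have hx := abs_le.1 (abs_real_inner_le_norm N (x : E3))
  rw [hN, norm_coe, mul_one] at hx
  exact (Real.strictAntiOn_arccos.le_iff_ge ⟨hx.1, hx.2⟩ ⟨by linarith, h1.le⟩).symm

lemma arccos_bounds {c : ℝ} (h0 : 0 ≤ c) (h1 : c < 1) :
    0 < Real.arccos c ∧ Real.arccos c ≤ Real.pi / 2 :=
  ⟨Real.arccos_pos.2 h1, Real.arccos_le_pi_div_two.2 h0⟩

lemma IsClosedConvexWithInterior.isCircle {K L : Set S2} (hK : IsClosedConvexWithInterior K)
    (hK' : K ≠ univ) (hL : IsClosedConvexWithInterior L) (hL' : L ≠ univ)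
    (hS : SmallSym (· ≠ LinearIsometryEquiv.refl ℝ E3) (cone K) (cone L)) : IsCircle K := by
  obtain ⟨N, c, hN, h0, h1, e⟩ := hS.exists_cap (hK.body hK') (hL.body hL')
  exact ⟨_, _, (arccos_bounds h0 h1).1, (arccos_bounds h0 h1).2, eq_circle_of_cone hN h0 h1 e⟩

lemma HasAxisOfSymmetry.hasNontrivialSymmetry {A : Set S2} (h : HasAxisOfSymmetry A) :
    HasNontrivialSymmetry A := by
  obtain ⟨u, hu⟩ := h
  refine ⟨_, fun e => ?_, hu⟩
  have h1 : (ℝ ∙ (u : E3))ᗮ.reflection (u : E3) = -u :=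
    Submodule.reflection_orthogonalComplement_singleton_eq_neg (u : E3)
  rw [e] at h1
  have h2 : (u : E3) = -u := h1
  have h3 := norm_coe u
  have h4 : ⟪(u : E3), (u : E3)⟫ = -⟪(u : E3), (u : E3)⟫ := by
    nth_rewrite 2 [h2]; rw [inner_neg_right]
  rw [real_inner_self_eq_norm_sq, h3] at h4
  norm_num at h4

/-- An isometry of order two that fixes the centres of two circles maps their intersection onto
itself. -/
lemma act_circle_inter {g : E3 ≃ₗᵢ[ℝ] E3} (hg : ∀ z, g (g z) = z) {c d : S2}
    (hc : g c = c) (hd : g d = d) (r s : ℝ) :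
    act g '' (circle c r ∩ circle d s) = circle c r ∩ circle d s := by
  have hinv : ∀ x, act g (act g x) = x := fun x => Subtype.ext (hg x)
  have hdist : ∀ {e : S2}, g e = e → ∀ x, sdist e (act g x) = sdist e x := fun he x => by
    unfold sdist
    conv_lhs => rw [← he]
    exact g.toLinearIsometry.angle_map _ _
  have hmem : ∀ x ∈ circle c r ∩ circle d s, act g x ∈ circle c r ∩ circle d s := fun x hx =>
    ⟨by rw [mem_circle_iff, hdist hc]; exact hx.1, by rw [mem_circle_iff, hdist hd]; exact hx.2⟩
  refine subset_antisymm (image_subset_iff.2 hmem) fun x hx => ⟨_, hmem x hx, hinv x⟩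

lemma act_circle (φ : E3 ≃ₗᵢ[ℝ] E3) (c : S2) (r : ℝ) :
    act φ '' circle c r = circle (act φ c) r := by
  ext x
  rw [mem_act_image, mem_circle_iff, mem_circle_iff]
  conv_rhs => rw [← act_act_symm φ x]
  unfold sdist
  rw [show InnerProductGeometry.angle (act φ c : E3) (act φ (act φ.symm x) : E3) =
    InnerProductGeometry.angle (c : E3) (act φ.symm x : E3) from
      φ.toLinearIsometry.angle_map _ _]

/-- Two vectors of three-space have a common perpendicular. -/
lemma exists_perp (a b : E3) : ∃ u : S2, ⟪(u : E3), a⟫ = 0 ∧ ⟪(u : E3), b⟫ = 0 := by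
  obtain ⟨w, hw, h⟩ : ∃ w : E3, w ≠ 0 ∧ w ∈ (Submodule.span ℝ {a, b})ᗮ := by
    have h1 := (Submodule.span ℝ {a, b}).finrank_add_finrank_orthogonal
    have h2 : Module.finrank ℝ (Submodule.span ℝ {a, b}) ≤ 2 := by
      have := finrank_span_finset_le_card (R := ℝ) ({a, b} : Finset E3)
      rw [Finset.coe_pair] at this
      exact this.trans Finset.card_le_two
    rw [finrank_euclideanSpace_fin] at h1
    obtain ⟨w, hw, hw0⟩ := (Submodule.ne_bot_iff _).1
      (fun h => by rw [h, finrank_bot] at h1; omega :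
        (Submodule.span ℝ {a, b})ᗮ ≠ ⊥)
    exact ⟨w, hw0, hw⟩
  obtain ⟨u, hu⟩ := exists_eq_smul_coe hw
  have key : ∀ x ∈ ({a, b} : Set E3), ⟪(u : E3), x⟫ = 0 := fun x hx => by
    have := (Submodule.mem_orthogonal' _ _).1 h x (Submodule.subset_span hx)
    rw [hu, inner_smul_left] at this
    exact (mul_eq_zero.1 this).resolve_left (norm_ne_zero_iff.2 hw)
  exact ⟨u, key a (by simp), key b (by simp)⟩

lemma hasAxisOfSymmetry_circle_inter (c d : S2) (r s : ℝ) :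
    HasAxisOfSymmetry (circle c r ∩ circle d s) := by
  obtain ⟨u, hc, hd⟩ := exists_perp c d
  exact ⟨u, act_circle_inter (Submodule.reflection_reflection _) (refl_of_inner_eq_zero hc)
    (refl_of_inner_eq_zero hd) r s⟩

lemma IsCentrallySymmetric.exists_halfTurn {A : Set S2} (h : IsCentrallySymmetric A) :
    ∃ g, IsHalfTurn g ∧ act g '' A = A := by
  obtain ⟨c, hc⟩ := h
  refine ⟨_, ⟨c, norm_coe c, fun z => ?_⟩, hc⟩
  rw [Submodule.reflection_singleton_apply]
  simp only [norm_coe, RCLike.ofReal_real_eq_id, id, one_pow, div_one]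
  module

end SphericalPlane

theorem theorem3 (K L : Set SphericalPlane.S2)
    (hK : SphericalPlane.IsClosedConvexWithInterior K) (hK' : K ≠ Set.univ)
    (hL : SphericalPlane.IsClosedConvexWithInterior L) (hL' : L ≠ Set.univ) :
    List.TFAE
      [SphericalPlane.SmallIntersectionsSatisfy SphericalPlane.HasNontrivialSymmetry K L,
       SphericalPlane.SmallIntersectionsSatisfy SphericalPlane.HasAxisOfSymmetry K L,
       SphericalPlane.IsCircle K ∧ SphericalPlane.IsCircle L] ∧
    (SphericalPlane.SmallIntersectionsSatisfy SphericalPlane.IsCentrallySymmetric K L →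
      SphericalPlane.AreCongruentCircles K L) := by
  open SphericalPlane in
  refine ⟨?_, fun h => ?_⟩
  · tfae_have 1 → 3 := fun h => by
      have hS := h.smallSym (Q := (· ≠ LinearIsometryEquiv.refl ℝ E3)) fun _ hA => hA
      exact ⟨hK.isCircle hK' hL hL' hS, hL.isCircle hL' hK hK' (hS.swap ne_refl_conj)⟩
    tfae_have 3 → 2 := by
      rintro ⟨⟨c, r, -, -, rfl⟩, d, s, -, -, rfl⟩
      refine ⟨1, one_pos, fun φ ψ _ _ _ _ => ?_⟩
      rw [act_circle, act_circle]
      exact hasAxisOfSymmetry_circle_inter _ _ _ _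
    tfae_have 2 → 1 := by
      rintro ⟨ε, hε, h⟩
      exact ⟨ε, hε, fun φ ψ h1 h2 h3 h4 => (h φ ψ h1 h2 h3 h4).hasNontrivialSymmetry⟩
    tfae_finish
  · have hS := h.smallSym fun _ hA => hA.exists_halfTurn
    have hS' := hS.mono fun _ hg => hg.ne_refl
    have bK := hK.body hK'
    have bL := hL.body hL'
    obtain ⟨N, c, hN, hc0, hc1, eK⟩ := hS'.exists_cap bK bL
    obtain ⟨M, d, hM, hd0, hd1, eL⟩ := (hS'.swap ne_refl_conj).exists_cap bL bK
    have hcd : c = d := by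
      rcases hc0.eq_or_lt with h0 | h0
      · rcases hd0.eq_or_lt with h1 | h1
        · rw [← h0, ← h1]
        · exact (cap_radius_eq bL bK hM hN h1 hc0 eL eK (hS.swap IsHalfTurn.conj)).symm
      · exact cap_radius_eq bK bL hN hM h0 hd0 eK eL hS
    exact ⟨_, _, _, (arccos_bounds hc0 hc1).1, (arccos_bounds hc0 hc1).2,
      eq_circle_of_cone hN hc0 hc1 eK, eq_circle_of_cone hM hc0 hc1 (hcd ▸ eL)⟩
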